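/- Graphs are finite multigraphs (parallel edges allowed). A drawing of a graph in the plane represents the vertices by distinct points and the edges by simple polygonal curves joining their ends (a loop by a simple closed polygonal curve), such that no edge passes through a vertex and no three edges cross in a common point. A crossing is an intersection point of two edges other than a common end, and the crossing number $\operatorname{cr}(G)$ is the minimum number of crossings in a drawing of $G$ in the plane. For a positive integer $c$, a graph $G$ is $c$-crossing-critical if $\operatorname{cr}(G)\ge c$ and $\operatorname{cr}(G')<c$ for every proper subgraph $G'$ of $G$. A $t$-thick edge $uv$ is a bunch of $t$ parallel edges joining two distinct vertices $u$ and $v$. Let $G$ be a $13$-crossing-critical graph, and let $s\in V(G)$ be a vertex incident with exactly two $4$-thick edges $st_1$, $st_2$, one ordinary edge $st_3$ (these are nine different edges), and no other edges. Let $G_1$ be the graph obtained from $G$ by the 4-to-3 expansion of $s$: remove $s$ with its incident edges, and add three new vertices $s^1,s^2,s^3$, two $4$-thick edges $s^1t_1$ and $s^2t_2$, one $3$-thick edge $s^1s^2$, and three ordinary edges $s^3s^1$, $s^3s^2$, $s^3t_3$. Then $G_1$ is also $13$-crossing-critical. -/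

import Mathlib

open Set

/-- The plane `ℝ²`. -/
abbrev Plane : Type := ℝ × ℝ

/-- The curve `γ`, restricted to `[0,1]`, is polygonal: for some subdivision
`0 = t 0 ≤ t 1 ≤ ⋯ ≤ t n = 1` it is affine on each interval `[t i, t (i+1)]`. -/
def IsPolygonal (γ : ℝ → Plane) : Prop :=
  ∃ (n : ℕ) (t : ℕ → ℝ), Monotone t ∧ t 0 = 0 ∧ t n = 1 ∧
    ∀ i < n, ∀ u ∈ Icc (0 : ℝ) 1,
      γ (AffineMap.lineMap (t i) (t (i + 1)) u) =
        AffineMap.lineMap (γ (t i)) (γ (t (i + 1))) u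

namespace Graph

universe u v

/-- A drawing of the multigraph `G` in the plane. Vertices are distinct points, edges are simple
polygonal curves joining their ends, no edge passes through a vertex, and no three edges cross in a
common point.

As the interior of an edge avoids all vertices and the vertices are distinct points, injectivity on
the open interval says that a non-loop edge is injective on `[0,1]` and that a loop is a simple
closed curve. -/
structure Drawing {α : Type u} {β : Type v} (G : Graph α β) where
  /-- the point representing a vertex -/
  pos : α → Plane
  /-- the curve representing an edge, parametrized by `[0,1]` -/
  curve : β → ℝ → Plane
  pos_injOn : InjOn pos G.vertexSet
  polygonal : ∀ e ∈ G.edgeSet, IsPolygonal (curve e)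
  joins : ∀ e ∈ G.edgeSet, ∃ x y, G.IsLink e x y ∧ curve e 0 = pos x ∧ curve e 1 = pos y
  simple : ∀ e ∈ G.edgeSet, InjOn (curve e) (Ioo 0 1)
  avoids : ∀ e ∈ G.edgeSet, ∀ x ∈ G.vertexSet, pos x ∉ curve e '' Ioo 0 1
  no_triple : ∀ e ∈ G.edgeSet, ∀ f ∈ G.edgeSet, ∀ g ∈ G.edgeSet, e ≠ f → e ≠ g → f ≠ g →
    ∀ p, ¬ (p ∈ curve e '' Ioo 0 1 ∧ p ∈ curve f '' Ioo 0 1 ∧ p ∈ curve g '' Ioo 0 1)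

/-- The crossings of a drawing: the points common to two distinct edges, other than a common end
of them. Since no edge passes through a vertex, these are the common points of the interiors. -/
def Drawing.crossings {α : Type u} {β : Type v} {G : Graph α β} (D : G.Drawing) : Set Plane :=
  {p | ∃ e ∈ G.edgeSet, ∃ f ∈ G.edgeSet, e ≠ f ∧
    p ∈ D.curve e '' Ioo 0 1 ∧ p ∈ D.curve f '' Ioo 0 1}

/-- The crossing number of `G`: the least number of crossings in a drawing of `G`. -/
noncomputable def crossingNumber {α : Type u} {β : Type v} (G : Graph α β) : ℕ∞ :=
  ⨅ D : G.Drawing, D.crossings.encard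

/-- `G` is `c`-crossing-critical: its crossing number is at least `c`, and every proper subgraph
has crossing number less than `c`. -/
def IsCrossingCritical {α : Type u} {β : Type v} (c : ℕ) (G : Graph α β) : Prop :=
  (c : ℕ∞) ≤ G.crossingNumber ∧ ∀ H : Graph α β, H < G → H.crossingNumber < (c : ℕ∞)

/-- The set `F` is a bunch of `k` parallel edges between the two vertices `x` and `y`,
that is, it forms a `k`-thick edge `xy`. -/
def IsThickEdge {α : Type u} {β : Type v} (G : Graph α β) (k : ℕ) (x y : α) (F : Set β) : Prop :=
  x ≠ y ∧ F.encard = k ∧ ∀ e ∈ F, G.IsLink e x y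

/-- The vertex `s` is incident exactly with two `4`-thick edges `st₁`, `st₂` and one ordinary
(`1`-thick) edge `st₃`. -/
def IsExpandable {α : Type u} {β : Type v} (G : Graph α β) (s t₁ t₂ t₃ : α) : Prop :=
  ∃ F₁ F₂ F₃ : Set β,
    G.IsThickEdge 4 s t₁ F₁ ∧ G.IsThickEdge 4 s t₂ F₂ ∧ G.IsThickEdge 1 s t₃ F₃ ∧
    Disjoint F₁ F₂ ∧ Disjoint F₁ F₃ ∧ Disjoint F₂ F₃ ∧
    ∀ e, G.Inc e s ↔ e ∈ F₁ ∪ F₂ ∪ F₃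

/-- The three new vertices `s¹`, `s²`, `s³` of a 4-to-3 expansion. -/
inductive NewVertex : Type
  | s1
  | s2
  | s3

/-- The new edges of a 4-to-3 expansion: the `4`-thick edges `s¹t₁` and `s²t₂`, the `3`-thick edge
`s¹s²`, and the ordinary edges `s³s¹`, `s³s²`, `s³t₃`. -/
inductive NewEdge : Type
  | s1t1 (i : Fin 4)
  | s2t2 (i : Fin 4)
  | s1s2 (i : Fin 3)
  | s3s1
  | s3s2
  | s3t3

/-- The ends of the new edges. -/
def NewEdge.ends {α : Type u} (t₁ t₂ t₃ : α) : NewEdge → Sym2 (α ⊕ NewVertex)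
  | s1t1 _ => s(.inr .s1, .inl t₁)
  | s2t2 _ => s(.inr .s2, .inl t₂)
  | s1s2 _ => s(.inr .s1, .inr .s2)
  | s3s1 => s(.inr .s3, .inr .s1)
  | s3s2 => s(.inr .s3, .inr .s2)
  | s3t3 => s(.inr .s3, .inl t₃)

theorem IsThickEdge.right_mem {α : Type u} {β : Type v} {G : Graph α β} {k : ℕ} {x y : α}
    {F : Set β} (h : G.IsThickEdge k x y F) (hk : k ≠ 0) : y ∈ G.vertexSet \ {x} := by
  obtain ⟨hxy, hF, hl⟩ := h
  obtain ⟨e, he⟩ : F.Nonempty := by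
    rw [← encard_ne_zero, hF]
    exact_mod_cast hk
  exact ⟨(hl e he).right_mem, fun h => hxy h.symm⟩

/-- The ends of an edge of the expansion. An old edge keeps its ends; only old edges
of `G - s` are edges of the expansion, see `expansion`. -/
def ExpansionLink {α : Type u} {β : Type v} (G : Graph α β) (s t₁ t₂ t₃ : α) :
    β ⊕ NewEdge → α ⊕ NewVertex → α ⊕ NewVertex → Prop
  | .inl e, p, q => ∃ x y, (G.deleteVerts {s}).IsLink e x y ∧ p = .inl x ∧ q = .inl y
  | .inr n, p, q => s(p, q) = n.ends t₁ t₂ t₃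

/-- The 4-to-3 expansion of the vertex `s` of `G`: remove `s` together with its incident edges, and
add the new vertices and the new edges. -/
def expansion {α : Type u} {β : Type v} (G : Graph α β) (s t₁ t₂ t₃ : α)
    (h : G.IsExpandable s t₁ t₂ t₃) : Graph (α ⊕ NewVertex) (β ⊕ NewEdge) where
  vertexSet := Sum.inl '' (G.vertexSet \ {s}) ∪ range Sum.inr
  IsLink := G.ExpansionLink s t₁ t₂ t₃
  isLink_symm := by
    rintro (e | n) -
    · refine ⟨?_⟩
      rintro p q ⟨x, y, hl, rfl, rfl⟩
      exact ⟨y, x, hl.symm, rfl, rfl⟩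
    · refine ⟨?_⟩
      intro p q hpq
      exact Sym2.eq_swap.trans hpq
  eq_or_eq_of_isLink_of_isLink := by
    rintro (e | n) p q p' q'
    · rintro ⟨x, y, hl, rfl, rfl⟩ ⟨x', y', hl', rfl, rfl⟩
      rcases hl.left_eq_or_eq hl' with h | h
      · exact Or.inl (congrArg _ h)
      · exact Or.inr (congrArg _ h)
    · intro h₁ h₂
      have h₃ : s(p, q) = s(p', q') := Eq.trans h₁ (Eq.symm h₂)
      rcases Sym2.eq_iff.1 h₃ with h | h
      · exact Or.inl h.1
      · exact Or.inr h.1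
  left_mem_of_isLink := by
    obtain ⟨F₁, F₂, F₃, h₁, h₂, h₃, -⟩ := h
    have m₁ := h₁.right_mem (by norm_num)
    have m₂ := h₂.right_mem (by norm_num)
    have m₃ := h₃.right_mem (by norm_num)
    rintro (e | n) p q
    · rintro ⟨x, y, hl, rfl, rfl⟩
      exact Or.inl ⟨x, by simpa using hl.left_mem, rfl⟩
    · intro hn
      have hp : p ∈ NewEdge.ends t₁ t₂ t₃ n := by
        rw [← show s(p, q) = _ from hn]
        exact Sym2.mem_mk_left p q
      cases n <;> rcases Sym2.mem_iff.1 hp with rfl | rfl <;>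
        first
        | exact Or.inr ⟨_, rfl⟩
        | exact Or.inl ⟨_, m₁, rfl⟩
        | exact Or.inl ⟨_, m₂, rfl⟩
        | exact Or.inl ⟨_, m₃, rfl⟩

end Graph

/-!
All redrawing is done on finite families of polygonal curves in the plane (`Pic`), whose curves
carry weights: a curve of weight `w` stands for a bunch of `w` parallel edges. The number of
crossings after replacing each curve by as many parallel copies as its weight says is half its
`cost`. Passing between drawings of graphs and weighted families rests on two facts.

* A bunch of parallel edges can be redrawn along its cheapest member without an increase of the
  number of crossings (`exists_representatives`, `exists_pic_of_crossingNumber_lt`).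
* Conversely, a curve can be replaced by parallel copies (`Pic.thicken`, `crossingNumber_lt`). The
  geometric core is `IsArc.exists_two_sided`: along an arc there are two parallel arcs, one on
  each side, which together meet any other curve at most twice per crossing with the arc. No
  transversality is needed, since only the sum over both sides is bounded. It is proved by pushing
  the vertices of a polygonal path along normals (`exists_pushoff`).

*The crossing number of the expansion is at least 13.* Suppose that there is a drawing with at
most 12 crossings. After bundling, `s³s¹` and `s³s²` are made disjoint by moving `s³` to their
last crossing (`Pic.exists_disjoint`). The original graph can then be drawn in three ways
(`Pic.exists_star`): with `s` at `s¹`, where the bunch to `t₂` runs along `s¹s²` and `s²t₂`;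
symmetrically with `s` at `s²`; and with `s` at `s³`, where the two thick edges run along `s³s¹`
and `s³s²`. Each of these drawings has at least 13 crossings, and the resulting linear
inequalities for the numbers of crossings between the bunches have no solution in integers
(`expansion_arithmetic`).

*Every proper subgraph has crossing number at most 12.* A critical graph has no isolated vertices,
so it suffices to delete one edge of the expansion. Some edge of the original graph is deleted as
well, the rest has a drawing with at most 12 crossings, and its edges at `s` are bundled. The
vertex `s²` is placed at `s`, the vertex `s¹` on the thick edge `st₁`, and the vertex `s³` on
`st₃` close to `s`. The triangle is completed by arcs parallel to the path `s³ s² s¹`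
(`Pic.exists_triangle`).

* If an old edge or an edge of a 4-thick edge is missing, `s¹` is placed so close to `s` that the
  part of the thick edge between `s` and `s¹` is not crossed; this part may then have any weight.
* If an edge of the triangle is missing, an edge of the thick edge `st₁` is deleted (or one of
  `st₂`, with the roles of `s¹` and `s²` exchanged), and `s¹` is placed close to `t₁`. The three
  remaining edges provide for the bunch `s¹s²` and, if that bunch lacks an edge, for `s³s¹` on one
  side of it.
* If `s³t₃` is missing, `st₃` is deleted, `s¹` is placed close to `s`, and `s³` on a copy of the
  uncrossed part `ss¹`.
-/

namespace PlaneDrawing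

/-! ### Polygonal curves and arcs -/

/-- The curve `γ` is affine on the parameter interval `[a, b]`. -/
def AffOn (γ : ℝ → Plane) (a b : ℝ) : Prop :=
  ∀ u ∈ Icc (0 : ℝ) 1, γ (a + u * (b - a)) = γ a + u • (γ b - γ a)

theorem affOn_iff_lineMap {γ : ℝ → Plane} {a b : ℝ} :
    AffOn γ a b ↔ ∀ u ∈ Icc (0 : ℝ) 1,
      γ (AffineMap.lineMap a b u) = AffineMap.lineMap (γ a) (γ b) u := by
  unfold AffOn
  refine forall₂_congr fun u _ => ?_
  rw [AffineMap.lineMap_apply_module', AffineMap.lineMap_apply_module', smul_eq_mul,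
    add_comm (u * _), add_comm (u • _)]

theorem AffOn.sub {γ : ℝ → Plane} {a b a' b' : ℝ} (h : AffOn γ a b) (h1 : a ≤ a') (h2 : a' ≤ b')
    (h3 : b' ≤ b) : AffOn γ a' b' := by
  rcases eq_or_lt_of_le (h1.trans (h2.trans h3)) with hab | hab
  · have e1 : a' = a := le_antisymm (by linarith) h1
    have e2 : b' = a := le_antisymm (by linarith) (by linarith)
    subst e1; subst e2
    intro u _
    simp
  have hba : 0 < b - a := by linarith
  -- every parameter in `[a, b]` has the form `a + r * (b - a)`
  have key : ∀ t, a ≤ t → t ≤ b → γ t = γ a + ((t - a) / (b - a)) • (γ b - γ a) := by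
    intro t hat htb
    have := h ((t - a) / (b - a)) ⟨div_nonneg (by linarith) hba.le,
      by rw [div_le_one hba]; linarith⟩
    rwa [div_mul_cancel₀ _ hba.ne', add_sub_cancel] at this
  intro u hu
  have hm0 : 0 ≤ u * (b' - a') := mul_nonneg hu.1 (by linarith)
  have hm1 : u * (b' - a') ≤ b' - a' := mul_le_of_le_one_left (by linarith) hu.2
  rw [key (a' + u * (b' - a')) (by linarith) (by linarith), key a' h1 (by linarith),
    key b' (by linarith) h3, add_sub_add_left_eq_sub, ← sub_smul, smul_smul, add_assoc, ← add_smul]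
  congr 2
  field_simp
  ring

theorem AffOn.comp_affine {γ : ℝ → Plane} {a b : ℝ} (c d : ℝ) (h : AffOn γ (c * a + d) (c * b + d)) :
    AffOn (fun t => γ (c * t + d)) a b := by
  intro u hu
  have := h u hu
  simp only
  rw [← this]
  congr 1
  ring

theorem AffOn.congr {γ γ' : ℝ → Plane} {a b : ℝ} (hab : a ≤ b) (h : AffOn γ a b)
    (hc : ∀ t ∈ Icc a b, γ' t = γ t) : AffOn γ' a b := by
  intro u hu
  have hm0 : 0 ≤ u * (b - a) := mul_nonneg hu.1 (by linarith)
  have hm1 : u * (b - a) ≤ b - a := mul_le_of_le_one_left (by linarith) hu.2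
  rw [hc _ ⟨by linarith, by linarith⟩, hc a ⟨le_rfl, hab⟩, hc b ⟨hab, le_rfl⟩]
  exact h u hu

theorem AffOn.symm {γ : ℝ → Plane} {a b : ℝ} (h : AffOn γ a b) : AffOn γ b a := by
  intro u hu
  have := h (1 - u) ⟨by linarith [hu.2], by linarith [hu.1]⟩
  rw [show b + u * (a - b) = a + (1 - u) * (b - a) by ring, this, sub_smul, one_smul]
  rw [smul_sub, smul_sub]
  abel

theorem AffOn.image_eq {γ : ℝ → Plane} {a b : ℝ} (hab : a ≤ b) (h : AffOn γ a b) :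
    γ '' Icc a b = segment ℝ (γ a) (γ b) := by
  rw [segment_eq_image']
  ext p
  constructor
  · rintro ⟨t, ht, rfl⟩
    rcases eq_or_lt_of_le hab with rfl | hlt
    · exact ⟨0, by simp, by simp [le_antisymm ht.1 ht.2]⟩
    have hba : 0 < b - a := by linarith
    have h' := h ((t - a) / (b - a)) ⟨div_nonneg (by linarith [ht.1]) hba.le,
      by rw [div_le_one hba]; linarith [ht.2]⟩
    rw [div_mul_cancel₀ _ hba.ne', add_sub_cancel] at h'
    exact ⟨(t - a) / (b - a), ⟨div_nonneg (by linarith [ht.1]) hba.le,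
      by rw [div_le_one hba]; linarith [ht.2]⟩, h'.symm⟩
  · rintro ⟨u, hu, rfl⟩
    have hm0 : 0 ≤ u * (b - a) := mul_nonneg hu.1 (by linarith)
    have hm1 : u * (b - a) ≤ b - a := mul_le_of_le_one_left (by linarith) hu.2
    exact ⟨a + u * (b - a), ⟨by linarith, by linarith⟩, h u hu⟩

/-- A finite set of parameters containing `0` and `1` cuts `[0, 1]` into consecutive intervals. -/
theorem exists_partition (T : Finset ℝ) (hT : ∀ x ∈ T, x ∈ Icc (0 : ℝ) 1) (h0 : (0 : ℝ) ∈ T)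
    (h1 : (1 : ℝ) ∈ T) :
    ∃ (n : ℕ) (t : ℕ → ℝ), Monotone t ∧ t 0 = 0 ∧ t n = 1 ∧ (∀ i < n, t i < t (i + 1)) ∧
      (∀ i, t i ∈ T) ∧ (∀ x ∈ T, ∃ i ≤ n, t i = x) ∧
      ∀ i < n, ∀ x ∈ T, x ≤ t i ∨ t (i + 1) ≤ x := by
  have hc : 0 < T.card := Finset.card_pos.2 ⟨0, h0⟩
  let e := T.orderEmbOfFin rfl
  have hmem : ∀ i, e i ∈ T := fun i => T.orderEmbOfFin_mem rfl i
  have hsurj : ∀ x ∈ T, ∃ i, e i = x := by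
    intro x hx
    have : x ∈ Set.range e := by rw [Finset.range_orderEmbOfFin]; exact hx
    exact this
  let c : ℕ → Fin T.card := fun i => ⟨min i (T.card - 1), by omega⟩
  have hcm : Monotone c := fun i j hij => by
    simp only [c, Fin.mk_le_mk]
    omega
  have hck : ∀ k : Fin T.card, c k = k := fun k => by
    ext
    simp only [c]
    omega
  have hc0 : ∀ k : Fin T.card, c 0 ≤ k := fun k => by
    simp only [c, Fin.le_def]
    omega
  have hcl : ∀ k : Fin T.card, k ≤ c (T.card - 1) := fun k => by
    simp only [c, Fin.le_def]
    omega
  refine ⟨T.card - 1, fun i => e (c i), fun i j hij => e.monotone (hcm hij), ?_, ?_, ?_, fun i => hmem _,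
    ?_, ?_⟩
  · obtain ⟨i, hi⟩ := hsurj 0 h0
    exact le_antisymm (hi ▸ e.monotone (hc0 i)) (hT _ (hmem _)).1
  · obtain ⟨i, hi⟩ := hsurj 1 h1
    exact le_antisymm (hT _ (hmem _)).2 (hi ▸ e.monotone (hcl i))
  · intro i hi
    refine e.strictMono ?_
    simp only [c, Fin.mk_lt_mk]
    omega
  · intro x hx
    obtain ⟨i, hi⟩ := hsurj x hx
    exact ⟨i, by omega, (congrArg e (hck i)).trans hi⟩
  · intro i hi x hx
    obtain ⟨k, rfl⟩ := hsurj x hx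
    rcases le_or_gt (k : ℕ) i with h | h
    · left
      refine e.monotone ?_
      simp only [c, Fin.le_def]
      omega
    · right
      refine e.monotone ?_
      simp only [c, Fin.le_def]
      omega

/-- A curve is polygonal iff it is affine on every interval that is not cut by one of finitely many
breakpoints. -/
theorem isPolygonal_iff {γ : ℝ → Plane} : IsPolygonal γ ↔ ∃ B : Finset ℝ, ∀ a b, 0 ≤ a → a ≤ b →
    b ≤ 1 → (∀ x ∈ B, x ≤ a ∨ b ≤ x) → AffOn γ a b := by
  constructor
  · rintro ⟨n, t, hm, h0, hn, h⟩
    refine ⟨(Finset.range (n + 1)).image t, fun a b ha hab hb hB => ?_⟩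
    rcases eq_or_lt_of_le hab with rfl | hlt
    · intro u _
      simp
    have hex : ∃ i, i ≤ n ∧ b ≤ t i := ⟨n, le_rfl, by rw [hn]; exact hb⟩
    classical
    obtain ⟨hin, hbi⟩ := Nat.find_spec hex
    have hmin := fun m => Nat.find_min (H := hex) (m := m)
    generalize Nat.find hex = i at hin hbi hmin
    rcases i with _ | i
    · linarith
    have hi : ¬ b ≤ t i := fun hc => hmin i (Nat.lt_succ_self i) ⟨by omega, hc⟩
    have hia : t i ≤ a := by
      rcases hB (t i) (Finset.mem_image.2 ⟨i, Finset.mem_range.2 (by omega), rfl⟩) with h' | h'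
      · exact h'
      · exact absurd h' hi
    exact (affOn_iff_lineMap.2 (h i (by omega))).sub hia hab hbi
  · rintro ⟨B, hB⟩
    classical
    obtain ⟨n, t, hm, h0, hn, -, hmem, -, hgap⟩ := exists_partition
      (insert 0 (insert 1 (B.filter (· ∈ Icc (0 : ℝ) 1)))) (by
        intro x hx
        simp only [Finset.mem_insert, Finset.mem_filter] at hx
        rcases hx with rfl | rfl | hx
        · simp
        · simp
        · exact hx.2) (by simp) (by simp)
    have hI : ∀ i, 0 ≤ t i := fun i => h0 ▸ hm (Nat.zero_le i)
    refine ⟨n, t, hm, h0, hn, fun i hi => affOn_iff_lineMap.1 ?_⟩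
    have hle : t (i + 1) ≤ 1 := hn ▸ hm (by omega)
    refine hB _ _ (hI i) (hm (Nat.le_succ i)) hle fun x hx => ?_
    by_cases hx' : x ∈ Icc (0 : ℝ) 1
    · exact hgap i hi x (by simp [hx, hx'.1, hx'.2])
    · rw [mem_Icc, not_and_or, not_le, not_le] at hx'
      rcases hx' with hx' | hx'
      · exact Or.inl (hx'.le.trans (hI i))
      · exact Or.inr (hle.trans hx'.le)

theorem isPolygonal_segment (p q : Plane) : IsPolygonal fun t : ℝ => p + t • (q - p) := by
  refine isPolygonal_iff.2 ⟨∅, fun a b _ _ _ _ u _ => ?_⟩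
  simp only
  module

/-- Restricting a polygonal curve to a parameter interval, possibly traversed backwards. -/
theorem _root_.IsPolygonal.comp_affine {γ : ℝ → Plane} (h : IsPolygonal γ) {c d : ℝ} (hc : c ≠ 0)
    (h0 : d ∈ Icc (0 : ℝ) 1) (h1 : c + d ∈ Icc (0 : ℝ) 1) : IsPolygonal fun t => γ (c * t + d) := by
  obtain ⟨B, hB⟩ := isPolygonal_iff.1 h
  classical
  refine isPolygonal_iff.2 ⟨B.image fun x => (x - d) / c, fun a b ha hab hb hx => ?_⟩
  refine AffOn.comp_affine c d ?_
  have hx' : ∀ x ∈ B, (x - d) / c ≤ a ∨ b ≤ (x - d) / c := fun x hxB =>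
    hx _ (Finset.mem_image_of_mem _ hxB)
  rcases lt_or_gt_of_ne hc with hneg | hpos
  · refine (hB _ _ ?_ ?_ ?_ fun x hxB => ?_).symm
    · nlinarith [h0.1, h1.1]
    · nlinarith
    · nlinarith [h0.2, h1.2]
    · rcases hx' x hxB with h' | h'
      · right
        rw [div_le_iff_of_neg hneg] at h'
        linarith
      · left
        rw [le_div_iff_of_neg hneg] at h'
        linarith
  · refine hB _ _ ?_ ?_ ?_ fun x hxB => ?_
    · nlinarith [h0.1, h1.1]
    · nlinarith
    · nlinarith [h0.2, h1.2]
    · rcases hx' x hxB with h' | h'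
      · left
        rw [div_le_iff₀ hpos] at h'
        linarith
      · right
        rw [le_div_iff₀ hpos] at h'
        linarith

theorem _root_.IsPolygonal.continuousOn {γ : ℝ → Plane} (h : IsPolygonal γ) :
    ContinuousOn γ (Icc 0 1) := by
  obtain ⟨n, t, hm, h0, hn, h⟩ := h
  have key : ∀ k ≤ n, ContinuousOn γ (Icc 0 (t k)) := by
    intro k
    induction k with
    | zero => intro _; rw [h0, Icc_self]; exact continuousOn_singleton _ _
    | succ k ih =>
      intro hk
      have hk0 : 0 ≤ t k := h0 ▸ hm (Nat.zero_le k)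
      have hkk := hm (Nat.le_succ k)
      rw [← Icc_union_Icc_eq_Icc hk0 hkk]
      refine (ih (by omega)).union_of_isClosed ?_ isClosed_Icc isClosed_Icc
      rcases eq_or_lt_of_le hkk with he | hlt
      · rw [← he, Icc_self]; exact continuousOn_singleton _ _
      have hd : 0 < t (k + 1) - t k := by linarith
      have ha := affOn_iff_lineMap.2 (h k (by omega))
      refine ContinuousOn.congr (f := fun s => γ (t k) + ((s - t k) / (t (k + 1) - t k)) •
        (γ (t (k + 1)) - γ (t k))) (by fun_prop) fun s hs => ?_
      have := ha ((s - t k) / (t (k + 1) - t k)) ⟨div_nonneg (by linarith [hs.1]) hd.le,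
        by rw [div_le_one hd]; linarith [hs.2]⟩
      rwa [div_mul_cancel₀ _ hd.ne', add_sub_cancel] at this
  simpa [hn] using key n le_rfl

/-- Two polygonal curves, the second starting at the end of the first, can be concatenated. -/
theorem isPolygonal_concat {γ δ : ℝ → Plane} (hγ : IsPolygonal γ) (hδ : IsPolygonal δ)
    (h : γ 1 = δ 0) :
    IsPolygonal fun t => if t ≤ 1 / 2 then γ (2 * t) else δ (2 * t - 1) := by
  obtain ⟨B, hB⟩ := isPolygonal_iff.1 hγ
  obtain ⟨C, hC⟩ := isPolygonal_iff.1 hδ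
  classical
  refine isPolygonal_iff.2 ⟨insert (1 / 2) ((B.image fun x => x / 2) ∪ C.image fun x => (x + 1) / 2),
    fun a b ha hab hb hx => ?_⟩
  have hB' : ∀ x ∈ B, x / 2 ≤ a ∨ b ≤ x / 2 := fun x hxB => hx _ (by
    simp only [Finset.mem_insert, Finset.mem_union, Finset.mem_image]
    exact Or.inr (Or.inl ⟨x, hxB, rfl⟩))
  have hC' : ∀ x ∈ C, (x + 1) / 2 ≤ a ∨ b ≤ (x + 1) / 2 := fun x hxB => hx _ (by
    simp only [Finset.mem_insert, Finset.mem_union, Finset.mem_image]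
    exact Or.inr (Or.inr ⟨x, hxB, rfl⟩))
  rcases hx (1 / 2) (by simp) with h2 | h2
  · refine AffOn.congr hab (γ := fun t => δ (2 * t + (-1))) (AffOn.comp_affine 2 (-1)
      (hC _ _ (by linarith) (by linarith) (by linarith) fun x hxC => ?_)) fun t ht => ?_
    · rcases hC' x hxC with h' | h'
      · left; linarith
      · right; linarith
    · split_ifs with h3
      · have : t = 1 / 2 := le_antisymm h3 (h2.trans ht.1)
        subst this
        norm_num [h]
      · rw [sub_eq_add_neg]
  · refine AffOn.congr hab (γ := fun t => γ (2 * t + 0)) (AffOn.comp_affine 2 0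
      (hB _ _ (by linarith) (by linarith) (by linarith) fun x hxC => ?_)) fun t ht => ?_
    · rcases hB' x hxC with h' | h'
      · left; linarith
      · right; linarith
    · rw [if_pos (ht.2.trans h2), add_zero]

/-- A simple polygonal arc from `x` to `y`. -/
structure IsArc (γ : ℝ → Plane) (x y : Plane) : Prop where
  polygonal : IsPolygonal γ
  inj : InjOn γ (Icc 0 1)
  left : γ 0 = x
  right : γ 1 = y

theorem image_Icc_eq (γ : ℝ → Plane) : γ '' Icc 0 1 = insert (γ 0) (insert (γ 1) (γ '' Ioo 0 1)) := by
  rw [← image_insert_eq, ← image_insert_eq]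
  congr 1
  ext t
  simp only [mem_Icc, mem_insert_iff, mem_Ioo]
  constructor
  · rintro ⟨h0, h1⟩
    rcases eq_or_lt_of_le h0 with h | h
    · exact Or.inl h.symm
    rcases eq_or_lt_of_le h1 with h' | h'
    · exact Or.inr (Or.inl h')
    · exact Or.inr (Or.inr ⟨h, h'⟩)
  · rintro (rfl | rfl | h)
    · simp
    · simp
    · exact ⟨h.1.le, h.2.le⟩

theorem IsPolygonal.isCompact_image {γ : ℝ → Plane} (h : IsPolygonal γ) :
    IsCompact (γ '' Icc 0 1) := isCompact_Icc.image_of_continuousOn h.continuousOn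

namespace IsArc
variable {γ δ : ℝ → Plane} {x y z : Plane}

theorem ne (h : IsArc γ x y) : x ≠ y := by
  intro hxy
  have := h.inj (by simp) (by simp) ((h.left.trans hxy).trans h.right.symm)
  norm_num at this

theorem image_Icc (h : IsArc γ x y) : γ '' Icc 0 1 = insert x (insert y (γ '' Ioo 0 1)) := by
  rw [image_Icc_eq, h.left, h.right]

theorem left_mem (h : IsArc γ x y) : x ∈ γ '' Icc 0 1 := ⟨0, by simp, h.left⟩

theorem left_notMem (h : IsArc γ x y) : x ∉ γ '' Ioo 0 1 := by
  rintro ⟨t, ht, he⟩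
  have := h.inj ⟨ht.1.le, ht.2.le⟩ (by simp) (he.trans h.left.symm)
  exact ht.1.ne' this

theorem right_notMem (h : IsArc γ x y) : y ∉ γ '' Ioo 0 1 := by
  rintro ⟨t, ht, he⟩
  have := h.inj ⟨ht.1.le, ht.2.le⟩ (by simp) (he.trans h.right.symm)
  exact ht.2.ne this

theorem injOn_Ioo (h : IsArc γ x y) : InjOn γ (Ioo 0 1) := h.inj.mono Ioo_subset_Icc_self

/-- The part of an arc between the parameters `a` and `b`. -/
theorem sub (h : IsArc γ x y) {a b : ℝ} (ha : 0 ≤ a) (hab : a < b) (hb : b ≤ 1) :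
    IsArc (fun t => γ ((b - a) * t + a)) (γ a) (γ b) where
  polygonal := h.polygonal.comp_affine (by linarith) ⟨ha, by linarith⟩ ⟨by linarith, by linarith⟩
  inj := by
    intro s hs t ht hst
    have hd : 0 < b - a := by linarith
    have hI : ∀ r ∈ Icc (0 : ℝ) 1, (b - a) * r + a ∈ Icc (0 : ℝ) 1 := fun r hr =>
      ⟨by nlinarith [hr.1], by nlinarith [hr.2]⟩
    have := h.inj (hI s hs) (hI t ht) hst
    have h' : (b - a) * s = (b - a) * t := by linarith
    exact mul_left_cancel₀ hd.ne' h'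
  left := by simp
  right := by simp

theorem _root_.PlaneDrawing.image_sub_Ioo (γ : ℝ → Plane) {a b : ℝ} (hab : a < b) :
    (fun t => γ ((b - a) * t + a)) '' Ioo 0 1 = γ '' Ioo a b := by
  rw [show (fun t => γ ((b - a) * t + a)) = γ ∘ fun t => (b - a) * t + a from rfl, image_comp,
    image_affine_Ioo (by linarith)]
  simp

theorem _root_.PlaneDrawing.image_sub_Icc (γ : ℝ → Plane) {a b : ℝ} (hab : a < b) :
    (fun t => γ ((b - a) * t + a)) '' Icc 0 1 = γ '' Icc a b := by
  rw [show (fun t => γ ((b - a) * t + a)) = γ ∘ fun t => (b - a) * t + a from rfl, image_comp,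
    image_affine_Icc' (by linarith)]
  simp

theorem reverse (h : IsArc γ x y) :
    ∃ δ, IsArc δ y x ∧ δ '' Ioo 0 1 = γ '' Ioo 0 1 := by
  refine ⟨fun t => γ (-1 * t + 1), ⟨h.polygonal.comp_affine (by norm_num) (by simp) (by simp), ?_, by
    simp [h.right], by simp [h.left]⟩, ?_⟩
  · intro s hs t ht hst
    have hI : ∀ r ∈ Icc (0 : ℝ) 1, -1 * r + 1 ∈ Icc (0 : ℝ) 1 := fun r hr =>
      ⟨by linarith [hr.2], by linarith [hr.1]⟩
    have := h.inj (hI s hs) (hI t ht) hst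
    linarith
  · ext p
    constructor
    · rintro ⟨t, ht, rfl⟩
      exact ⟨-1 * t + 1, ⟨by linarith [ht.2], by linarith [ht.1]⟩, rfl⟩
    · rintro ⟨t, ht, rfl⟩
      exact ⟨1 - t, ⟨by linarith [ht.2], by linarith [ht.1]⟩, by simp⟩

/-- Concatenation of two arcs that meet only at the common end. -/
theorem concat (h : IsArc γ x y) (h' : IsArc δ y z)
    (hd : ∀ p ∈ γ '' Icc 0 1, p ∈ δ '' Icc 0 1 → p = y) :
    ∃ ε, IsArc ε x z ∧ ε '' Ioo 0 1 = γ '' Ioo 0 1 ∪ {y} ∪ δ '' Ioo 0 1 := by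
  refine ⟨fun t => if t ≤ 1 / 2 then γ (2 * t) else δ (2 * t - 1),
    ⟨isPolygonal_concat h.polygonal h'.polygonal (h.right.trans h'.left.symm), ?_, ?_, ?_⟩, ?_⟩
  · have hy : ∀ s ∈ Icc (0 : ℝ) 1, ∀ t ∈ Icc (0 : ℝ) 1, s ≤ 1 / 2 → ¬ t ≤ 1 / 2 →
        γ (2 * s) ≠ δ (2 * t - 1) := by
      intro s hs t ht hs2 ht2 he
      have h1 := hd (γ (2 * s)) ⟨2 * s, ⟨by linarith [hs.1], by linarith⟩, rfl⟩
        ⟨2 * t - 1, ⟨by linarith, by linarith [ht.2]⟩, he.symm⟩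
      have := h'.inj ⟨by linarith, by linarith [ht.2]⟩ (by simp)
        (he.symm.trans (h1.trans h'.left.symm))
      linarith
    intro s hs t ht hst
    simp only at hst
    split_ifs at hst with h1 h2 h2
    · have := h.inj ⟨by linarith [hs.1], by linarith⟩ ⟨by linarith [ht.1], by linarith⟩ hst
      linarith
    · exact absurd hst (hy s hs t ht h1 h2)
    · exact absurd hst.symm (hy t ht s hs h2 h1)
    · have := h'.inj ⟨by linarith [hs.1], by linarith [hs.2]⟩ ⟨by linarith [ht.1], by linarith [ht.2]⟩
        hst
      linarith
  · norm_num [h.left]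
  · norm_num [h'.right]
  · ext p
    simp only [mem_image, mem_union, mem_singleton_iff]
    constructor
    · rintro ⟨t, ht, rfl⟩
      split_ifs with h1
      · rcases eq_or_lt_of_le h1 with rfl | h2
        · left; right; norm_num [h.right]
        · left; left; exact ⟨2 * t, ⟨by linarith [ht.1], by linarith⟩, rfl⟩
      · right; exact ⟨2 * t - 1, ⟨by linarith, by linarith [ht.2]⟩, rfl⟩
    · rintro ((⟨t, ht, rfl⟩ | rfl) | ⟨t, ht, rfl⟩)
      · refine ⟨t / 2, ⟨by linarith [ht.1], by linarith [ht.2]⟩, ?_⟩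
        rw [if_pos (by linarith [ht.2])]
        congr 1; ring
      · exact ⟨1 / 2, by norm_num, by norm_num [h.right]⟩
      · refine ⟨(t + 1) / 2, ⟨by linarith [ht.1], by linarith [ht.2]⟩, ?_⟩
        rw [if_neg (by linarith [ht.1])]
        congr 1; ring

/-- Two arcs `x → y → z`, which may cross each other, contain a simple arc `x → z`: the first arc is
left at its first point on the second one. -/
theorem merge (h : IsArc γ x y) (h' : IsArc δ y z) (hx : x ∉ δ '' Icc 0 1) (hz : z ∉ γ '' Icc 0 1) :
    ∃ ε, IsArc ε x z ∧ ε '' Ioo 0 1 ⊆ γ '' Ioo 0 1 ∪ {y} ∪ δ '' Ioo 0 1 := by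
  have hcl : IsCompact (Icc (0 : ℝ) 1 ∩ γ ⁻¹' (δ '' Icc 0 1)) :=
    isCompact_Icc.of_isClosed_subset
      (h.polygonal.continuousOn.preimage_isClosed_of_isClosed isClosed_Icc
        (IsPolygonal.isCompact_image h'.polygonal).isClosed) inter_subset_left
  obtain ⟨a, ⟨haI, u, huI, hua⟩, hmin⟩ := hcl.exists_isLeast
    ⟨1, by simp, by rw [mem_preimage, h.right]; exact h'.left_mem⟩
  have ha0 : 0 < a := by
    refine lt_of_le_of_ne haI.1 ?_
    rintro rfl
    exact hx ⟨u, huI, hua.trans h.left⟩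
  have hu1 : u < 1 := by
    refine lt_of_le_of_ne huI.2 ?_
    rintro rfl
    exact hz ⟨a, haI, hua.symm.trans h'.right⟩
  have A := h.sub le_rfl ha0 haI.2
  have B := h'.sub huI.1 hu1 le_rfl
  rw [h.left] at A
  rw [h'.right, hua] at B
  obtain ⟨ε, hε, him⟩ := A.concat B (by
    rw [image_sub_Icc γ ha0, image_sub_Icc δ hu1]
    rintro p ⟨t, ht, rfl⟩ ⟨v, hv, hvp⟩
    have := hmin ⟨⟨ht.1, ht.2.trans haI.2⟩, v, ⟨huI.1.trans hv.1, hv.2⟩, hvp⟩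
    rw [le_antisymm ht.2 this])
  refine ⟨ε, hε, ?_⟩
  rw [him, image_sub_Ioo γ ha0, image_sub_Ioo δ hu1]
  rintro p ((⟨t, ht, rfl⟩ | hp) | ⟨t, ht, rfl⟩)
  · exact Or.inl (Or.inl ⟨t, ⟨ht.1, ht.2.trans_le haI.2⟩, rfl⟩)
  · rw [mem_singleton_iff] at hp
    subst hp
    rcases eq_or_lt_of_le haI.2 with rfl | h1
    · exact Or.inl (Or.inr h.right)
    · exact Or.inl (Or.inl ⟨a, ⟨ha0, h1⟩, rfl⟩)
  · exact Or.inr ⟨t, ⟨huI.1.trans_lt ht.1, ht.2⟩, rfl⟩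

end IsArc

/-- A nondegenerate segment is an arc. -/
theorem isArc_segment {p q : Plane} (h : p ≠ q) : IsArc (fun t : ℝ => p + t • (q - p)) p q where
  polygonal := isPolygonal_segment p q
  inj := by
    intro s _ t _ hst
    have : s • (q - p) = t • (q - p) := add_left_cancel hst
    exact smul_left_injective ℝ (sub_ne_zero.2 h.symm) this
  left := by simp
  right := by simp

/-! ### Cross products, sides of a path, and polygonal paths -/

section

open Filter Topology

/-- The signed area of the parallelogram spanned by two vectors. -/
def cr (a b : Plane) : ℝ := a.1 * b.2 - a.2 * b.1

/-- The Euclidean inner product. -/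
def dot (a b : Plane) : ℝ := a.1 * b.1 + a.2 * b.2

theorem continuous_cr {X : Type*} [TopologicalSpace X] {f g : X → Plane} (hf : Continuous f)
    (hg : Continuous g) : Continuous fun x => cr (f x) (g x) := by
  unfold cr; fun_prop

theorem continuous_dot {X : Type*} [TopologicalSpace X] {f g : X → Plane} (hf : Continuous f)
    (hg : Continuous g) : Continuous fun x => dot (f x) (g x) := by
  unfold dot; fun_prop

@[simp] theorem cr_self (a : Plane) : cr a a = 0 := by unfold cr; ring

theorem cr_add_left (a b c : Plane) : cr (a + b) c = cr a c + cr b c := by simp [cr]; ring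

theorem cr_add_right (a b c : Plane) : cr a (b + c) = cr a b + cr a c := by simp [cr]; ring

theorem cr_smul_left (t : ℝ) (b c : Plane) : cr (t • b) c = t * cr b c := by simp [cr]; ring

theorem cr_smul_right (t : ℝ) (b c : Plane) : cr b (t • c) = t * cr b c := by simp [cr]; ring

theorem cr_comm (a b : Plane) : cr a b = -cr b a := by unfold cr; ring

theorem dot_smul_right (t : ℝ) (b c : Plane) : dot b (t • c) = t * dot b c := by simp [dot]; ring

theorem dot_self_pos {a : Plane} (h : a ≠ 0) : 0 < dot a a := by
  unfold dot
  by_contra hc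
  refine h (Prod.ext ?_ ?_) <;> simp only [Prod.fst_zero, Prod.snd_zero] <;> nlinarith [sq_nonneg a.1, sq_nonneg a.2]

theorem mem_segment_iff {p a b : Plane} :
    p ∈ segment ℝ a b ↔ ∃ u ∈ Icc (0 : ℝ) 1, p = a + u • (b - a) := by
  rw [segment_eq_image']
  constructor
  · rintro ⟨u, hu, rfl⟩
    exact ⟨u, hu, rfl⟩
  · rintro ⟨u, hu, rfl⟩
    exact ⟨u, hu, rfl⟩

/-- The vectors `a` and `b` do not point in the same direction. -/
def NotSame (a b : Plane) : Prop := cr a b ≠ 0 ∨ dot a b < 0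

theorem NotSame.symm {a b : Plane} (h : NotSame a b) : NotSame b a := by
  rcases h with h | h
  · left; rw [cr_comm]; simpa using h
  · right; unfold dot at h ⊢; linarith

theorem exists_smul_of_cr_eq_zero {a b : Plane} (ha : a ≠ 0) (h : cr a b = 0) :
    b = (dot a b / dot a a) • a := by
  have hp := dot_self_pos ha
  have h1 : dot a a * b.1 = dot a b * a.1 := by
    unfold cr dot at *
    linear_combination (-a.2) * h
  have h2 : dot a a * b.2 = dot a b * a.2 := by
    unfold cr dot at *
    linear_combination (a.1) * h
  refine Prod.ext ?_ ?_
  · simp only [Prod.smul_fst, smul_eq_mul]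
    field_simp
    linarith
  · simp only [Prod.smul_snd, smul_eq_mul]
    field_simp
    linarith

theorem notSame_of_inter {p a b : Plane} (ha : a ≠ p) (hb : b ≠ p)
    (h : segment ℝ p a ∩ segment ℝ p b ⊆ {p}) : NotSame (a - p) (b - p) := by
  by_contra hc
  unfold NotSame at hc
  push Not at hc
  obtain ⟨h0, h1⟩ := hc
  have ha' : a - p ≠ 0 := sub_ne_zero.2 ha
  have hb' : b - p ≠ 0 := sub_ne_zero.2 hb
  have hp := dot_self_pos ha'
  have he := exists_smul_of_cr_eq_zero ha' h0
  set r := dot (a - p) (b - p) / dot (a - p) (a - p) with hr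
  have hr0 : 0 ≤ r := div_nonneg h1 hp.le
  have hr1 : 0 < r := by
    refine lt_of_le_of_ne hr0 fun h' => hb' ?_
    rw [he, ← h', zero_smul]
  -- the shorter of the two vectors ends in a second common point
  rcases le_total r 1 with hle | hle
  · have : b ∈ ({p} : Set Plane) := h ⟨mem_segment_iff.2 ⟨r, ⟨hr0, hle⟩, by rw [← he]; abel⟩,
      right_mem_segment ℝ _ _⟩
    exact hb this
  · have : a ∈ ({p} : Set Plane) := h ⟨right_mem_segment ℝ _ _,
      mem_segment_iff.2 ⟨r⁻¹, ⟨inv_nonneg.2 hr0, inv_le_one_of_one_le₀ hle⟩, by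
        rw [he, smul_smul, inv_mul_cancel₀ hr1.ne', one_smul]; abel⟩⟩
    exact ha this

theorem NotSame.inter {p a b : Plane} (h : NotSame (a - p) (b - p)) :
    segment ℝ p a ∩ segment ℝ p b ⊆ {p} := by
  rintro q ⟨h1, h2⟩
  obtain ⟨s, hs, rfl⟩ := mem_segment_iff.1 h1
  obtain ⟨t, ht, he⟩ := mem_segment_iff.1 h2
  have he : s • (a - p) = t • (b - p) := add_left_cancel he
  suffices s • (a - p) = 0 by rw [mem_singleton_iff, this, add_zero]
  rcases h with h | h
  · have := cr_smul_left s (a - p) (b - p)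
    rw [he, cr_smul_left, cr_self, mul_zero] at this
    rcases mul_eq_zero.1 this.symm with h0 | h0
    · rw [h0, zero_smul]
    · exact absurd h0 h
  · have h3 : a - p ≠ 0 := by
      intro h0
      rw [h0] at h
      simp [dot] at h
    have h4 := dot_smul_right s (a - p) (a - p)
    rw [he, dot_smul_right] at h4
    have h5 := dot_self_pos h3
    have : s * dot (a - p) (a - p) = 0 := le_antisymm
      (by rw [← h4]; exact mul_nonpos_of_nonneg_of_nonpos ht.1 h.le) (mul_nonneg hs.1 h5.le)
    rcases mul_eq_zero.1 this with h0 | h0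
    · rw [h0, zero_smul]
    · exact absurd h0 h5.ne'

theorem NotSame.eventually {X : Type*} [TopologicalSpace X] {f g : X → Plane} {x : X}
    (hf : Continuous f) (hg : Continuous g) (h : NotSame (f x) (g x)) :
    ∀ᶠ y in 𝓝 x, NotSame (f y) (g y) := by
  rcases h with h | h
  · exact ((continuous_cr hf hg).continuousAt.eventually_ne h).mono fun y hy => Or.inl hy
  · exact ((continuous_dot hf hg).continuousAt.eventually_lt continuousAt_const h).mono
      fun y hy => Or.inr hy

theorem eventually_disjoint_segment {Q : Set Plane} (hQ : IsClosed Q) {f g : ℝ → Plane} {x : ℝ}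
    (hf : Continuous f) (hg : Continuous g) (h : Disjoint Q (segment ℝ (f x) (g x))) :
    ∀ᶠ y in 𝓝 x, Disjoint Q (segment ℝ (f y) (g y)) := by
  have hc : Continuous fun z : ℝ × ℝ => f z.1 + z.2 • (g z.1 - f z.1) := by fun_prop
  have := isCompact_Icc.eventually_forall_of_forall_eventually (x₀ := x) (K := Icc (0 : ℝ) 1)
    (P := fun y u => f y + u • (g y - f y) ∉ Q) fun u hu => by
      have : f x + u • (g x - f x) ∈ Qᶜ := fun hq =>
        disjoint_left.1 h hq (mem_segment_iff.2 ⟨u, hu, rfl⟩)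
      exact hc.continuousAt.eventually_mem (hQ.isOpen_compl.mem_nhds this)
  refine this.mono fun y hy => disjoint_right.2 fun p hp => ?_
  obtain ⟨u, hu, rfl⟩ := mem_segment_iff.1 hp
  exact hy u hu

theorem eventually_pos {f : ℝ → ℝ} (hf : Continuous f) (h : 0 < f 0) :
    ∀ᶠ ε in 𝓝[>] (0 : ℝ), 0 < f ε :=
  (continuousAt_const.eventually_lt hf.continuousAt h).filter_mono nhdsWithin_le_nhds

theorem segment_inter_subsingleton {q q' v z : Plane} (h : cr (q' - q) (z - v) ≠ 0) :
    (segment ℝ q q' ∩ segment ℝ v z).Subsingleton := by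
  rintro p ⟨h1, h2⟩ p' ⟨h1', h2'⟩
  obtain ⟨s, -, hs⟩ := mem_segment_iff.1 h1
  obtain ⟨t, -, ht⟩ := mem_segment_iff.1 h2
  obtain ⟨s', -, hs'⟩ := mem_segment_iff.1 h1'
  obtain ⟨t', -, ht'⟩ := mem_segment_iff.1 h2'
  have e1 : p - p' = (s - s') • (q' - q) := by rw [hs, hs']; module
  have e2 : p - p' = (t - t') • (z - v) := by rw [ht, ht']; module
  have := cr_smul_left (s - s') (q' - q) (z - v)
  rw [← e1, e2, cr_smul_left, cr_self, mul_zero] at this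
  rcases mul_eq_zero.1 this.symm with h0 | h0
  · rw [h0, zero_smul] at e1
    exact sub_eq_zero.1 e1
  · exact absurd h0 h

/-- The half of the sector at `v` on the side `σ` that lies between the direction of `w` and the
normal direction `m`: the segment from `v` to `z` starts there. -/
def HalfSide (σ : ℝ) (v w m z : Plane) : Prop :=
  0 < σ * cr (w - v) (z - v) ∧ σ * cr m (z - v) ≤ 0

/-- How the pushed segment from `v + ε m` to `w + ε m'` meets a segment issuing from `v`: not at
all, unless this segment starts between the segment `vw` and the normal `m`. -/
theorem eventually_pushed_germ {σ : ℝ} {v w m m' z : Plane} (hvw : v ≠ w)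
    (hm : 0 < σ * cr (w - v) m) (hm' : 0 < σ * cr (w - v) m' ∨ m' = 0)
    (hz : segment ℝ v z ∩ segment ℝ v w ⊆ {v}) :
    ∀ᶠ ε in 𝓝[>] (0 : ℝ),
      (¬ HalfSide σ v w m z → Disjoint (segment ℝ (v + ε • m) (w + ε • m')) (segment ℝ v z)) ∧
      (segment ℝ (v + ε • m) (w + ε • m') ∩ segment ℝ v z).Subsingleton ∧
      (cr m (z - v) = 0 →
        segment ℝ (v + ε • m) (w + ε • m') ∩ segment ℝ v z ⊆ {v + ε • m}) := by
  have hpos : ∀ᶠ ε in 𝓝[>] (0 : ℝ), 0 < ε := eventually_mem_nhdsWithin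
  by_cases h1 : 0 < σ * cr (w - v) (z - v)
  swap
  · have key : ∀ᶠ ε in 𝓝[>] (0 : ℝ),
        Disjoint (segment ℝ (v + ε • m) (w + ε • m')) (segment ℝ v z) := by
      refine hpos.mono fun ε hε => disjoint_left.2 fun p hp hp' => ?_
      have hp'' := hp'
      obtain ⟨u, hu, rfl⟩ := mem_segment_iff.1 hp
      obtain ⟨t, ht, he⟩ := mem_segment_iff.1 hp'
      have e1 : (v + ε • m + u • (w + ε • m' - (v + ε • m))) - v =
          u • (w - v) + ((1 - u) * ε) • m + (u * ε) • m' := by module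
      have e2 : (v + ε • m + u • (w + ε • m' - (v + ε • m))) - v = t • (z - v) := by
        rw [he]; module
      have e3 := congrArg (fun x => σ * cr (w - v) x) (e1.symm.trans e2)
      simp only [cr_add_right, cr_smul_right, cr_self] at e3
      have h3 : t * (σ * cr (w - v) (z - v)) ≤ 0 :=
        mul_nonpos_of_nonneg_of_nonpos ht.1 (not_lt.1 h1)
      have h4 : 0 ≤ (1 - u) * ε * (σ * cr (w - v) m) :=
        mul_nonneg (mul_nonneg (by linarith [hu.2]) hε.le) hm.le
      have hu1 : u = 1 ∧ ¬ 0 < σ * cr (w - v) m' := by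
        rcases eq_or_lt_of_le hu.2 with h5 | h5
        · refine ⟨h5, fun h6 => ?_⟩
          have : 0 < u * ε * (σ * cr (w - v) m') := by rw [h5]; positivity
          nlinarith
        · exfalso
          have h6 : 0 < (1 - u) * ε * (σ * cr (w - v) m) :=
            mul_pos (mul_pos (by linarith) hε) hm
          have h7 : 0 ≤ u * ε * (σ * cr (w - v) m') := by
            rcases hm' with h7 | h7
            · exact mul_nonneg (mul_nonneg hu.1 hε.le) h7.le
            · simp [h7, cr]
          nlinarith
      have hm0 : m' = 0 := hm'.resolve_left hu1.2
      have : w ∈ ({v} : Set Plane) := by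
        refine hz ⟨?_, right_mem_segment ℝ _ _⟩
        convert hp'' using 1
        rw [hu1.1, hm0]
        module
      exact hvw (mem_singleton_iff.1 this).symm
    refine key.mono fun ε h => ⟨fun _ => h, ?_, fun _ => ?_⟩
    · rw [disjoint_iff_inter_eq_empty.1 h]; exact subsingleton_empty
    · rw [disjoint_iff_inter_eq_empty.1 h]; exact empty_subset _
  have hcont : ∀ c : Plane, Continuous fun ε : ℝ => c + ε • m' := fun c => by fun_prop
  have hne : ∀ᶠ ε in 𝓝[>] (0 : ℝ), 0 < σ * cr ((w + ε • m') - (v + ε • m)) (z - v) := by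
    refine eventually_pos (f := fun ε => σ * cr ((w + ε • m') - (v + ε • m)) (z - v))
      (continuous_const.mul (continuous_cr (by fun_prop) (by fun_prop))) (by simpa using h1)
  have hmd : σ * cr m (w - v) < 0 := by rw [cr_comm]; linarith
  have hsep : ∀ᶠ ε in 𝓝[>] (0 : ℝ), 0 < -(σ * cr m ((w + ε • m') - v)) := by
    refine eventually_pos (f := fun ε => -(σ * cr m ((w + ε • m') - v)))
      (continuous_const.mul (continuous_cr (by fun_prop) (by fun_prop))).neg
      (by simpa using hmd)
  filter_upwards [hne, hsep, hpos] with ε hne hsep hε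
  have hcr : cr ((w + ε • m') - (v + ε • m)) (z - v) ≠ 0 := fun h0 => by simp [h0] at hne
  refine ⟨fun hns => ?_, segment_inter_subsingleton hcr, fun h0 => ?_⟩
  · have h2 : 0 < σ * cr m (z - v) := by
      by_contra h2
      exact hns ⟨h1, not_lt.1 h2⟩
    refine disjoint_left.2 fun p hp hp' => ?_
    obtain ⟨u, hu, rfl⟩ := mem_segment_iff.1 hp
    obtain ⟨t, ht, he⟩ := mem_segment_iff.1 hp'
    have e1 : (v + ε • m + u • (w + ε • m' - (v + ε • m))) - v =
        u • ((w + ε • m') - v) + ((1 - u) * ε) • m := by module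
    have e2 : (v + ε • m + u • (w + ε • m' - (v + ε • m))) - v = t • (z - v) := by
      rw [he]; module
    have e3 := congrArg (fun x => σ * cr m x) (e1.symm.trans e2)
    simp only [cr_add_right, cr_smul_right, cr_self] at e3
    have h5 : 0 ≤ t * (σ * cr m (z - v)) := mul_nonneg ht.1 h2.le
    have h6 : 0 ≤ u * -(σ * cr m (w + ε • m' - v)) := mul_nonneg hu.1 hsep.le
    have h7 : t * (σ * cr m (z - v)) = 0 := by nlinarith
    have ht0 : t = 0 := by
      rcases mul_eq_zero.1 h7 with h8 | h8
      · exact h8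
      · exact absurd h8 h2.ne'
    have hu0 : u = 0 := by
      have h8 : u * -(σ * cr m (w + ε • m' - v)) = 0 := by nlinarith
      rcases mul_eq_zero.1 h8 with h9 | h9
      · exact h9
      · exact absurd h9 hsep.ne'
    have e4 := e1.symm.trans e2
    rw [ht0, hu0] at e4
    have e5 : ε • m = 0 := by simpa using e4
    rcases smul_eq_zero.1 e5 with h9 | h9
    · exact hε.ne' h9
    · simp [h9, cr] at hm
  · rintro p ⟨hp, hp'⟩
    obtain ⟨u, hu, rfl⟩ := mem_segment_iff.1 hp
    obtain ⟨t, ht, he⟩ := mem_segment_iff.1 hp'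
    have e1 : ε • m + u • (w + ε • m' - (v + ε • m)) = t • (z - v) := by
      have := congrArg (fun x => x - v) he
      rw [show v + ε • m + u • (w + ε • m' - (v + ε • m)) - v =
        ε • m + u • (w + ε • m' - (v + ε • m)) by module,
        show v + t • (z - v) - v = t • (z - v) by module] at this
      exact this
    have e3 := congrArg (fun x => cr x (z - v)) e1
    simp only [cr_add_left, cr_smul_left, cr_self, h0] at e3
    have : u * cr ((w + ε • m') - (v + ε • m)) (z - v) = 0 := by linarith
    rcases mul_eq_zero.1 this with h9 | h9
    · rw [h9]; simp
    · exact absurd h9 hcr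

/-- A pushed segment that still starts at `v` meets a segment issuing from `v` only there. -/
theorem eventually_pushed_end {v w m' z : Plane} (hvw : v ≠ w)
    (hz : segment ℝ v z ∩ segment ℝ v w ⊆ {v}) :
    ∀ᶠ ε in 𝓝[>] (0 : ℝ), segment ℝ v (w + ε • m') ∩ segment ℝ v z ⊆ {v} := by
  by_cases hzv : z = v
  · subst hzv
    exact Eventually.of_forall fun ε => by
      rw [segment_same]
      exact inter_subset_right
  have h := (notSame_of_inter hzv hvw.symm hz).symm
  have := NotSame.eventually (f := fun ε : ℝ => w + ε • m' - v) (g := fun _ => z - v) (x := 0)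
    (by fun_prop) (by fun_prop) (by simpa using h)
  exact (this.filter_mono nhdsWithin_le_nhds).mono fun ε hε => hε.inter

/-- The points `v 0, …, v n` are the vertices of a simple polygonal path. -/
structure IsPolyline (v : ℕ → Plane) (n : ℕ) : Prop where
  ne : ∀ k < n, v k ≠ v (k + 1)
  adj : ∀ k, k + 1 < n → segment ℝ (v k) (v (k + 1)) ∩ segment ℝ (v (k + 1)) (v (k + 2)) ⊆ {v (k + 1)}
  far : ∀ j k, j + 1 < k → k < n →
    Disjoint (segment ℝ (v j) (v (j + 1))) (segment ℝ (v k) (v (k + 1)))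

/-- The polygonal path with vertices `v 0, …, v n`. -/
def polyPath (v : ℕ → Plane) (n : ℕ) : Set Plane := ⋃ k < n, segment ℝ (v k) (v (k + 1))

theorem mem_polyPath {v : ℕ → Plane} {n : ℕ} {p : Plane} :
    p ∈ polyPath v n ↔ ∃ k < n, p ∈ segment ℝ (v k) (v (k + 1)) := by
  simp [polyPath]

theorem isCompact_segment (a b : Plane) : IsCompact (segment ℝ a b) := by
  rw [segment_eq_image']
  exact isCompact_Icc.image (by fun_prop)

theorem polyPath_succ (v : ℕ → Plane) (n : ℕ) :
    polyPath v (n + 1) = polyPath v n ∪ segment ℝ (v n) (v (n + 1)) := by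
  ext p
  simp only [mem_polyPath, mem_union]
  constructor
  · rintro ⟨k, hk, hp⟩
    rcases Nat.lt_succ_iff_lt_or_eq.1 hk with hk | rfl
    · exact Or.inl ⟨k, hk, hp⟩
    · exact Or.inr hp
  · rintro (⟨k, hk, hp⟩ | hp)
    · exact ⟨k, by omega, hp⟩
    · exact ⟨n, by omega, hp⟩

namespace IsPolyline
variable {v : ℕ → Plane} {n : ℕ}

theorem mono (h : IsPolyline v n) {k : ℕ} (hk : k ≤ n) : IsPolyline v k where
  ne j hj := h.ne j (by omega)
  adj j hj := h.adj j (by omega)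
  far i j hij hj := h.far i j hij (by omega)

theorem notMem_segment (h : IsPolyline v n) {k j : ℕ} (hk : k ≤ n) (hj : j < n) (h1 : j + 1 ≠ k)
    (h2 : j ≠ k) : v k ∉ segment ℝ (v j) (v (j + 1)) := by
  intro hm
  rcases lt_or_gt_of_ne h2 with hlt | hgt
  · obtain ⟨k, rfl⟩ : ∃ k', k = k' + 1 := ⟨k - 1, by omega⟩
    rcases eq_or_ne (j + 1) k with rfl | hne
    · exact h.ne (j + 1) (by omega) (h.adj j (by omega) ⟨hm, right_mem_segment ℝ _ _⟩).symm
    · exact disjoint_left.1 (h.far j k (by omega) (by omega)) hm (right_mem_segment ℝ _ _)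
  · rcases eq_or_ne (k + 1) j with rfl | hne
    · exact h.ne k (by omega) (h.adj k (by omega) ⟨left_mem_segment ℝ _ _, hm⟩)
    · exact disjoint_left.1 (h.far k j (by omega) (by omega)) (left_mem_segment ℝ _ _) hm

/-- A simple polygonal path is the image of an arc. -/
theorem exists_isArc (h : IsPolyline v n) (hn : 1 ≤ n) :
    ∃ γ, IsArc γ (v 0) (v n) ∧ γ '' Icc 0 1 = polyPath v n := by
  induction n, hn using Nat.le_induction with
  | base =>
    refine ⟨_, isArc_segment (h.ne 0 (by omega)), ?_⟩
    ext p
    rw [mem_polyPath, ← segment_eq_image']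
    simp
  | succ n hn ih =>
    obtain ⟨γ, hγ, him⟩ := ih (h.mono (by omega))
    have hs := isArc_segment (h.ne n (by omega))
    obtain ⟨ε, hε, hεim⟩ := hγ.concat hs (by
      rw [him, ← segment_eq_image']
      intro p hp hp'
      obtain ⟨k, hk, hpk⟩ := mem_polyPath.1 hp
      rcases eq_or_ne (k + 1) n with rfl | hne
      · exact h.adj k (by omega) ⟨hpk, hp'⟩
      · exact absurd hp' (disjoint_left.1 (h.far k n (by omega) (by omega)) hpk))
    refine ⟨ε, hε, ?_⟩
    have e1 := hγ.image_Icc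
    have e2 := hs.image_Icc
    rw [polyPath_succ, ← him, segment_eq_image', e1, e2, hε.image_Icc, hεim]
    ext p
    simp only [mem_insert_iff, mem_union, mem_singleton_iff]
    tauto

end IsPolyline

/-- The segment from `v` to `z` starts on the side `σ` of the path `… u v w …` with normal `m`
at `v`. -/
def OnSide (σ : ℝ) (u v w m z : Plane) : Prop :=
  HalfSide σ v w m z ∨ HalfSide (-σ) v u m z

/-- A segment does not start on both sides of a path. -/
theorem not_onSide_neg {u v w m z : Plane} {σ : ℝ} (h : OnSide σ u v w m z)
    (hm : 0 < σ * cr (w - v) m) (hm' : 0 < σ * cr (v - u) m) : ¬ OnSide (-σ) u v w (-m) z := by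
  have e : ∀ x, cr (-m) x = -cr m x := fun x => by unfold cr; simp; ring
  have e' : ∀ x, cr (v - u) x = -cr (u - v) x := fun x => by unfold cr; simp; ring
  rw [e'] at hm'
  have key : cr m (z - v) = 0 → ∃ r : ℝ, z - v = r • m := fun h0 => by
    have hm0 : m ≠ 0 := by rintro rfl; simp [cr] at hm
    exact ⟨_, exists_smul_of_cr_eq_zero hm0 h0⟩
  unfold OnSide HalfSide at *
  rw [e, neg_neg]
  rintro (h' | h') <;> rcases h with h | h
  · linarith [h.1, h'.1]
  · have h0 : σ * cr m (z - v) = 0 := by linarith [h.2, h'.2]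
    have h0 : cr m (z - v) = 0 := by
      rcases mul_eq_zero.1 h0 with h3 | h3
      · simp [h3] at hm
      · exact h3
    obtain ⟨r, hr⟩ := key h0
    have h1 := h.1
    have h2 := h'.1
    rw [hr, cr_smul_right] at h1 h2
    have : r < 0 := by nlinarith
    nlinarith
  · have h0 : σ * cr m (z - v) = 0 := by linarith [h.2, h'.2]
    have h0 : cr m (z - v) = 0 := by
      rcases mul_eq_zero.1 h0 with h3 | h3
      · simp [h3] at hm
      · exact h3
    obtain ⟨r, hr⟩ := key h0
    have h1 := h.1
    have h2 := h'.1
    rw [hr, cr_smul_right] at h1 h2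
    have : 0 < r := by nlinarith
    nlinarith
  · linarith [h.1, h'.1]

end

/-! ### A parallel copy of a polygonal path -/

section

open Filter Topology

/-- **Parallel arcs.** Pushing the inner vertices of a simple polygonal path a little to the side
`σ`, along the normals `m k`, gives an arc with the same ends that misses the rest of the path and
a given compact set `Q`. A segment issuing from a vertex of the path is met at most once, and only
if it issues from an inner vertex and starts on the side `σ`. -/
theorem exists_pushoff {v m : ℕ → Plane} {n : ℕ} {σ : ℝ} (hn : 2 ≤ n) (hv : IsPolyline v n)
    (hm0 : m 0 = 0) (hmn : m n = 0)
    (hm : ∀ k, k + 1 < n → 0 < σ * cr (v (k + 2) - v (k + 1)) (m (k + 1)) ∧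
      0 < σ * cr (v (k + 1) - v k) (m (k + 1)))
    {Q : Set Plane} (hQ : IsCompact Q) (hQv : Disjoint Q (polyPath v n))
    (germs : Set (ℕ × Plane)) (hfin : germs.Finite)
    (hg : ∀ g ∈ germs, g.1 ≤ n ∧ segment ℝ (v g.1) g.2 ∩ polyPath v n ⊆ {v g.1}) :
    ∃ γ, IsArc γ (v 0) (v n) ∧ Disjoint (γ '' Ioo 0 1) (polyPath v n) ∧ Disjoint (γ '' Ioo 0 1) Q ∧
      ∀ g ∈ germs, (γ '' Ioo 0 1 ∩ segment ℝ (v g.1) g.2).Subsingleton ∧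
        ((γ '' Ioo 0 1 ∩ segment ℝ (v g.1) g.2).Nonempty → ∃ k, g.1 = k + 1 ∧ k + 1 < n ∧
          OnSide σ (v k) (v (k + 1)) (v (k + 2)) (m (k + 1)) g.2) := by
  let q : ℝ → ℕ → Plane := fun ε k => v k + ε • m k
  have hqc : ∀ k, Continuous fun ε => q ε k := fun k => by
    simp only [q]; fun_prop
  have hq0 : ∀ k, q 0 k = v k := fun k => by simp [q]
  have hqa : ∀ ε, q ε 0 = v 0 := fun ε => by simp [q, hm0]
  have hqn : ∀ ε, q ε n = v n := fun ε => by simp [q, hmn]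
  have hneg : ∀ (a b m : Plane), -σ * cr (a - b) m = σ * cr (b - a) m := fun a b m => by
    unfold cr; simp; ring
  have fwd : ∀ k < n, 0 < σ * cr (v (k + 1) - v k) (m (k + 1)) ∨ m (k + 1) = 0 := by
    intro k hk
    rcases Nat.lt_or_ge (k + 1) n with h | h
    · exact Or.inl (hm k h).2
    · right; rw [show k + 1 = n by omega, hmn]
  have bwd : ∀ k < n, 0 < σ * cr (v (k + 1) - v k) (m k) ∨ m k = 0 := by
    intro k hk
    rcases k with _ | k
    · exact Or.inr hm0
    · exact Or.inl (hm k hk).1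
  have hcr0 : ∀ a : Plane, cr a 0 = 0 := fun a => by simp [cr]
  -- the two kinds of germs next to the pushed segment between the vertices `k` and `k + 1`
  have gfwd : ∀ k, k + 1 < n → ∀ z, segment ℝ (v (k + 1)) z ∩ polyPath v n ⊆ {v (k + 1)} →
      ∀ᶠ ε in 𝓝[>] (0 : ℝ),
      (¬ HalfSide σ (v (k + 1)) (v (k + 2)) (m (k + 1)) z →
        Disjoint (segment ℝ (q ε (k + 1)) (q ε (k + 2))) (segment ℝ (v (k + 1)) z)) ∧
      (segment ℝ (q ε (k + 1)) (q ε (k + 2)) ∩ segment ℝ (v (k + 1)) z).Subsingleton ∧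
      (cr (m (k + 1)) (z - v (k + 1)) = 0 →
        segment ℝ (q ε (k + 1)) (q ε (k + 2)) ∩ segment ℝ (v (k + 1)) z ⊆ {q ε (k + 1)}) := by
    intro k hk z hz
    exact eventually_pushed_germ (hv.ne _ hk) (hm k hk).1 (fwd _ hk) fun p hp =>
      hz ⟨hp.1, mem_polyPath.2 ⟨k + 1, hk, hp.2⟩⟩
  have gbwd : ∀ k, k + 1 < n → ∀ z, segment ℝ (v (k + 1)) z ∩ polyPath v n ⊆ {v (k + 1)} →
      ∀ᶠ ε in 𝓝[>] (0 : ℝ),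
      (¬ HalfSide (-σ) (v (k + 1)) (v k) (m (k + 1)) z →
        Disjoint (segment ℝ (q ε k) (q ε (k + 1))) (segment ℝ (v (k + 1)) z)) ∧
      (segment ℝ (q ε k) (q ε (k + 1)) ∩ segment ℝ (v (k + 1)) z).Subsingleton ∧
      (cr (m (k + 1)) (z - v (k + 1)) = 0 →
        segment ℝ (q ε k) (q ε (k + 1)) ∩ segment ℝ (v (k + 1)) z ⊆ {q ε (k + 1)}) := by
    intro k hk z hz
    have := eventually_pushed_germ (σ := -σ) (v := v (k + 1)) (w := v k) (m := m (k + 1))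
      (m' := m k) (z := z) (hv.ne k (by omega)).symm (by rw [hneg]; exact (hm k hk).2)
      (by rw [hneg]; exact bwd k (by omega)) fun p hp => hz ⟨hp.1, mem_polyPath.2
        ⟨k, by omega, by rw [segment_symm]; exact hp.2⟩⟩
    simpa only [q, segment_symm ℝ (v (k + 1) + _) (v k + _)] using this
  -- a path segment next to another one is a germ on neither side
  have pfwd : ∀ k, k + 1 < n → ∀ᶠ ε in 𝓝[>] (0 : ℝ),
      Disjoint (segment ℝ (q ε (k + 1)) (q ε (k + 2))) (segment ℝ (v (k + 1)) (v k)) := by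
    intro k hk
    refine (eventually_pushed_germ (hv.ne _ hk) (hm k hk).1 (fwd _ hk) ?_).mono
      fun ε h => h.1 fun hs => ?_
    · rw [segment_symm ℝ (v (k + 1)) (v k)]
      exact hv.adj k hk
    · have h1 := hs.2
      have h2 := (hm k hk).2
      have : σ * cr (m (k + 1)) (v k - v (k + 1)) = σ * cr (v (k + 1) - v k) (m (k + 1)) := by
        simp only [cr, Prod.fst_sub, Prod.snd_sub]; ring
      linarith
  have pbwd : ∀ k, k + 1 < n → ∀ᶠ ε in 𝓝[>] (0 : ℝ),
      Disjoint (segment ℝ (q ε k) (q ε (k + 1))) (segment ℝ (v (k + 1)) (v (k + 2))) := by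
    intro k hk
    have := eventually_pushed_germ (σ := -σ) (v := v (k + 1)) (w := v k) (m := m (k + 1))
      (m' := m k) (z := v (k + 2)) (hv.ne k (by omega)).symm (by rw [hneg]; exact (hm k hk).2)
      (by rw [hneg]; exact bwd k (by omega)) (by
        rw [inter_comm, segment_symm ℝ (v (k + 1)) (v k)]
        exact hv.adj k hk)
    refine this.mono fun ε h => ?_
    rw [segment_symm]
    refine h.1 fun hs => ?_
    have h1 := hs.2
    have h2 := (hm k hk).1
    have : -σ * cr (m (k + 1)) (v (k + 2) - v (k + 1)) =
        σ * cr (v (k + 2) - v (k + 1)) (m (k + 1)) := by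
      simp only [cr, Prod.fst_sub, Prod.snd_sub]; ring
    linarith
  have edisj : ∀ Q' : Set Plane, IsClosed Q' → ∀ k, Disjoint Q' (segment ℝ (v k) (v (k + 1))) →
      ∀ᶠ ε in 𝓝[>] (0 : ℝ), Disjoint Q' (segment ℝ (q ε k) (q ε (k + 1))) := by
    intro Q' hQ' k hk
    refine (eventually_disjoint_segment hQ' (x := 0) (hqc k) (hqc (k + 1)) ?_).filter_mono
      nhdsWithin_le_nhds
    rwa [hq0, hq0]
  have hpos : ∀ᶠ ε in 𝓝[>] (0 : ℝ), 0 < ε := eventually_mem_nhdsWithin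
  have A1 : ∀ᶠ ε in 𝓝[>] (0 : ℝ), ∀ k ∈ Finset.range n, Disjoint Q (segment ℝ (q ε k) (q ε (k + 1))) :=
    (Filter.eventually_all_finset _).2 fun k hk => edisj Q hQ.isClosed k
      (hQv.mono_right fun p hp => mem_polyPath.2 ⟨k, Finset.mem_range.1 hk, hp⟩)
  have A2 : ∀ᶠ ε in 𝓝[>] (0 : ℝ), ∀ k ∈ Finset.range n, ∀ j ∈ Finset.range n, j + 1 < k ∨ k + 1 < j →
      Disjoint (segment ℝ (v j) (v (j + 1))) (segment ℝ (q ε k) (q ε (k + 1))) := by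
    refine (Filter.eventually_all_finset _).2 fun k hk => (Filter.eventually_all_finset _).2
      fun j hj => ?_
    rw [Finset.mem_range] at hk hj
    refine eventually_imp_distrib_left.2 fun h => edisj _ (isCompact_segment _ _).isClosed k ?_
    rcases h with h | h
    · exact hv.far j k h hk
    · exact (hv.far k j h hj).symm
  have A3 : ∀ᶠ ε in 𝓝[>] (0 : ℝ), ∀ k ∈ Finset.range n, k + 1 < n →
      Disjoint (segment ℝ (q ε (k + 1)) (q ε (k + 2))) (segment ℝ (v (k + 1)) (v k)) ∧
      Disjoint (segment ℝ (q ε k) (q ε (k + 1))) (segment ℝ (v (k + 1)) (v (k + 2))) :=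
    (Filter.eventually_all_finset _).2 fun k _ => eventually_imp_distrib_left.2 fun h =>
      (pfwd k h).and (pbwd k h)
  have A4 : ∀ᶠ ε in 𝓝[>] (0 : ℝ), ∀ k ∈ Finset.range n, q ε k ≠ q ε (k + 1) := by
    refine (Filter.eventually_all_finset _).2 fun k hk => ?_
    have h1 := hv.ne k (Finset.mem_range.1 hk)
    have : ∀ᶠ ε in 𝓝 (0 : ℝ), q ε k - q ε (k + 1) ≠ 0 :=
      ((hqc k).sub (hqc (k + 1))).continuousAt.eventually_ne (by
        change q 0 k - q 0 (k + 1) ≠ 0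
        rw [hq0, hq0]; exact sub_ne_zero.2 h1)
    exact (this.filter_mono nhdsWithin_le_nhds).mono fun ε h => sub_ne_zero.1 h
  have A5 : ∀ᶠ ε in 𝓝[>] (0 : ℝ), ∀ k ∈ Finset.range n, k + 1 < n →
      segment ℝ (q ε k) (q ε (k + 1)) ∩ segment ℝ (q ε (k + 1)) (q ε (k + 2)) ⊆ {q ε (k + 1)} := by
    refine (Filter.eventually_all_finset _).2 fun k _ => eventually_imp_distrib_left.2 fun h => ?_
    have h1 := notSame_of_inter (hv.ne k (by omega)) (hv.ne (k + 1) h).symm (by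
      rw [segment_symm ℝ (v (k + 1)) (v k)]
      exact hv.adj k h)
    have := NotSame.eventually (f := fun ε => q ε k - q ε (k + 1))
      (g := fun ε => q ε (k + 2) - q ε (k + 1)) (x := 0) ((hqc _).sub (hqc _)) ((hqc _).sub (hqc _))
      (by
        rw [hq0, hq0, hq0]; exact h1)
    refine (this.filter_mono nhdsWithin_le_nhds).mono fun ε hε => ?_
    rw [segment_symm ℝ (q ε k)]
    exact hε.inter
  have A6 : ∀ᶠ ε in 𝓝[>] (0 : ℝ), ∀ k ∈ Finset.range n, ∀ j ∈ Finset.range n, j + 1 < k →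
      Disjoint (segment ℝ (q ε j) (q ε (j + 1))) (segment ℝ (q ε k) (q ε (k + 1))) := by
    refine (Filter.eventually_all_finset _).2 fun k hk => (Filter.eventually_all_finset _).2
      fun j hj => eventually_imp_distrib_left.2 fun h => ?_
    rw [Finset.mem_range] at hk hj
    -- separate the two limit segments by disjoint closed neighbourhoods
    obtain ⟨U, V, hU, hV, hUs, hVs, hUV⟩ := SeparatedNhds.of_isCompact_isCompact
      (isCompact_segment (v j) (v (j + 1))) (isCompact_segment (v k) (v (k + 1))) (hv.far j k h hk)
    have h1 := edisj Uᶜ hU.isClosed_compl j (disjoint_left.2 fun p hp hp' => hp (hUs hp'))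
    have h2 := edisj Vᶜ hV.isClosed_compl k (disjoint_left.2 fun p hp hp' => hp (hVs hp'))
    filter_upwards [h1, h2] with ε h1 h2
    refine disjoint_left.2 fun p hp hp' => ?_
    by_cases hpU : p ∈ U
    · by_cases hpV : p ∈ V
      · exact disjoint_left.1 hUV hpU hpV
      · exact disjoint_left.1 h2 hpV hp'
    · exact disjoint_left.1 h1 hpU hp
  have A7 : ∀ᶠ ε in 𝓝[>] (0 : ℝ), ∀ g ∈ hfin.toFinset, ∀ k ∈ Finset.range n, k + 1 ≠ g.1 → k ≠ g.1 →
      Disjoint (segment ℝ (v g.1) g.2) (segment ℝ (q ε k) (q ε (k + 1))) := by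
    refine (Filter.eventually_all_finset _).2 fun g hgg => (Filter.eventually_all_finset _).2
      fun k hk => eventually_imp_distrib_left.2 fun h1 => eventually_imp_distrib_left.2 fun h2 => ?_
    rw [Finset.mem_range] at hk
    obtain ⟨hgn, hgs⟩ := hg g (hfin.mem_toFinset.1 hgg)
    refine edisj _ (isCompact_segment _ _).isClosed k (disjoint_left.2 fun p hp hp' => ?_)
    have := hgs ⟨hp, mem_polyPath.2 ⟨k, hk, hp'⟩⟩
    rw [mem_singleton_iff.1 this] at hp'
    exact hv.notMem_segment hgn hk h1 h2 hp'
  have A8 : ∀ᶠ ε in 𝓝[>] (0 : ℝ), ∀ g ∈ hfin.toFinset,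
      segment ℝ (v 0) (q ε 1) ∩ segment ℝ (v 0) g.2 ⊆ {v 0} ∨ g.1 ≠ 0 := by
    refine (Filter.eventually_all_finset _).2 fun g hgg => ?_
    by_cases h0 : g.1 = 0
    · obtain ⟨hgn, hgs⟩ := hg g (hfin.mem_toFinset.1 hgg)
      rw [h0] at hgs
      exact (eventually_pushed_end (m' := m 1) (hv.ne 0 (by omega)) fun p hp =>
        hgs ⟨hp.1, mem_polyPath.2 ⟨0, by omega, hp.2⟩⟩).mono fun ε h => Or.inl h
    · exact Eventually.of_forall fun _ => Or.inr h0
  obtain ⟨N, rfl⟩ : ∃ N, n = N + 2 := ⟨n - 2, by omega⟩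
  have A9 : ∀ᶠ ε in 𝓝[>] (0 : ℝ), ∀ g ∈ hfin.toFinset,
      segment ℝ (v (N + 2)) (q ε (N + 1)) ∩ segment ℝ (v (N + 2)) g.2 ⊆ {v (N + 2)} ∨
        g.1 ≠ N + 2 := by
    refine (Filter.eventually_all_finset _).2 fun g hgg => ?_
    by_cases h0 : g.1 = N + 2
    · obtain ⟨hgn, hgs⟩ := hg g (hfin.mem_toFinset.1 hgg)
      rw [h0] at hgs
      exact (eventually_pushed_end (m' := m (N + 1)) (hv.ne (N + 1) (by omega)).symm fun p hp =>
        hgs ⟨hp.1, mem_polyPath.2 ⟨N + 1, by omega, by rw [segment_symm]; exact hp.2⟩⟩).mono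
        fun ε h => Or.inl h
    · exact Eventually.of_forall fun _ => Or.inr h0
  have A10 : ∀ᶠ ε in 𝓝[>] (0 : ℝ), ∀ g ∈ hfin.toFinset, ∀ k ∈ Finset.range (N + 2), g.1 = k + 1 →
      k + 1 < N + 2 →
      ((¬ HalfSide σ (v (k + 1)) (v (k + 2)) (m (k + 1)) g.2 →
        Disjoint (segment ℝ (q ε (k + 1)) (q ε (k + 2))) (segment ℝ (v (k + 1)) g.2)) ∧
      (segment ℝ (q ε (k + 1)) (q ε (k + 2)) ∩ segment ℝ (v (k + 1)) g.2).Subsingleton ∧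
      (cr (m (k + 1)) (g.2 - v (k + 1)) = 0 →
        segment ℝ (q ε (k + 1)) (q ε (k + 2)) ∩ segment ℝ (v (k + 1)) g.2 ⊆ {q ε (k + 1)})) ∧
      ((¬ HalfSide (-σ) (v (k + 1)) (v k) (m (k + 1)) g.2 →
        Disjoint (segment ℝ (q ε k) (q ε (k + 1))) (segment ℝ (v (k + 1)) g.2)) ∧
      (segment ℝ (q ε k) (q ε (k + 1)) ∩ segment ℝ (v (k + 1)) g.2).Subsingleton ∧
      (cr (m (k + 1)) (g.2 - v (k + 1)) = 0 →
        segment ℝ (q ε k) (q ε (k + 1)) ∩ segment ℝ (v (k + 1)) g.2 ⊆ {q ε (k + 1)})) := by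
    refine (Filter.eventually_all_finset _).2 fun g hgg => (Filter.eventually_all_finset _).2
      fun k _ => eventually_imp_distrib_left.2 fun h1 => eventually_imp_distrib_left.2 fun h2 => ?_
    obtain ⟨hgn, hgs⟩ := hg g (hfin.mem_toFinset.1 hgg)
    rw [h1] at hgs
    exact (gfwd k h2 _ hgs).and (gbwd k h2 _ hgs)
  obtain ⟨ε, hε, A1, A2, A3, A4, A5, A6, A7, A8, A9, A10⟩ := (hpos.and (A1.and (A2.and (A3.and
    (A4.and (A5.and (A6.and (A7.and (A8.and (A9.and A10)))))))))).exists
  have hpl : IsPolyline (q ε) (N + 2) := ⟨fun k hk => A4 k (Finset.mem_range.2 hk),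
    fun k hk => A5 k (Finset.mem_range.2 (by omega)) hk,
    fun j k hjk hk => A6 k (Finset.mem_range.2 hk) j (Finset.mem_range.2 (by omega)) hjk⟩
  obtain ⟨γ, hγ, him⟩ := hpl.exists_isArc (by omega)
  rw [hqa, hqn] at hγ
  have hsub : ∀ p ∈ γ '' Ioo 0 1, ∃ k < N + 2, p ∈ segment ℝ (q ε k) (q ε (k + 1)) := fun p hp =>
    mem_polyPath.1 (him ▸ image_mono Ioo_subset_Icc_self hp)
  have hp0 : ∀ p ∈ γ '' Ioo 0 1, p ≠ v 0 := fun p hp h => hγ.left_notMem (h ▸ hp)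
  have hp1 : ∀ p ∈ γ '' Ioo 0 1, p ≠ v (N + 2) := fun p hp h => hγ.right_notMem (h ▸ hp)
  refine ⟨γ, hγ, disjoint_left.2 fun p hp hpv => ?_, disjoint_left.2 fun p hp hpQ => ?_,
    fun g hgg => ?_⟩
  · obtain ⟨k, hk, hpk⟩ := hsub p hp
    obtain ⟨j, hj, hpj⟩ := mem_polyPath.1 hpv
    by_cases hfar : j + 1 < k ∨ k + 1 < j
    · exact disjoint_left.1 (A2 k (Finset.mem_range.2 hk) j (Finset.mem_range.2 hj) hfar) hpj hpk
    obtain rfl | rfl | rfl : j = k ∨ k = j + 1 ∨ j = k + 1 := by omega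
    · -- the pushed segment lies strictly on one side of the segment it comes from
      obtain ⟨u, hu, rfl⟩ := mem_segment_iff.1 hpk
      obtain ⟨t, ht, he⟩ := mem_segment_iff.1 hpj
      have e1 : (v j + ε • m j) + u • ((v (j + 1) + ε • m (j + 1)) - (v j + ε • m j)) - v j =
          u • (v (j + 1) - v j) + ((1 - u) * ε) • m j + (u * ε) • m (j + 1) := by module
      have e2 : (v j + ε • m j) + u • ((v (j + 1) + ε • m (j + 1)) - (v j + ε • m j)) - v j =
          t • (v (j + 1) - v j) := by
        simp only [q] at he
        rw [he]; module
      have e3 := congrArg (fun x => σ * cr (v (j + 1) - v j) x) (e1.symm.trans e2)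
      simp only [cr_add_right, cr_smul_right, cr_self] at e3
      have hb : 0 ≤ (1 - u) * ε * (σ * cr (v (j + 1) - v j) (m j)) := by
        refine mul_nonneg (mul_nonneg (by linarith [hu.2]) hε.le) ?_
        rcases bwd j hk with h | h
        · exact h.le
        · simp [h, hcr0]
      have hf : 0 ≤ u * ε * (σ * cr (v (j + 1) - v j) (m (j + 1))) := by
        refine mul_nonneg (mul_nonneg hu.1 hε.le) ?_
        rcases fwd j hk with h | h
        · exact h.le
        · simp [h, hcr0]
      rcases Nat.eq_zero_or_pos j with rfl | hj0
      · have h1 : u * ε * (σ * cr (v (0 + 1) - v 0) (m (0 + 1))) = 0 := by nlinarith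
        have h2 := (hm 0 (by omega)).2
        have hu0 : u = 0 := by
          rcases mul_eq_zero.1 h1 with h | h
          · rcases mul_eq_zero.1 h with h | h
            · exact h
            · exact absurd h hε.ne'
          · exact absurd h h2.ne'
        refine hp0 _ hp ?_
        rw [hu0, zero_smul, add_zero, hqa]
      · have h1 : (1 - u) * ε * (σ * cr (v (j + 1) - v j) (m j)) = 0 := by nlinarith
        have h2 : 0 < σ * cr (v (j + 1) - v j) (m j) := by
          obtain ⟨i, rfl⟩ : ∃ i, j = i + 1 := ⟨j - 1, by omega⟩
          exact (hm i hk).1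
        have hu1 : u = 1 := by
          rcases mul_eq_zero.1 h1 with h | h
          · rcases mul_eq_zero.1 h with h | h
            · linarith
            · exact absurd h hε.ne'
          · exact absurd h h2.ne'
        have h3 : u * ε * (σ * cr (v (j + 1) - v j) (m (j + 1))) = 0 := by nlinarith
        rcases Nat.lt_or_ge (j + 1) (N + 2) with hlt | hge
        · have h4 := (hm j hlt).2
          rw [hu1, one_mul] at h3
          rcases mul_eq_zero.1 h3 with h | h
          · exact hε.ne' h
          · exact h4.ne' h
        · refine hp1 _ hp ?_
          have : j + 1 = N + 2 := by omega
          rw [hu1, one_smul, add_sub_cancel, this, hqn]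
    · refine disjoint_left.1 (A3 j (Finset.mem_range.2 hj) hk).1 hpk ?_
      rwa [segment_symm]
    · exact disjoint_left.1 (A3 k (Finset.mem_range.2 hk) hj).2 hpk hpj
  · obtain ⟨k, hk, hpk⟩ := hsub p hp
    exact disjoint_left.1 (A1 k (Finset.mem_range.2 hk)) hpQ hpk
  · have hgf := hfin.mem_toFinset.2 hgg
    obtain ⟨hgn, -⟩ := hg g hgg
    have hsub' : ∀ p ∈ γ '' Ioo 0 1 ∩ segment ℝ (v g.1) g.2, ∃ k < N + 2, (k + 1 = g.1 ∨ k = g.1) ∧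
        p ∈ segment ℝ (q ε k) (q ε (k + 1)) := by
      rintro p ⟨hp, hp'⟩
      obtain ⟨k, hk, hpk⟩ := hsub p hp
      refine ⟨k, hk, ?_, hpk⟩
      by_contra hc
      rw [not_or] at hc
      exact disjoint_left.1 (A7 g hgf k (Finset.mem_range.2 hk) hc.1 hc.2) hp' hpk
    rcases Nat.eq_zero_or_pos g.1 with h0 | hg0
    · have : γ '' Ioo 0 1 ∩ segment ℝ (v g.1) g.2 = ∅ := by
        refine eq_empty_of_forall_notMem fun p hp => ?_
        obtain ⟨k, hk, hkg, hpk⟩ := hsub' p hp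
        obtain rfl : k = 0 := by omega
        have h8 := (A8 g hgf).resolve_right (not_not.2 h0)
        rw [hqa] at hpk
        rw [h0] at hp
        exact hp0 p hp.1 (h8 ⟨hpk, hp.2⟩)
      rw [this]
      exact ⟨subsingleton_empty, fun h => absurd h not_nonempty_empty⟩
    rcases hgn.eq_or_lt with hl | hgl
    · have : γ '' Ioo 0 1 ∩ segment ℝ (v g.1) g.2 = ∅ := by
        refine eq_empty_of_forall_notMem fun p hp => ?_
        obtain ⟨k, hk, hkg, hpk⟩ := hsub' p hp
        obtain rfl : k = N + 1 := by omega
        have h9 := (A9 g hgf).resolve_right (not_not.2 hl)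
        rw [segment_symm, show N + 1 + 1 = N + 2 from rfl, hqn] at hpk
        rw [hl] at hp
        exact hp1 p hp.1 (h9 ⟨hpk, hp.2⟩)
      rw [this]
      exact ⟨subsingleton_empty, fun h => absurd h not_nonempty_empty⟩
    obtain ⟨k, hk⟩ : ∃ k, g.1 = k + 1 := ⟨g.1 - 1, by omega⟩
    obtain ⟨⟨f1, f2, f3⟩, b1, b2, b3⟩ := A10 g hgf k (Finset.mem_range.2 (by omega)) hk (by omega)
    have hsub'' : ∀ p ∈ γ '' Ioo 0 1 ∩ segment ℝ (v g.1) g.2,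
        p ∈ segment ℝ (q ε k) (q ε (k + 1)) ∩ segment ℝ (v (k + 1)) g.2 ∨
        p ∈ segment ℝ (q ε (k + 1)) (q ε (k + 2)) ∩ segment ℝ (v (k + 1)) g.2 := by
      intro p hp
      obtain ⟨j, -, hjg, hpj⟩ := hsub' p hp
      rw [hk] at hp
      obtain rfl | rfl : j = k ∨ j = k + 1 := by omega
      · exact Or.inl ⟨hpj, hp.2⟩
      · exact Or.inr ⟨hpj, hp.2⟩
    refine ⟨?_, ?_⟩
    · -- a germ in the direction of the normal is met at the pushed vertex, any other germ by only
      -- one of the two adjacent pushed segments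
      have hexcl : (∀ p ∈ γ '' Ioo 0 1 ∩ segment ℝ (v g.1) g.2,
            p ∈ segment ℝ (q ε k) (q ε (k + 1)) ∩ segment ℝ (v (k + 1)) g.2) ∨
          (∀ p ∈ γ '' Ioo 0 1 ∩ segment ℝ (v g.1) g.2,
            p ∈ segment ℝ (q ε (k + 1)) (q ε (k + 2)) ∩ segment ℝ (v (k + 1)) g.2) ∨
          (∀ p ∈ γ '' Ioo 0 1 ∩ segment ℝ (v g.1) g.2, p = q ε (k + 1)) := by
        by_cases hf : HalfSide σ (v (k + 1)) (v (k + 2)) (m (k + 1)) g.2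
        · by_cases hb : HalfSide (-σ) (v (k + 1)) (v k) (m (k + 1)) g.2
          · have h0 : σ * cr (m (k + 1)) (g.2 - v (k + 1)) = 0 := by linarith [hf.2, hb.2]
            have h0 : cr (m (k + 1)) (g.2 - v (k + 1)) = 0 := by
              rcases mul_eq_zero.1 h0 with h3 | h3
              · have := hf.1
                simp [h3] at this
              · exact h3
            right; right
            intro p hp
            rcases hsub'' p hp with h | h
            · exact b3 h0 h
            · exact f3 h0 h
          · right; left
            intro p hp
            exact (hsub'' p hp).resolve_left fun h => disjoint_left.1 (b1 hb) h.1 h.2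
        · left
          intro p hp
          exact (hsub'' p hp).resolve_right fun h => disjoint_left.1 (f1 hf) h.1 h.2
      rcases hexcl with h | h | h
      · exact b2.anti h
      · exact f2.anti h
      · intro p hp p' hp'
        rw [h p hp, h p' hp']
    · rintro ⟨p, hp⟩
      refine ⟨k, hk, by omega, ?_⟩
      by_contra hs
      unfold OnSide at hs
      rw [not_or] at hs
      rcases hsub'' p hp with h | h
      · exact disjoint_left.1 (b1 hs.2) h.1 h.2
      · exact disjoint_left.1 (f1 hs.1) h.1 h.2

end

/-! ### Curves near a polygonal path -/

section

open Filter Topology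

/-- A common normal direction on the left of two consecutive segments with directions `a` and `b`,
provided that the path does not turn back. -/
theorem exists_normal {a b : Plane} (ha : a ≠ 0) (h : NotSame (-a) b) :
    ∃ m, 0 < cr b m ∧ 0 < cr a m := by
  rcases lt_trichotomy (cr a b) 0 with h0 | h0 | h0
  · refine ⟨a - b, ?_, ?_⟩ <;> simp only [cr, Prod.fst_sub, Prod.snd_sub] at * <;> linarith
  · -- parallel vectors of the same direction: rotate by a right angle
    have hd : 0 < dot a b := by
      rcases h with h | h
      · exact absurd (by simp only [cr, Prod.fst_neg, Prod.snd_neg] at *; linarith) h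
      · simp only [dot, Prod.fst_neg, Prod.snd_neg] at *; linarith
    have ha' := dot_self_pos ha
    refine ⟨(-a.2, a.1), ?_, ?_⟩ <;> simp only [cr, dot] at * <;> linarith
  · refine ⟨b - a, ?_, ?_⟩ <;> simp only [cr, Prod.fst_sub, Prod.snd_sub] at * <;> linarith

/-- An arc is a polygonal path, with any finite set of its points among the vertices, and with
normals at the inner vertices, all on the same side. -/
theorem IsArc.exists_frame {γ : ℝ → Plane} {x y : Plane} (h : IsArc γ x y) (T : Finset ℝ)
    (hT : ∀ t ∈ T, t ∈ Icc (0 : ℝ) 1) :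
    ∃ (n : ℕ) (τ : ℕ → ℝ) (m : ℕ → Plane), τ 0 = 0 ∧ τ n = 1 ∧ (∀ i j, i < j → j ≤ n → τ i < τ j) ∧
      (∀ t ∈ T, ∃ k ≤ n, τ k = t) ∧ IsPolyline (γ ∘ τ) n ∧
      (∀ k < n, segment ℝ (γ (τ k)) (γ (τ (k + 1))) = γ '' Icc (τ k) (τ (k + 1))) ∧
      ∀ k, k + 1 < n → 0 < cr (γ (τ (k + 2)) - γ (τ (k + 1))) (m (k + 1)) ∧
        0 < cr (γ (τ (k + 1)) - γ (τ k)) (m (k + 1)) := by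
  obtain ⟨B, hB⟩ := isPolygonal_iff.1 h.polygonal
  classical
  obtain ⟨n, τ, hm, h0, hn, hlt, hmem, hsurj, hgap⟩ := exists_partition
    (insert 0 (insert 1 (T ∪ B.filter (· ∈ Icc (0 : ℝ) 1)))) (by
      intro x hx
      simp only [Finset.mem_insert, Finset.mem_union, Finset.mem_filter] at hx
      rcases hx with rfl | rfl | hx | hx
      · simp
      · simp
      · exact hT _ hx
      · exact hx.2) (by simp) (by simp)
  have hI : ∀ i, 0 ≤ τ i := fun i => h0 ▸ hm (Nat.zero_le i)
  have hle : ∀ i ≤ n, τ i ≤ 1 := fun i hi => hn ▸ hm hi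
  have hstrict : ∀ i j, i < j → j ≤ n → τ i < τ j := fun i j hij hj =>
    (hlt i (by omega)).trans_le (hm (by omega))
  have haff : ∀ k < n, AffOn γ (τ k) (τ (k + 1)) := by
    intro i hi
    refine hB _ _ (hI i) (hm (Nat.le_succ i)) (hle _ hi) fun x hx => ?_
    by_cases hx' : x ∈ Icc (0 : ℝ) 1
    · exact hgap i hi x (by simp [hx, hx'.1, hx'.2])
    · rw [mem_Icc, not_and_or, not_le, not_le] at hx'
      rcases hx' with hx' | hx'
      · exact Or.inl (hx'.le.trans (hI i))
      · exact Or.inr ((hle _ hi).trans hx'.le)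
  have hseg : ∀ k < n, segment ℝ (γ (τ k)) (γ (τ (k + 1))) = γ '' Icc (τ k) (τ (k + 1)) :=
    fun k hk => ((haff k hk).image_eq (hm (Nat.le_succ k))).symm
  have hIcc : ∀ k < n, Icc (τ k) (τ (k + 1)) ⊆ Icc 0 1 := fun k hk =>
    Icc_subset_Icc (hI k) (hle _ hk)
  have hpl : IsPolyline (γ ∘ τ) n := by
    refine ⟨fun k hk he => ?_, fun k hk => ?_, fun j k hjk hk => ?_⟩
    · exact (hlt k hk).ne (h.inj ⟨hI _, hle _ hk.le⟩ ⟨hI _, hle _ hk⟩ he)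
    · simp only [Function.comp]
      rw [hseg k (by omega), hseg (k + 1) hk]
      rintro p ⟨⟨s, hs, rfl⟩, t, ht, he⟩
      have := h.inj (hIcc _ hk ht) (hIcc k (by omega) hs) he
      subst this
      rw [le_antisymm hs.2 ht.1]
      rfl
    · simp only [Function.comp]
      rw [hseg k hk, hseg j (by omega)]
      refine disjoint_left.2 ?_
      rintro p ⟨s, hs, rfl⟩ ⟨t, ht, he⟩
      have := h.inj (hIcc _ hk ht) (hIcc j (by omega) hs) he
      subst this
      have := hstrict (j + 1) k hjk hk.le
      linarith [hs.2, ht.1]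
  have hnor : ∀ k, ∃ m, k + 1 < n → 0 < cr (γ (τ (k + 2)) - γ (τ (k + 1))) m ∧
      0 < cr (γ (τ (k + 1)) - γ (τ k)) m := by
    intro k
    by_cases hk : k + 1 < n
    · have hne := hpl.ne k (by omega)
      have h1 := notSame_of_inter hne (hpl.ne (k + 1) hk).symm (by
        rw [segment_symm ℝ ((γ ∘ τ) (k + 1)) ((γ ∘ τ) k)]
        exact hpl.adj k hk)
      obtain ⟨m, hm⟩ := exists_normal (a := γ (τ (k + 1)) - γ (τ k))
        (b := γ (τ (k + 2)) - γ (τ (k + 1))) (sub_ne_zero.2 hne.symm) (by rw [neg_sub]; exact h1)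
      exact ⟨m, fun _ => hm⟩
    · exact ⟨0, fun h => absurd h hk⟩
  choose m hm' using hnor
  refine ⟨n, τ, fun k => m (k - 1), h0, hn, hstrict, fun t ht => hsurj t (by simp [ht]), hpl, hseg,
    fun k hk => hm' k hk⟩

/-- A curve `c` near a closed set `E`: the parameters `Z` at which `c` is on `E`, two segments of
`c` issuing from each such point, with ends `e t true` and `e t false`, and a compact set `Q`
containing the rest of the curve. -/
structure GermData (c : ℝ → Plane) (E : Set Plane) (Z : Set ℝ) (Q : Set Plane)
    (e : ℝ → Bool → Plane) : Prop where
  finite : Z.Finite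
  compact : IsCompact Q
  disjoint : Disjoint Q E
  germ : ∀ t ∈ Z, ∀ b, segment ℝ (c t) (e t b) ∩ E ⊆ {c t}
  cover : ∀ s ∈ Icc (0 : ℝ) 1, c s ∈ Q ∨ ∃ t ∈ Z, ∃ b, c s ∈ segment ℝ (c t) (e t b)
  start : ∀ t ∈ Z, t = 0 → e t false = c t
  finish : ∀ t ∈ Z, t = 1 → e t true = c t

/-- Near a smaller set, only the germs at its points are needed; the other ones become part of the
remote part `Q` of the curve. -/
theorem GermData.restrict {c : ℝ → Plane} {E E' : Set Plane} {Z : Set ℝ} {Q : Set Plane}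
    {e : ℝ → Bool → Plane} (h : GermData c E Z Q e) (hE : E' ⊆ E) :
    ∃ Q', GermData c E' {t ∈ Z | c t ∈ E'} Q' e := by
  refine ⟨Q ∪ ⋃ t ∈ {t ∈ Z | c t ∉ E'}, ⋃ b, segment ℝ (c t) (e t b), h.finite.subset (sep_subset _ _),
    h.compact.union ((h.finite.subset (sep_subset _ _)).isCompact_biUnion fun t _ =>
      isCompact_iUnion fun b => isCompact_segment _ _), ?_, fun t ht b => ?_, fun s hs => ?_,
    fun t ht => h.start t ht.1, fun t ht => h.finish t ht.1⟩
  · refine disjoint_left.2 ?_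
    rintro p (hp | hp) hpE
    · exact disjoint_left.1 h.disjoint hp (hE hpE)
    · simp only [mem_iUnion] at hp
      obtain ⟨t, ht, b, hp⟩ := hp
      have := h.germ t ht.1 b ⟨hp, hE hpE⟩
      rw [mem_singleton_iff] at this
      exact ht.2 (this ▸ hpE)
  · exact fun p hp => h.germ t ht.1 b ⟨hp.1, hE hp.2⟩
  · rcases h.cover s hs with h1 | ⟨t, ht, b, h1⟩
    · exact Or.inl (Or.inl h1)
    · by_cases hc : c t ∈ E'
      · exact Or.inr ⟨t, ⟨ht, hc⟩, b, h1⟩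
      · refine Or.inl (Or.inr ?_)
        simp only [mem_iUnion]
        exact ⟨t, ⟨ht, hc⟩, b, h1⟩

/-- A polygonal curve that meets `E` finitely often consists near `E` of finitely many segments
issuing from the common points. -/
theorem _root_.IsPolygonal.exists_germData {c : ℝ → Plane} (hc : IsPolygonal c) {E : Set Plane}
    (hfin : {t ∈ Icc (0 : ℝ) 1 | c t ∈ E}.Finite) :
    ∃ Q e, GermData c E {t ∈ Icc (0 : ℝ) 1 | c t ∈ E} Q e := by
  obtain ⟨B, hB⟩ := isPolygonal_iff.1 hc
  set Z := {t ∈ Icc (0 : ℝ) 1 | c t ∈ E} with hZ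
  -- a radius below the distances between the points of `Z`, the breakpoints, and the ends
  have hF : ((B : Set ℝ) ∪ Z ∪ {0, 1}).Finite := (B.finite_toSet.union hfin).union (by simp)
  have key : ∀ᶠ δ in 𝓝[>] (0 : ℝ), ∀ t ∈ hfin.toFinset, ∀ r ∈ hF.toFinset, r = t ∨ δ ≤ |r - t| := by
    refine (eventually_all_finset _).2 fun t _ => (eventually_all_finset _).2 fun r _ => ?_
    by_cases h : r = t
    · exact Eventually.of_forall fun _ => Or.inl h
    · have : ∀ᶠ δ in 𝓝 (0 : ℝ), δ < |r - t| :=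
        continuousAt_id.eventually_lt continuousAt_const (abs_pos.2 (sub_ne_zero.2 h))
      exact (this.filter_mono nhdsWithin_le_nhds).mono fun δ h => Or.inr h.le
  obtain ⟨δ, hkey, hδ⟩ := (key.and eventually_mem_nhdsWithin).exists
  rw [mem_Ioi] at hδ
  have hsep : ∀ t ∈ Z, ∀ r, r ∈ B ∨ r ∈ Z ∨ r = 0 ∨ r = 1 → r ≤ t - δ ∨ r = t ∨ t + δ ≤ r := by
    intro t ht r hr
    rcases hkey t (hfin.mem_toFinset.2 ht) r (hF.mem_toFinset.2 (by
      simp only [mem_union, Finset.mem_coe, mem_insert_iff, mem_singleton_iff]; tauto)) with h | h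
    · exact Or.inr (Or.inl h)
    · rcases le_abs.1 h with h | h
      · right; right; linarith
      · left; linarith
  let δ' := δ / 2
  have hδ' : 0 < δ' := by positivity
  have hδδ : δ' < δ := by simp only [δ']; linarith
  have hbT : ∀ t ∈ Z, t < 1 → t + δ ≤ 1 := fun t ht h => by
    rcases hsep t ht 1 (by simp) with h' | h' | h' <;> linarith
  have hb0 : ∀ t ∈ Z, 0 < t → 0 ≤ t - δ := fun t ht h => by
    rcases hsep t ht 0 (by simp) with h' | h' | h' <;> linarith
  have afwd : ∀ t ∈ Z, t < 1 → AffOn c t (t + δ') := fun t ht h =>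
    hB _ _ ht.1.1 (by linarith) (by linarith [hbT t ht h]) fun r hr => by
      rcases hsep t ht r (Or.inl hr) with h' | h' | h'
      · left; linarith
      · left; linarith
      · right; linarith
  have abwd : ∀ t ∈ Z, 0 < t → AffOn c (t - δ') t := fun t ht h =>
    hB _ _ (by linarith [hb0 t ht h]) (by linarith) ht.1.2 fun r hr => by
      rcases hsep t ht r (Or.inl hr) with h' | h' | h'
      · left; linarith
      · right; linarith
      · right; linarith
  classical
  let e : ℝ → Bool → Plane := fun t b => if b then (if t < 1 then c (t + δ') else c t)
    else if 0 < t then c (t - δ') else c t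
  have ht : ∀ t ∈ Z, t < 1 → segment ℝ (c t) (e t true) = c '' Icc t (t + δ') := by
    intro t ht h
    rw [(afwd t ht h).image_eq (by linarith)]
    simp [e, h]
  have hf : ∀ t ∈ Z, 0 < t → segment ℝ (c t) (e t false) = c '' Icc (t - δ') t := by
    intro t ht h
    rw [(abwd t ht h).image_eq (by linarith), segment_symm]
    simp [e, h]
  have hnot : ∀ t ∈ Z, ∀ s ∈ Icc (0 : ℝ) 1, t - δ < s → s < t + δ → c s ∈ E → c s = c t := by
    intro t ht s hs h1 h2 hsE
    rcases hsep t ht s (Or.inr (Or.inl ⟨hs, hsE⟩)) with h | h | h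
    · linarith
    · rw [h]
    · linarith
  refine ⟨c '' (Icc 0 1 \ ⋃ t ∈ Z, Ioo (t - δ') (t + δ')), e, hfin, ?_, ?_, ?_, ?_, ?_, ?_⟩
  · refine IsCompact.image_of_continuousOn ?_ (hc.continuousOn.mono sdiff_subset)
    exact isCompact_Icc.diff (isOpen_biUnion fun _ _ => isOpen_Ioo)
  · refine disjoint_left.2 ?_
    rintro p ⟨s, hs, rfl⟩ hsE
    refine hs.2 ?_
    simp only [mem_iUnion]
    exact ⟨s, ⟨hs.1, hsE⟩, by linarith, by linarith⟩
  · intro t htZ b p hp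
    rcases b with _ | _
    · rcases eq_or_lt_of_le htZ.1.1 with h0 | h0
      · have := hp.1
        simp only [e, ← h0, Bool.false_eq_true, if_false, lt_irrefl, segment_same] at this
        rw [← h0]
        exact this
      · obtain ⟨hp1, hp2⟩ := hp
        rw [hf t htZ h0] at hp1
        obtain ⟨s, hs, rfl⟩ := hp1
        exact hnot t htZ s ⟨by linarith [hs.1, hb0 t htZ h0], hs.2.trans htZ.1.2⟩
          (by linarith [hs.1]) (by linarith [hs.2]) hp2
    · rcases eq_or_lt_of_le htZ.1.2 with h0 | h0
      · have := hp.1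
        simp only [e, h0, if_true, lt_irrefl, if_false, segment_same] at this
        rw [h0]
        exact this
      · obtain ⟨hp1, hp2⟩ := hp
        rw [ht t htZ h0] at hp1
        obtain ⟨s, hs, rfl⟩ := hp1
        exact hnot t htZ s ⟨htZ.1.1.trans hs.1, by linarith [hs.2, hbT t htZ h0]⟩
          (by linarith [hs.1]) (by linarith [hs.2]) hp2
  · intro s hs
    by_cases h : s ∈ ⋃ t ∈ Z, Ioo (t - δ') (t + δ')
    · right
      simp only [mem_iUnion] at h
      obtain ⟨t, htZ, h1, h2⟩ := h
      refine ⟨t, htZ, ?_⟩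
      rcases lt_trichotomy s t with hst | hst | hst
      · exact ⟨false, by rw [hf t htZ (hs.1.trans_lt hst)]; exact ⟨s, ⟨h1.le, hst.le⟩, rfl⟩⟩
      · exact ⟨true, by rw [hst]; exact left_mem_segment ℝ _ _⟩
      · exact ⟨true, by rw [ht t htZ (hst.trans_le hs.2)]; exact ⟨s, ⟨hst.le, h2.le⟩, rfl⟩⟩
    · exact Or.inl ⟨s, ⟨hs, h⟩, rfl⟩
  · rintro t - rfl
    simp [e]
  · rintro t - rfl
    simp [e]

/-- `exists_pushoff` for a family of curves whose germs at the path are known. -/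
theorem exists_pushoff_curves {v m : ℕ → Plane} {n : ℕ} {σ : ℝ} (hn : 2 ≤ n) (hv : IsPolyline v n)
    (hm0 : m 0 = 0) (hmn : m n = 0)
    (hm : ∀ k, k + 1 < n → 0 < σ * cr (v (k + 2) - v (k + 1)) (m (k + 1)) ∧
      0 < σ * cr (v (k + 1) - v k) (m (k + 1)))
    {J : Type*} [Finite J] {c : J → ℝ → Plane} {Z : J → Set ℝ} {Q : J → Set Plane}
    {e : J → ℝ → Bool → Plane} (hc : ∀ j, GermData (c j) (polyPath v n) (Z j) (Q j) (e j))
    (hvert : ∀ j, ∀ t ∈ Z j, ∃ k ≤ n, c j t = v k) {A : Set Plane} (hA : A.Finite)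
    (hAv : Disjoint A (polyPath v n)) :
    ∃ γ, IsArc γ (v 0) (v n) ∧ Disjoint (γ '' Ioo 0 1) (polyPath v n) ∧ Disjoint (γ '' Ioo 0 1) A ∧
      (∀ j, ∀ s ∈ Icc (0 : ℝ) 1, c j s ∈ γ '' Ioo 0 1 →
        ∃ t ∈ Z j, ∃ b, c j s ∈ segment ℝ (c j t) (e j t b)) ∧
      ∀ j, ∀ t ∈ Z j, ∀ b, (γ '' Ioo 0 1 ∩ segment ℝ (c j t) (e j t b)).Subsingleton ∧
        ((γ '' Ioo 0 1 ∩ segment ℝ (c j t) (e j t b)).Nonempty → ∃ k, c j t = v (k + 1) ∧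
          k + 1 < n ∧ OnSide σ (v k) (v (k + 1)) (v (k + 2)) (m (k + 1)) (e j t b)) := by
  let germs : Set (ℕ × Plane) := ⋃ j, ⋃ t ∈ Z j, ⋃ b, {g | g.1 ≤ n ∧ c j t = v g.1 ∧ g.2 = e j t b}
  have hfin : germs.Finite := by
    refine finite_iUnion fun j => (hc j).finite.biUnion fun t _ => finite_iUnion fun b => ?_
    refine ((Set.finite_le_nat n).image fun k => (k, e j t b)).subset ?_
    rintro ⟨k, z⟩ ⟨h1, -, h3⟩
    exact ⟨k, h1, by rw [← h3]⟩
  obtain ⟨γ, hγ, h1, h2, h3⟩ := exists_pushoff hn hv hm0 hmn hm (Q := (⋃ j, Q j) ∪ A)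
    ((isCompact_iUnion fun j => (hc j).compact).union hA.isCompact)
    (disjoint_union_left.2 ⟨disjoint_iUnion_left.2 fun j => (hc j).disjoint, hAv⟩) germs hfin (by
      intro g hg
      simp only [germs, mem_iUnion] at hg
      obtain ⟨j, t, ht, b, h1, h2, h3⟩ := hg
      refine ⟨h1, ?_⟩
      rw [← h2, h3]
      exact (hc j).germ t ht b)
  rw [disjoint_union_right] at h2
  refine ⟨γ, hγ, h1, h2.2, fun j s hs hsγ => ?_, fun j t ht b => ?_⟩
  · refine ((hc j).cover s hs).resolve_left fun hQ => ?_
    exact disjoint_left.1 h2.1 hsγ (mem_iUnion.2 ⟨j, hQ⟩)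
  · obtain ⟨k, hk, hck⟩ := hvert j t ht
    have := h3 (k, e j t b) (by
      simp only [germs, mem_iUnion]
      exact ⟨j, t, ht, b, hk, hck, rfl⟩)
    simp only [← hck] at this
    refine ⟨this.1, fun hne => ?_⟩
    obtain ⟨i, hi, hin, hside⟩ := this.2 hne
    exact ⟨i, by rw [hck, hi], hin, hside⟩

end

/-! ### Parallel arcs on both sides of an arc -/

section

open Filter Topology

theorem IsPolyline.shift {v : ℕ → Plane} {n : ℕ} (h : IsPolyline v n) (a N : ℕ) (hN : a + N ≤ n) :
    IsPolyline (fun k => v (k + a)) N := by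
  refine ⟨fun k hk => ?_, fun k hk => ?_, fun j k hjk hk => ?_⟩
  · simpa only [Nat.add_right_comm k 1 a] using h.ne (k + a) (by omega)
  · simpa only [Nat.add_right_comm k 1 a, Nat.add_right_comm k 2 a] using h.adj (k + a) (by omega)
  · simpa only [Nat.add_right_comm _ 1 a] using h.far (j + a) (k + a) (by omega) (by omega)

theorem polyPath_eq_image {γ : ℝ → Plane} {τ : ℕ → ℝ} {n : ℕ}
    (hτ : ∀ i j, i < j → j ≤ n → τ i < τ j)
    (hseg : ∀ k < n, segment ℝ (γ (τ k)) (γ (τ (k + 1))) = γ '' Icc (τ k) (τ (k + 1)))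
    (a N : ℕ) (hN : 1 ≤ N) (haN : a + N ≤ n) :
    polyPath (fun k => γ (τ (k + a))) N = γ '' Icc (τ a) (τ (a + N)) := by
  induction N, hN using Nat.le_induction with
  | base =>
    rw [← hseg a (by omega)]
    ext p
    rw [mem_polyPath]
    simp [add_comm 1 a]
  | succ N hN ih =>
    rw [polyPath_succ, ih (by omega), show N + 1 + a = a + N + 1 by ring, show N + a = a + N by ring,
      hseg (a + N) (by omega), ← image_union,
      Icc_union_Icc_eq_Icc (hτ a (a + N) (by omega) (by omega)).le
        (hτ (a + N) (a + N + 1) (by omega) (by omega)).le]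
    rfl

/-- **Parallel arcs on both sides.** Let `γ` be an arc from `x` to `y`, let `s = γ ts` be one of its
points, and consider finitely many curves which pass at most once through every inner point of `γ`,
and of which at most one has an end at an inner point of `γ`, namely at `s`. There are arcs `L` from
`x` to `y` and `R` from `s` to `y`, close to `γ` on different sides, such that every curve meets `L`
and `R` together at most twice per crossing with `γ`. A crossing may be a mere touching; then the
two points may lie on the same side. -/
theorem IsArc.exists_two_sided {γ : ℝ → Plane} {x y : Plane} (hγ : IsArc γ x y) {ts : ℝ}
    (hts : ts ∈ Ico (0 : ℝ) 1) {J : Type*} [Finite J] (c : J → ℝ → Plane)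
    (hpoly : ∀ j, IsPolygonal (c j))
    (hfin : ∀ j, {t ∈ Icc (0 : ℝ) 1 | c j t ∈ γ '' Icc 0 1}.Finite)
    {A : Set Plane} (hA : A.Finite) (hAγ : Disjoint A (γ '' Icc 0 1))
    (honce : ∀ j k, ∀ t ∈ Icc (0 : ℝ) 1, ∀ u ∈ Icc (0 : ℝ) 1, c j t = c k u →
      c j t ∈ γ '' Ioo 0 1 → j = k ∧ t = u)
    (hends : ∀ j, ∀ t, t = 0 ∨ t = 1 → c j t ∈ γ '' Ioo 0 1 → c j t = γ ts)
    (hs : ∀ j, ∀ t ∈ Ioo (0 : ℝ) 1, c j t ≠ γ ts) :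
    ∃ L R, IsArc L x y ∧ IsArc R (γ ts) y ∧ Disjoint (L '' Ioo 0 1) (γ '' Icc 0 1) ∧
      Disjoint (R '' Ioo 0 1) (γ '' Icc 0 1) ∧ Disjoint (R '' Ioo 0 1) (L '' Ioo 0 1) ∧
      Disjoint (L '' Ioo 0 1) A ∧ Disjoint (R '' Ioo 0 1) A ∧
      ∀ j, (L '' Ioo 0 1 ∩ c j '' Icc 0 1).Finite ∧ (R '' Ioo 0 1 ∩ c j '' Icc 0 1).Finite ∧
        (L '' Ioo 0 1 ∩ c j '' Icc 0 1).ncard + (R '' Ioo 0 1 ∩ c j '' Icc 0 1).ncard ≤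
          2 * {t ∈ Ioo (0 : ℝ) 1 | c j t ∈ γ '' Ioo 0 1}.ncard := by
  classical
  set E := γ '' Icc 0 1 with hEdef
  let Z : J → Set ℝ := fun j => {t ∈ Icc (0 : ℝ) 1 | c j t ∈ E}
  choose Q e hgerm using fun j => (hpoly j).exists_germData (hfin j)
  -- the vertices of the path include all points on the curves
  have hTfin : {t ∈ Icc (0 : ℝ) 1 | ∃ j, ∃ u ∈ Z j, c j u = γ t}.Finite := by
    refine Set.Finite.of_finite_image (f := γ) ?_ (hγ.inj.mono (sep_subset _ _))
    refine (finite_iUnion fun j => (hfin j).image (c j)).subset ?_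
    rintro p ⟨t, ⟨-, j, u, hu, he⟩, rfl⟩
    exact mem_iUnion.2 ⟨j, u, hu, he⟩
  obtain ⟨n, τ, m, hτ0, hτn, hτ, hτT, hv, hseg, hm⟩ := hγ.exists_frame
    (insert ts (insert ((ts + 1) / 2) hTfin.toFinset)) (by
      intro t ht
      simp only [Finset.mem_insert, Finite.mem_toFinset] at ht
      rcases ht with rfl | rfl | ht
      · exact ⟨hts.1, hts.2.le⟩
      · constructor <;> linarith [hts.1, hts.2]
      · exact ht.1)
  have hτI : ∀ k ≤ n, τ k ∈ Icc (0 : ℝ) 1 := by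
    intro k hk
    constructor
    · rcases Nat.eq_zero_or_pos k with rfl | h
      · exact hτ0.ge
      · exact hτ0 ▸ (hτ 0 k h hk).le
    · rcases hk.eq_or_lt with rfl | h
      · exact hτn.le
      · exact hτn ▸ (hτ k n h le_rfl).le
  have hτinj : ∀ i ≤ n, ∀ j ≤ n, γ (τ i) = γ (τ j) → i = j := by
    intro i hi j hj he
    have := hγ.inj (hτI i hi) (hτI j hj) he
    rcases lt_trichotomy i j with h | h | h
    · exact absurd this (hτ i j h hj).ne
    · exact h
    · exact absurd this (hτ j i h hi).ne'
  obtain ⟨i, hin, hi⟩ := hτT ts (by simp)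
  obtain ⟨i', hin', hi'⟩ := hτT ((ts + 1) / 2) (by simp)
  have hii' : i < i' := by
    by_contra hc
    rcases (not_lt.1 hc).eq_or_lt with h | h
    · subst h; linarith [hts.2, hi.symm.trans hi']
    · have := hτ i' i h hin
      linarith [hts.2]
  have hin2 : i' < n := by
    refine lt_of_le_of_ne hin' ?_
    rintro rfl
    linarith [hts.2, hi'.symm.trans hτn]
  have hv0 : polyPath (γ ∘ τ) n = E := by
    have := polyPath_eq_image hτ hseg 0 n (by omega) (by omega)
    rwa [zero_add, hτ0, hτn] at this
  -- a curve that ends inside `γ` is to be avoided by `L`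
  have hdeg : ∀ σ u v w m, ¬ OnSide σ u v w m v := fun σ u v w m => by
    simp [OnSide, HalfSide, cr]
  obtain ⟨σ, hσ, hσs⟩ : ∃ σ : ℝ, (σ = 1 ∨ σ = -1) ∧ ∀ j, ∀ t ∈ Z j, t = 0 ∨ t = 1 → ∀ b k,
      c j t = γ (τ (k + 1)) → k + 1 < n → ¬ OnSide σ (γ (τ k)) (γ (τ (k + 1))) (γ (τ (k + 2)))
        (σ • m (k + 1)) (e j t b) := by
    by_cases hex : ∀ j, ∀ t ∈ Z j, t = 0 ∨ t = 1 → ∀ b k, c j t = γ (τ (k + 1)) → k + 1 < n →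
        ¬ OnSide 1 (γ (τ k)) (γ (τ (k + 1))) (γ (τ (k + 2))) ((1 : ℝ) • m (k + 1)) (e j t b)
    · exact ⟨1, Or.inl rfl, hex⟩
    push Not at hex
    obtain ⟨j₀, t₀, ht₀, ht₀', b₀, k₀, hc₀, hk₀, hside⟩ := hex
    have hinner : ∀ k, k + 1 < n → γ (τ (k + 1)) ∈ γ '' Ioo 0 1 := fun k hk =>
      ⟨τ (k + 1), ⟨hτ0 ▸ hτ 0 (k + 1) (by omega) (by omega), hτn ▸ hτ (k + 1) n hk le_rfl⟩, rfl⟩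
    have hnb : ∀ j, ∀ t ∈ Z j, ∀ b, t = 0 ∨ t = 1 → ∀ σ u w m, OnSide σ u (c j t) w m (e j t b) →
        (t = 0 ∧ b = true) ∨ (t = 1 ∧ b = false) := by
      rintro j t ht b (rfl | rfl) σ u w m hon
      · rcases b with _ | _
        · rw [(hgerm j).start 0 ht rfl] at hon
          exact absurd hon (hdeg _ _ _ _ _)
        · exact Or.inl ⟨rfl, rfl⟩
      · rcases b with _ | _
        · exact Or.inr ⟨rfl, rfl⟩
        · rw [(hgerm j).finish 1 ht rfl] at hon
          exact absurd hon (hdeg _ _ _ _ _)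
    refine ⟨-1, Or.inr rfl, fun j t ht ht' b k hck hk hon => ?_⟩
    have e1 := hends j t ht' (hck ▸ hinner k hk)
    have e2 := hends j₀ t₀ ht₀' (hc₀ ▸ hinner k₀ hk₀)
    obtain ⟨rfl, rfl⟩ := honce j j₀ t ht.1 t₀ ht₀.1 (e1.trans e2.symm) (hck ▸ hinner k hk)
    have hkk := hτinj _ hk.le _ hk₀.le (hck.symm.trans hc₀)
    obtain rfl : k = k₀ := by omega
    have h1 := hnb j t ht b ht' _ _ _ _ (hck ▸ hon)
    have h2 := hnb j t ht b₀ ht' _ _ _ _ (hc₀ ▸ hside)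
    have hbb : b = b₀ := by
      rcases h1 with h1 | h1 <;> rcases h2 with h2 | h2
      · rw [h1.2, h2.2]
      · linarith [h1.1, h2.1]
      · linarith [h1.1, h2.1]
      · rw [h1.2, h2.2]
    subst hbb
    rw [one_smul] at hside
    rw [neg_one_smul] at hon
    exact not_onSide_neg hside (by simpa using (hm k hk).1) (by simpa using (hm k hk).2) hon
  have hσσ : ∀ r : ℝ, σ * (σ * r) = r := by rcases hσ with rfl | rfl <;> intro r <;> ring
  have hmσ : ∀ k, k + 1 < n →
      0 < σ * cr (γ (τ (k + 2)) - γ (τ (k + 1))) (σ • m (k + 1)) ∧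
        0 < σ * cr (γ (τ (k + 1)) - γ (τ k)) (σ • m (k + 1)) := by
    intro k hk
    rw [cr_smul_right, cr_smul_right, hσσ, hσσ]
    exact hm k hk
  have hτvert : ∀ j, ∀ t ∈ Z j, ∃ k ≤ n, c j t = γ (τ k) := by
    intro j t ht
    obtain ⟨u, hu, he⟩ := ht.2
    obtain ⟨k, hk, hku⟩ := hτT u (by
      simp only [Finset.mem_insert, Finite.mem_toFinset]
      exact Or.inr (Or.inr ⟨hu, j, t, ht, he.symm⟩))
    exact ⟨k, hk, by rw [hku, he]⟩
  -- the arc `L`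
  obtain ⟨L, hL, hL1, hLA, hL2, hL3⟩ := exists_pushoff_curves (v := γ ∘ τ) (n := n) (σ := σ)
    (m := fun k => if k = 0 ∨ k = n then 0 else σ • m k) (by omega) hv (by simp) (by simp)
    (fun k hk => by simpa [hk.ne] using hmσ k hk) (c := c) (Z := Z) (Q := Q) (e := e)
    (by rw [hv0]; exact hgerm) hτvert hA (by rwa [hv0])
  rw [hv0] at hL1
  simp only [Function.comp, hτ0, hτn, hγ.left, hγ.right] at hL
  -- the arc `R` starts at `s`; the initial part of `γ` and `L` are further curves to be avoided
  have hiN : i + (n - i) = n := by omega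
  set N := n - i with hN
  have hER : polyPath (fun k => γ (τ (k + i))) N = γ '' Icc ts 1 := by
    have := polyPath_eq_image hτ hseg i N (by omega) (by omega)
    rwa [hiN, hτn, hi] at this
  have hERsub : γ '' Icc ts 1 ⊆ E := image_mono (Icc_subset_Icc_left hts.1)
  have hvR : IsPolyline (fun k => γ (τ (k + i))) N := by
    have := hv.shift i N (by omega)
    exact this
  obtain ⟨QL, eL, hgL⟩ := hL.polygonal.exists_germData (E := γ '' Icc ts 1) (by
    refine Set.Finite.subset (s := {0, 1}) (by simp) ?_
    rintro t ⟨ht, htE⟩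
    by_contra hc
    simp only [mem_insert_iff, mem_singleton_iff, not_or] at hc
    exact disjoint_left.1 hL1 ⟨t, ⟨lt_of_le_of_ne ht.1 (Ne.symm hc.1), lt_of_le_of_ne ht.2 hc.2⟩, rfl⟩
      (hERsub htE))
  obtain ⟨ZI, QI, eI, hgI, hZI⟩ : ∃ ZI QI eI,
      GermData (fun t => γ (ts * t)) (γ '' Icc ts 1) ZI QI eI ∧
        ∀ t ∈ ZI, t ∈ Icc (0 : ℝ) 1 ∧ γ (ts * t) ∈ γ '' Icc ts 1 := by
    rcases eq_or_lt_of_le hts.1 with h0 | h0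
    · refine ⟨{0}, ∅, fun _ _ => γ 0, ⟨finite_singleton _, isCompact_empty, empty_disjoint _, ?_, ?_,
        ?_, ?_⟩, ?_⟩
      · rintro t rfl b
        rw [mul_zero, segment_same]
        exact inter_subset_left
      · intro s _
        right
        exact ⟨0, rfl, true, by rw [← h0, zero_mul, zero_mul, segment_same]; rfl⟩
      · rintro t rfl -
        rw [mul_zero]
      · rintro t rfl h
        norm_num at h
      · rintro t rfl
        refine ⟨by simp, ⟨0, ⟨h0.ge, by simp⟩, by simp⟩⟩
    · have hp : IsPolygonal fun t => γ (ts * t) := by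
        simpa using hγ.polygonal.comp_affine (c := ts) (d := 0) h0.ne' (by simp)
          ⟨by linarith, by linarith [hts.2]⟩
      obtain ⟨QI, eI, h⟩ := hp.exists_germData (E := γ '' Icc ts 1) (by
        refine Set.Finite.subset (s := {1}) (by simp) ?_
        rintro t ⟨ht, u, hu, he⟩
        have := hγ.inj ⟨hts.1.trans hu.1, hu.2⟩ ⟨by nlinarith [ht.1], by nlinarith [ht.2, hts.2]⟩ he
        rw [mem_singleton_iff]
        nlinarith [hu.1, ht.2])
      exact ⟨_, QI, eI, h, fun t ht => ht⟩
  choose QR hgR using fun j => (hgerm j).restrict hERsub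
  let cR : Option (Option J) → ℝ → Plane := fun o => o.elim (fun t => γ (ts * t)) fun o => o.elim L c
  let ZR : Option (Option J) → Set ℝ := fun o => o.elim ZI fun o =>
    o.elim {t ∈ Icc (0 : ℝ) 1 | L t ∈ γ '' Icc ts 1} fun j => {t ∈ Z j | c j t ∈ γ '' Icc ts 1}
  let eR : Option (Option J) → ℝ → Bool → Plane := fun o => o.elim eI fun o => o.elim eL e
  let QR' : Option (Option J) → Set Plane := fun o => o.elim QI fun o => o.elim QL QR
  have hvertE : ∀ k ≤ n, γ (τ k) ∈ γ '' Icc ts 1 → ∃ k', k' ≤ N ∧ k = k' + i := by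
    rintro k hk ⟨u, hu, he⟩
    have := hγ.inj ⟨hts.1.trans hu.1, hu.2⟩ (hτI k hk) he
    have hik : i ≤ k := by
      by_contra hc
      have := hτ k i (by omega) hin
      linarith [hu.1]
    exact ⟨k - i, by omega, by omega⟩
  obtain ⟨R, hR, hR1, hRA, hR2, hR3⟩ := exists_pushoff_curves (v := fun k => γ (τ (k + i))) (n := N)
    (σ := -σ) (m := fun k => if k = 0 ∨ k = N then 0 else -(σ • m (k + i))) (by omega) hvR (by simp)
    (by simp)
    (fun k hk => by
      have h := hmσ (k + i) (by omega)
      have hc : ∀ a b : Plane, -σ * cr a (-b) = σ * cr a b := fun a b => by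
        simp only [cr, Prod.fst_neg, Prod.snd_neg]; ring
      have e1 : k + 2 + i = k + i + 2 := by ring
      have e2 : k + 1 + i = k + i + 1 := by ring
      simp only [hk.ne, Nat.add_eq_zero_iff, one_ne_zero, and_false, or_self, if_false]
      rw [hc, hc, e1, e2]
      exact h) (c := cR) (Z := ZR) (Q := QR') (e := eR)
    (by
      rw [hER]
      rintro (_ | _ | j)
      · exact hgI
      · exact hgL
      · exact hgR j)
    (by
      rintro (_ | _ | j) t ht
      · obtain ⟨htI, u, hu, he⟩ := hZI t ht
        have := hγ.inj ⟨hts.1.trans hu.1, hu.2⟩ ⟨mul_nonneg hts.1 htI.1, by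
          nlinarith [hts.1, hts.2, htI.1, htI.2]⟩ he
        have h1 : ts * t = ts := le_antisymm (mul_le_of_le_one_right hts.1 htI.2) (this ▸ hu.1)
        refine ⟨0, Nat.zero_le _, ?_⟩
        change γ (ts * t) = γ (τ (0 + i))
        rw [zero_add, hi, h1]
      · obtain ⟨htI, htE⟩ := ht
        change ∃ k ≤ N, L t = γ (τ (k + i))
        rcases eq_or_lt_of_le htI.1 with h0 | h0
        · rw [← h0, hL.left, ← hγ.left, ← hτ0] at htE ⊢
          obtain ⟨k', hk', he⟩ := hvertE 0 (Nat.zero_le _) htE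
          exact ⟨k', hk', by rw [← he]⟩
        rcases eq_or_lt_of_le htI.2 with h1 | h1
        · exact ⟨N, le_rfl, by rw [h1, hL.right, ← hγ.right, ← hτn, add_comm, hiN]⟩
        · exact absurd (hERsub htE) (disjoint_left.1 hL1 ⟨t, ⟨h0, h1⟩, rfl⟩)
      · obtain ⟨k, hk, he⟩ := hτvert j t ht.1
        obtain ⟨k', hk', rfl⟩ := hvertE k hk (he ▸ ht.2)
        exact ⟨k', hk', he⟩)
    hA (by rw [hER]; exact hAγ.mono_right hERsub)
  have hR' : IsArc R (γ ts) y := by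
    have : IsArc R (γ (τ (0 + i))) (γ (τ (N + i))) := hR
    rwa [zero_add, hi, show N + i = n by omega, hτn, hγ.right] at this
  -- a germ met by `R` issues from an inner vertex of the final part of `γ`
  have hRinner : ∀ o, ∀ t ∈ ZR o, ∀ b, (R '' Ioo 0 1 ∩ segment ℝ (cR o t) (eR o t b)).Nonempty →
      ∃ k, cR o t = γ (τ (k + i + 1)) ∧ k + i + 1 < n ∧ OnSide (-σ) (γ (τ (k + i)))
        (γ (τ (k + i + 1))) (γ (τ (k + i + 2))) (-(σ • m (k + i + 1))) (eR o t b) := by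
    intro o t ht b hne
    obtain ⟨k, h1, h2, h3⟩ := (hR3 o t ht b).2 hne
    have e1 : k + 2 + i = k + i + 2 := by ring
    have e2 : k + 1 + i = k + i + 1 := by ring
    simp only [h2.ne, Nat.add_eq_zero_iff, one_ne_zero, and_false, or_self, if_false] at h3
    rw [e1, e2] at h3
    rw [e2] at h1
    exact ⟨k, h1, by omega, h3⟩
  have hRγ : Disjoint (R '' Ioo 0 1) E := by
    refine disjoint_left.2 ?_
    rintro p hp ⟨r, hr, rfl⟩
    rcases le_or_gt ts r with h | h
    · exact disjoint_left.1 hR1 hp (hER ▸ ⟨r, ⟨h, hr.2⟩, rfl⟩)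
    · have h0 : 0 < ts := hr.1.trans_lt h
      obtain ⟨t, ht, b, hb⟩ := hR2 none (r / ts) ⟨div_nonneg hr.1 h0.le, by rw [div_le_one h0]; exact h.le⟩
        (by change γ (ts * (r / ts)) ∈ _; rwa [mul_div_cancel₀ _ h0.ne'])
      have hb' : γ r ∈ segment ℝ (cR none t) (eR none t b) := by
        have : cR none (r / ts) = γ r := by
          change γ (ts * (r / ts)) = _
          rw [mul_div_cancel₀ _ h0.ne']
        rwa [this] at hb
      obtain ⟨k, hk, hkn, -⟩ := hRinner none t ht b ⟨_, hp, hb'⟩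
      obtain ⟨htI, -⟩ := hZI t ht
      have hle : ts * t ≤ ts := mul_le_of_le_one_right hts.1 htI.2
      have := hγ.inj ⟨mul_nonneg hts.1 htI.1, hle.trans hts.2.le⟩ (hτI _ hkn.le) hk
      have := hτ i (k + i + 1) (by omega) hkn.le
      linarith
  have hRL : Disjoint (R '' Ioo 0 1) (L '' Ioo 0 1) := by
    refine disjoint_left.2 ?_
    rintro p hp ⟨r, hr, rfl⟩
    obtain ⟨t, ht, b, hb⟩ := hR2 (some none) r ⟨hr.1.le, hr.2.le⟩ hp
    obtain ⟨k, hk, hkn, -⟩ := hRinner (some none) t ht b ⟨_, hp, hb⟩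
    change L t = _ at hk
    obtain ⟨htI, htE⟩ : t ∈ Icc (0 : ℝ) 1 ∧ L t ∈ γ '' Icc ts 1 := ht
    rcases eq_or_lt_of_le htI.1 with h0 | h0
    · rw [← h0, hL.left, ← hγ.left, ← hτ0] at hk
      have := hτinj 0 (Nat.zero_le _) _ hkn.le hk
      omega
    rcases eq_or_lt_of_le htI.2 with h1 | h1
    · rw [h1, hL.right, ← hγ.right, ← hτn] at hk
      have := hτinj n le_rfl _ hkn.le hk
      omega
    · exact disjoint_left.1 hL1 ⟨t, ⟨h0, h1⟩, rfl⟩ (hERsub htE)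
  refine ⟨L, R, hL, hR', hL1, hRγ, hRL, hLA, hRA, fun j => ?_⟩
  set U := {t ∈ Ioo (0 : ℝ) 1 | c j t ∈ γ '' Ioo 0 1} with hU
  have hUfin : U.Finite := (hfin j).subset fun t ht =>
    ⟨Ioo_subset_Icc_self ht.1, image_mono Ioo_subset_Icc_self ht.2⟩
  have hinner : ∀ k, k + 1 < n → γ (τ (k + 1)) ∈ γ '' Ioo 0 1 := fun k hk =>
    ⟨τ (k + 1), ⟨hτ0 ▸ hτ 0 (k + 1) (by omega) (by omega), hτn ▸ hτ (k + 1) n hk le_rfl⟩, rfl⟩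
  let S : (ℝ → Plane) → Set Plane → Set (ℝ × Bool) := fun X W =>
    {g | g.1 ∈ U ∧ c j g.1 ∈ W ∧ (X '' Ioo 0 1 ∩ segment ℝ (c j g.1) (e j g.1 g.2)).Nonempty}
  have hSsub : ∀ X W, S X W ⊆ U ×ˢ univ := fun X W g hg => ⟨hg.1, mem_univ _⟩
  have hUU : (U ×ˢ (univ : Set Bool)).Finite := hUfin.prod finite_univ
  have hSfin : ∀ X W, (S X W).Finite := fun X W => hUU.subset (hSsub X W)
  -- every point of a parallel arc on the curve belongs to a germ, and every germ has one such point
  have hcount : ∀ (X : ℝ → Plane) (W : Set Plane),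
      (∀ p ∈ X '' Ioo 0 1 ∩ c j '' Icc 0 1, ∃ g ∈ S X W, p ∈ segment ℝ (c j g.1) (e j g.1 g.2)) →
      (∀ g ∈ S X W, (X '' Ioo 0 1 ∩ segment ℝ (c j g.1) (e j g.1 g.2)).Subsingleton) →
      (X '' Ioo 0 1 ∩ c j '' Icc 0 1).Finite ∧
        (X '' Ioo 0 1 ∩ c j '' Icc 0 1).ncard ≤ (S X W).ncard := by
    intro X W h1 h2
    choose! f hf1 hf2 using h1
    have hinj : InjOn f (X '' Ioo 0 1 ∩ c j '' Icc 0 1) := fun p hp p' hp' he =>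
      h2 _ (hf1 p hp) ⟨hp.1, hf2 p hp⟩ ⟨hp'.1, he ▸ hf2 p' hp'⟩
    exact ⟨(hSfin X W).of_injOn hf1 hinj, ncard_le_ncard_of_injOn f hf1 hinj (hSfin X W)⟩
  have cL := hcount L univ (by
    rintro _ ⟨hp, r, hr, rfl⟩
    obtain ⟨t, ht, b, hb⟩ := hL2 j r hr hp
    refine ⟨(t, b), ⟨⟨?_, ?_⟩, mem_univ _, ⟨_, hp, hb⟩⟩, hb⟩
    · obtain ⟨k, hk, hkn, hon⟩ := (hL3 j t ht b).2 ⟨_, hp, hb⟩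
      by_contra hc
      have h01 : t = 0 ∨ t = 1 := by
        by_contra h
        rw [not_or] at h
        exact hc ⟨lt_of_le_of_ne ht.1.1 (Ne.symm h.1), lt_of_le_of_ne ht.1.2 h.2⟩
      simp only [hkn.ne, Nat.add_eq_zero_iff, one_ne_zero, and_false, or_self, if_false] at hon
      exact hσs j t ht h01 b k hk hkn hon
    · obtain ⟨k, hk, hkn, -⟩ := (hL3 j t ht b).2 ⟨_, hp, hb⟩
      change c j t ∈ _
      rw [hk]
      exact hinner k hkn) fun g hg => (hL3 j g.1 ⟨Ioo_subset_Icc_self hg.1.1,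
        image_mono Ioo_subset_Icc_self hg.1.2⟩ g.2).1
  have cRR := hcount R (γ '' Icc ts 1) (by
    rintro _ ⟨hp, r, hr, rfl⟩
    obtain ⟨t, ht, b, hb⟩ := hR2 (some (some j)) r hr hp
    obtain ⟨k, hk, hkn, -⟩ := hRinner (some (some j)) t ht b ⟨_, hp, hb⟩
    change c j t = _ at hk
    have ht' : t ∈ Z j ∧ c j t ∈ γ '' Icc ts 1 := ht
    have hin' : c j t ∈ γ '' Ioo 0 1 := hk ▸ hinner (k + i) hkn
    refine ⟨(t, b), ⟨⟨?_, hin'⟩, ht'.2, ⟨_, hp, hb⟩⟩, hb⟩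
    by_contra hc
    have h01 : t = 0 ∨ t = 1 := by
      by_contra h
      rw [not_or] at h
      exact hc ⟨lt_of_le_of_ne ht'.1.1.1 (Ne.symm h.1), lt_of_le_of_ne ht'.1.1.2 h.2⟩
    have := hends j t h01 hin'
    rw [hk, ← hi] at this
    have := hτinj _ hkn.le _ hin this
    omega) fun g hg => (hR3 (some (some j)) g.1 ⟨⟨Ioo_subset_Icc_self hg.1.1,
      image_mono Ioo_subset_Icc_self hg.1.2⟩, hg.2.1⟩ g.2).1
  refine ⟨cL.1, cRR.1, (add_le_add cL.2 cRR.2).trans ?_⟩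
  have hdisj : Disjoint (S L univ) (S R (γ '' Icc ts 1)) := by
    refine disjoint_left.2 fun g hgL hgR => ?_
    have hZ : g.1 ∈ Z j := ⟨Ioo_subset_Icc_self hgL.1.1, image_mono Ioo_subset_Icc_self hgL.1.2⟩
    obtain ⟨k, hk, hkn, hon⟩ := (hL3 j g.1 hZ g.2).2 hgL.2.2
    obtain ⟨k', hk', hkn', hon'⟩ := hRinner (some (some j)) g.1 ⟨hZ, hgR.2.1⟩ g.2 hgR.2.2
    have hkk := hτinj _ hkn.le _ hkn'.le (hk.symm.trans hk')
    obtain rfl : k = k' + i := by omega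
    simp only [hkn.ne, Nat.add_eq_zero_iff, one_ne_zero, and_false, or_self, if_false] at hon
    exact not_onSide_neg hon (hmσ _ hkn).1 (hmσ _ hkn).2 hon'
  rw [← ncard_union_eq hdisj (hSfin _ _) (hSfin _ _)]
  refine (ncard_le_ncard (union_subset (hSsub _ _) (hSsub _ _)) hUU).trans ?_
  rw [ncard_prod, ncard_univ, Nat.card_eq_fintype_card, Fintype.card_bool, mul_comm]

end

/-! ### Families of curves, thickening, and bundling -/

/-- A family of curves drawn in the plane on a finite set `P` of points: simple polygonal curves
with ends in `P` (possibly loops) that avoid `P` otherwise, such that any two cross finitely often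
and no three of them cross in a common point. -/
structure Pic {ι : Type*} (P : Set Plane) (c : ι → ℝ → Plane) : Prop where
  finite_pts : P.Finite
  polygonal : ∀ i, IsPolygonal (c i)
  simple : ∀ i, InjOn (c i) (Ioo 0 1)
  left_mem : ∀ i, c i 0 ∈ P
  right_mem : ∀ i, c i 1 ∈ P
  avoids : ∀ i, ∀ p ∈ P, p ∉ c i '' Ioo 0 1
  finite : ∀ i j, i ≠ j → (c i '' Ioo 0 1 ∩ c j '' Ioo 0 1).Finite
  no_triple : ∀ i j k, i ≠ j → i ≠ k → j ≠ k →
    ∀ p, ¬ (p ∈ c i '' Ioo 0 1 ∧ p ∈ c j '' Ioo 0 1 ∧ p ∈ c k '' Ioo 0 1)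

open Classical in
/-- The number of crossings of two curves of a family; a curve does not cross itself. -/
noncomputable def crossCount {ι : Type*} (c : ι → ℝ → Plane) (i j : ι) : ℕ :=
  if i = j then 0 else (c i '' Ioo 0 1 ∩ c j '' Ioo 0 1).ncard

section crossCount
variable {ι κ : Type*} {c : ι → ℝ → Plane}

@[simp] theorem crossCount_self (i : ι) : crossCount c i i = 0 := if_pos rfl

theorem crossCount_of_ne {i j : ι} (h : i ≠ j) :
    crossCount c i j = (c i '' Ioo 0 1 ∩ c j '' Ioo 0 1).ncard := if_neg h

theorem crossCount_comm (i j : ι) : crossCount c i j = crossCount c j i := by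
  by_cases h : i = j
  · rw [h]
  · rw [crossCount_of_ne h, crossCount_of_ne (Ne.symm h), inter_comm]

theorem crossCount_eq_zero_of_disjoint {i j : ι} (h : Disjoint (c i '' Ioo 0 1) (c j '' Ioo 0 1)) :
    crossCount c i j = 0 := by
  unfold crossCount
  split_ifs
  · rfl
  · rw [disjoint_iff_inter_eq_empty.1 h, ncard_empty]

theorem crossCount_comp {f : κ → ι} (hf : Function.Injective f) (k l : κ) :
    crossCount (fun k => c (f k)) k l = crossCount c (f k) (f l) := by
  by_cases h : k = l
  · rw [h, crossCount_self, crossCount_self]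
  · rw [crossCount_of_ne h, crossCount_of_ne (hf.ne h)]

end crossCount

theorem injOn_Icc_of_injOn_Ioo {γ : ℝ → Plane} (h : InjOn γ (Ioo 0 1)) (h0 : γ 0 ∉ γ '' Ioo 0 1)
    (h1 : γ 1 ∉ γ '' Ioo 0 1) (h01 : γ 0 ≠ γ 1) : InjOn γ (Icc 0 1) := by
  have key : ∀ t ∈ Icc (0 : ℝ) 1, t = 0 ∨ t = 1 ∨ t ∈ Ioo (0 : ℝ) 1 := by
    intro t ht
    rcases eq_or_lt_of_le ht.1 with h | h
    · exact Or.inl h.symm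
    rcases eq_or_lt_of_le ht.2 with h' | h'
    · exact Or.inr (Or.inl h')
    · exact Or.inr (Or.inr ⟨h, h'⟩)
  intro s hs t ht he
  rcases key s hs with rfl | rfl | hs' <;> rcases key t ht with rfl | rfl | ht'
  · rfl
  · exact absurd he h01
  · exact absurd ⟨t, ht', he.symm⟩ h0
  · exact absurd he.symm h01
  · rfl
  · exact absurd ⟨t, ht', he.symm⟩ h1
  · exact absurd ⟨s, hs', he⟩ h0
  · exact absurd ⟨s, hs', he⟩ h1
  · exact h hs' ht' he

namespace Pic
variable {ι κ : Type*} {P : Set Plane} {c : ι → ℝ → Plane}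

theorem comp (h : Pic P c) {f : κ → ι} (hf : Function.Injective f) : Pic P fun k => c (f k) where
  finite_pts := h.finite_pts
  polygonal _ := h.polygonal _
  simple _ := h.simple _
  left_mem _ := h.left_mem _
  right_mem _ := h.right_mem _
  avoids _ := h.avoids _
  finite _ _ hkl := h.finite _ _ (hf.ne hkl)
  no_triple _ _ _ h1 h2 h3 := h.no_triple _ _ _ (hf.ne h1) (hf.ne h2) (hf.ne h3)

theorem isArc (h : Pic P c) {i : ι} (hi : c i 0 ≠ c i 1) : IsArc (c i) (c i 0) (c i 1) :=
  ⟨h.polygonal i, injOn_Icc_of_injOn_Ioo (h.simple i) (h.avoids i _ (h.left_mem i))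
    (h.avoids i _ (h.right_mem i)) hi, rfl, rfl⟩

theorem mem_Ioo (h : Pic P c) {i : ι} {t : ℝ} (ht : t ∈ Icc (0 : ℝ) 1) (hp : c i t ∉ P) :
    t ∈ Ioo (0 : ℝ) 1 := by
  refine ⟨lt_of_le_of_ne ht.1 ?_, lt_of_le_of_ne ht.2 ?_⟩
  · rintro rfl
    exact hp (h.left_mem i)
  · rintro rfl
    exact hp (h.right_mem i)

/-- Adding an arc to a family. -/
theorem cons (h : Pic P c) {d : ℝ → Plane} {x y : Plane} (hd : IsArc d x y) (hx : x ∈ P) (hy : y ∈ P)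
    (hP : ∀ p ∈ P, p ∉ d '' Ioo 0 1) (hfin : ∀ i, (d '' Ioo 0 1 ∩ c i '' Ioo 0 1).Finite)
    (htr : ∀ i j, i ≠ j → ∀ p ∈ d '' Ioo 0 1, p ∈ c i '' Ioo 0 1 → p ∉ c j '' Ioo 0 1) :
    Pic P (fun o : Option ι => o.elim d c) where
  finite_pts := h.finite_pts
  polygonal := by rintro (_ | i); exacts [hd.polygonal, h.polygonal i]
  simple := by rintro (_ | i); exacts [hd.injOn_Ioo, h.simple i]
  left_mem := by
    rintro (_ | i)
    · change d 0 ∈ P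
      rwa [hd.left]
    · exact h.left_mem i
  right_mem := by
    rintro (_ | i)
    · change d 1 ∈ P
      rwa [hd.right]
    · exact h.right_mem i
  avoids := by rintro (_ | i); exacts [hP, h.avoids i]
  finite := by
    rintro (_ | i) (_ | j) hij
    · exact absurd rfl hij
    · exact hfin j
    · rw [inter_comm]; exact hfin i
    · exact h.finite i j fun he => hij (by rw [he])
  no_triple := by
    rintro (_ | i) (_ | j) (_ | k) hij hik hjk p ⟨h1, h2, h3⟩
    · exact hij rfl
    · exact hij rfl
    · exact hik rfl
    · exact htr j k (fun he => hjk (by rw [he])) p h1 h2 h3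
    · exact hjk rfl
    · exact htr i k (fun he => hik (by rw [he])) p h2 h1 h3
    · exact htr i j (fun he => hij (by rw [he])) p h3 h1 h2
    · exact h.no_triple i j k (fun he => hij (by rw [he])) (fun he => hik (by rw [he]))
        (fun he => hjk (by rw [he])) p ⟨h1, h2, h3⟩

/-- Arcs on both sides of an arc `γ` that is composed of the curves in `S`, joined at the point
`γ ts`, as in `IsArc.exists_two_sided`. At most one further curve may end at this point. -/
theorem exists_two_sided [Finite ι] (h : Pic P c) (S : Set ι) {γ : ℝ → Plane} {x y : Plane}
    (hγ : IsArc γ x y) {ts : ℝ} (hts : ts ∈ Ico (0 : ℝ) 1) (hx : x ∈ P) (hy : y ∈ P)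
    (htsP : γ ts ∈ P) (hγS : ∀ p ∈ γ '' Ioo 0 1, p ≠ γ ts → ∃ i ∈ S, p ∈ c i '' Ioo 0 1)
    (hSγ : ∀ i ∈ S, c i '' Ioo 0 1 ⊆ γ '' Ioo 0 1)
    (hone : γ ts ∈ γ '' Ioo 0 1 → ∀ j k, j ∉ S → k ∉ S → ∀ t u, t = 0 ∨ t = 1 → u = 0 ∨ u = 1 →
      c j t = γ ts → c k u = γ ts → j = k ∧ t = u) :
    ∃ L R, IsArc L x y ∧ IsArc R (γ ts) y ∧
      Pic P (fun o : Option (Option ι) => o.elim L fun o => o.elim R c) ∧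
      Disjoint (L '' Ioo 0 1) (γ '' Icc 0 1) ∧ Disjoint (R '' Ioo 0 1) (γ '' Icc 0 1) ∧
      Disjoint (L '' Ioo 0 1) (R '' Ioo 0 1) ∧
      ∀ j, j ∉ S → (L '' Ioo 0 1 ∩ c j '' Ioo 0 1).ncard + (R '' Ioo 0 1 ∩ c j '' Ioo 0 1).ncard ≤
        2 * (γ '' Ioo 0 1 ∩ c j '' Ioo 0 1).ncard := by
  have hγP : ∀ p ∈ γ '' Ioo 0 1, p ∈ P → p = γ ts := by
    intro p hp hpP
    by_contra hne
    obtain ⟨i, -, hi⟩ := hγS p hp hne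
    exact h.avoids i p hpP hi
  have hγIoo : ∀ p ∈ γ '' Icc 0 1, p ∉ P → p ∈ γ '' Ioo 0 1 := by
    intro p hp hpP
    rw [hγ.image_Icc] at hp
    rcases hp with rfl | rfl | hp
    · exact absurd hx hpP
    · exact absurd hy hpP
    · exact hp
  have hcγ : ∀ j, ∀ t ∈ Ioo (0 : ℝ) 1, c j t ∈ γ '' Icc 0 1 →
      c j t ∈ γ '' Ioo 0 1 ∧ ∃ i ∈ S, c j t ∈ c i '' Ioo 0 1 := by
    intro j t ht hjt
    have hP : c j t ∉ P := fun hP => h.avoids j _ hP ⟨t, ht, rfl⟩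
    have h1 := hγIoo _ hjt hP
    exact ⟨h1, hγS _ h1 fun he => hP (he ▸ htsP)⟩
  have hfin : ∀ j, j ∉ S → (γ '' Ioo 0 1 ∩ c j '' Ioo 0 1).Finite := by
    intro j hj
    refine (finite_iUnion fun i : S => h.finite i j fun he => hj (he ▸ i.2)).subset ?_
    rintro p ⟨hp, t, ht, rfl⟩
    obtain ⟨-, i, hi, hpi⟩ := hcγ j t ht (image_mono Ioo_subset_Icc_self hp)
    exact mem_iUnion.2 ⟨⟨i, hi⟩, hpi, ⟨t, ht, rfl⟩⟩
  have hcount : ∀ j, {t ∈ Ioo (0 : ℝ) 1 | c j t ∈ γ '' Ioo 0 1}.ncard =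
      (γ '' Ioo 0 1 ∩ c j '' Ioo 0 1).ncard := by
    intro j
    rw [← ((h.simple j).mono (sep_subset _ _)).ncard_image]
    congr 1
    ext p
    constructor
    · rintro ⟨t, ⟨ht, htγ⟩, rfl⟩
      exact ⟨htγ, ⟨t, ht, rfl⟩⟩
    · rintro ⟨hp, t, ht, rfl⟩
      exact ⟨t, ⟨ht, hp⟩, rfl⟩
  let K : Set Plane := {p | ∃ i j, i ≠ j ∧ p ∈ c i '' Ioo 0 1 ∧ p ∈ c j '' Ioo 0 1}
  have hK : K.Finite := by
    refine (finite_iUnion fun i => finite_iUnion fun j => finite_iUnion fun hij : i ≠ j =>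
      h.finite i j hij).subset ?_
    rintro p ⟨i, j, hij, h1, h2⟩
    simp only [mem_iUnion]
    exact ⟨i, j, hij, h1, h2⟩
  obtain ⟨L, R, hL, hR, hLγ, hRγ, hRL, hLA, hRA, hcnt⟩ := hγ.exists_two_sided hts
    (J := {j // j ∉ S}) (fun j => c j) (fun j => h.polygonal j) (by
      rintro ⟨j, hj⟩
      have h1 : {t ∈ Ioo (0 : ℝ) 1 | c j t ∈ γ '' Ioo 0 1}.Finite := by
        refine Set.Finite.of_finite_image (f := c j) ((hfin j hj).subset ?_)
          ((h.simple j).mono (sep_subset _ _))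
        rintro _ ⟨t, ht, rfl⟩
        exact ⟨ht.2, ⟨t, ht.1, rfl⟩⟩
      refine (h1.union (Set.toFinite {0, 1})).subset ?_
      rintro t ⟨ht, htγ⟩
      by_cases h01 : t = 0 ∨ t = 1
      · exact Or.inr h01
      · rw [not_or] at h01
        have ht' : t ∈ Ioo (0 : ℝ) 1 :=
          ⟨lt_of_le_of_ne ht.1 (Ne.symm h01.1), lt_of_le_of_ne ht.2 h01.2⟩
        exact Or.inl ⟨ht', (hcγ j t ht' htγ).1⟩)
    (A := (P ∪ K) \ γ '' Icc 0 1) ((h.finite_pts.union hK).subset sdiff_subset) disjoint_sdiff_left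
    (by
      rintro ⟨j, hj⟩ ⟨k, hk⟩ t ht u hu he htγ
      by_cases hP : c j t ∈ P
      · have e1 := hγP _ htγ hP
        have hend : ∀ i, ∀ r ∈ Icc (0 : ℝ) 1, c i r ∈ P → r = 0 ∨ r = 1 := by
          intro i r hr hrP
          by_contra hc
          rw [not_or] at hc
          exact h.avoids i _ hrP
            ⟨r, ⟨lt_of_le_of_ne hr.1 (Ne.symm hc.1), lt_of_le_of_ne hr.2 hc.2⟩, rfl⟩
        obtain ⟨rfl, rfl⟩ := hone (e1 ▸ htγ) j k hj hk t u (hend j t ht hP)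
          (hend k u hu (he ▸ hP)) e1 (he ▸ e1)
        exact ⟨rfl, rfl⟩
      · have ht' := h.mem_Ioo ht hP
        have hu' := h.mem_Ioo hu (he ▸ hP)
        obtain ⟨-, i, hi, hpi⟩ := hcγ j t ht' (image_mono Ioo_subset_Icc_self htγ)
        have hjk : j = k := by
          by_contra hjk
          exact h.no_triple i j k (fun e => hj (e ▸ hi)) (fun e => hk (e ▸ hi)) hjk _
            ⟨hpi, ⟨t, ht', rfl⟩, ⟨u, hu', he.symm⟩⟩
        subst hjk
        exact ⟨rfl, h.simple j ht' hu' he⟩)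
    (by
      rintro ⟨j, hj⟩ t (rfl | rfl) hp
      · exact hγP _ hp (h.left_mem j)
      · exact hγP _ hp (h.right_mem j))
    (by
      rintro ⟨j, hj⟩ t ht he
      exact h.avoids j _ htsP (he ▸ ⟨t, ht, rfl⟩))
  -- the new arcs avoid the points of `P` and the crossings of the family
  have hav : ∀ X : ℝ → Plane, Disjoint (X '' Ioo 0 1) (γ '' Icc 0 1) →
      Disjoint (X '' Ioo 0 1) ((P ∪ K) \ γ '' Icc 0 1) → ∀ p ∈ P ∪ K, p ∉ X '' Ioo 0 1 := by
    intro X h1 h2 p hp hpX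
    by_cases hpγ : p ∈ γ '' Icc 0 1
    · exact disjoint_left.1 h1 hpX hpγ
    · exact disjoint_left.1 h2 hpX ⟨hp, hpγ⟩
  have hfinX : ∀ X : ℝ → Plane, Disjoint (X '' Ioo 0 1) (γ '' Icc 0 1) →
      (∀ j : {j // j ∉ S}, (X '' Ioo 0 1 ∩ c j '' Icc 0 1).Finite) →
      ∀ i, (X '' Ioo 0 1 ∩ c i '' Ioo 0 1).Finite := by
    intro X h1 h2 i
    by_cases hi : i ∈ S
    · have : Disjoint (X '' Ioo 0 1) (c i '' Ioo 0 1) :=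
        h1.mono_right ((hSγ i hi).trans (image_mono Ioo_subset_Icc_self))
      rw [disjoint_iff_inter_eq_empty.1 this]
      exact finite_empty
    · exact (h2 ⟨i, hi⟩).subset (inter_subset_inter_right _ (image_mono Ioo_subset_Icc_self))
  have hpR := h.cons hR htsP hy (fun p hp => hav R hRγ hRA p (Or.inl hp))
    (hfinX R hRγ fun j => (hcnt j).2.1)
    (fun i j hij p hpR h1 h2 => hav R hRγ hRA p (Or.inr ⟨i, j, hij, h1, h2⟩) hpR)
  have hpL := hpR.cons hL hx hy (fun p hp => hav L hLγ hLA p (Or.inl hp))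
    (by
      rintro (_ | i)
      · rw [inter_comm]
        change (R '' Ioo 0 1 ∩ L '' Ioo 0 1).Finite
        rw [disjoint_iff_inter_eq_empty.1 hRL]
        exact finite_empty
      · exact hfinX L hLγ (fun j => (hcnt j).1) i)
    (by
      rintro (_ | i) (_ | j) hij p hpL h1 h2
      · exact hij rfl
      · exact disjoint_left.1 hRL h1 hpL
      · exact disjoint_left.1 hRL h2 hpL
      · exact hav L hLγ hLA p (Or.inr ⟨i, j, fun he => hij (by rw [he]), h1, h2⟩) hpL)
  refine ⟨L, R, hL, hR, hpL, hLγ, hRγ, hRL.symm, fun j hj => ?_⟩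
  rw [← hcount j]
  refine le_trans (add_le_add (ncard_le_ncard ?_ (hcnt ⟨j, hj⟩).1)
    (ncard_le_ncard ?_ (hcnt ⟨j, hj⟩).2.1)) (hcnt ⟨j, hj⟩).2.2
  · exact inter_subset_inter_right _ (image_mono Ioo_subset_Icc_self)
  · exact inter_subset_inter_right _ (image_mono Ioo_subset_Icc_self)

/-- **Doubling a curve.** A curve that is not a loop can be drawn a second time, without crossing
the first copy and without increasing the weighted number of crossings. -/
theorem exists_double [Finite ι] (h : Pic P c) {e : ι} (he : c e 0 ≠ c e 1) (s : Finset κ)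
    (f : κ → ι) :
    ∃ d, Pic P (fun o : Option ι => o.elim d c) ∧ d 0 = c e 0 ∧ d 1 = c e 1 ∧
      ∑ k ∈ s, crossCount (fun o : Option ι => o.elim d c) none (some (f k)) ≤
        ∑ k ∈ s, crossCount c e (f k) := by
  have ha := h.isArc he
  obtain ⟨L, R, hL, hR, hpic, hLγ, hRγ, hLR, hcnt⟩ := h.exists_two_sided {e} ha (ts := 0) (by simp)
    (h.left_mem e) (h.right_mem e) (h.left_mem e) (fun p hp _ => ⟨e, rfl, hp⟩)
    (by rintro i rfl; exact subset_rfl) (fun hc => absurd hc (h.avoids e _ (h.left_mem e)))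
  have hsum : ∑ k ∈ s, crossCount (fun o : Option ι => o.elim L c) none (some (f k)) +
      ∑ k ∈ s, crossCount (fun o : Option ι => o.elim R c) none (some (f k)) ≤
      2 * ∑ k ∈ s, crossCount c e (f k) := by
    rw [← Finset.sum_add_distrib, Finset.mul_sum]
    refine Finset.sum_le_sum fun k _ => ?_
    rw [crossCount_of_ne (Option.some_ne_none _).symm, crossCount_of_ne (Option.some_ne_none _).symm]
    change (L '' Ioo 0 1 ∩ c (f k) '' Ioo 0 1).ncard + (R '' Ioo 0 1 ∩ c (f k) '' Ioo 0 1).ncard ≤ _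
    by_cases hk : f k = e
    · rw [hk, disjoint_iff_inter_eq_empty.1 (hLγ.mono_right (image_mono Ioo_subset_Icc_self)),
        disjoint_iff_inter_eq_empty.1 (hRγ.mono_right (image_mono Ioo_subset_Icc_self))]
      simp
    · rw [crossCount_of_ne (Ne.symm hk)]
      exact hcnt (f k) hk
  rcases le_total (∑ k ∈ s, crossCount (fun o : Option ι => o.elim L c) none (some (f k)))
    (∑ k ∈ s, crossCount (fun o : Option ι => o.elim R c) none (some (f k))) with hle | hle
  · refine ⟨L, ?_, hL.left, hL.right, by linarith⟩
    have := hpic.comp (f := fun o : Option ι => o.elim none fun i => some (some i)) (by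
      rintro (_ | i) (_ | j) hij <;> simp_all)
    convert this using 2 with o
    cases o <;> rfl
  · refine ⟨R, ?_, hR.left, hR.right, by linarith⟩
    exact hpic.comp (f := fun o : Option ι => some o) fun i j hij => by simpa using hij

end Pic

theorem sum_sum_erase {κ : Type*} [Fintype κ] [DecidableEq κ] (g : κ → κ → ℕ)
    (hsymm : ∀ k l, g k l = g l k) (hdiag : ∀ k, g k k = 0) (a : κ) :
    ∑ k, ∑ l, g k l = ∑ k ∈ Finset.univ.erase a, ∑ l ∈ Finset.univ.erase a, g k l +
      2 * ∑ k ∈ Finset.univ.erase a, g a k := by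
  have h1 : ∀ k, ∑ l, g k l = g k a + ∑ l ∈ Finset.univ.erase a, g k l := fun k =>
    (Finset.add_sum_erase _ _ (Finset.mem_univ a)).symm
  rw [← Finset.add_sum_erase _ _ (Finset.mem_univ a), h1 a, hdiag,
    Finset.sum_congr rfl fun k _ => h1 k, Finset.sum_add_distrib,
    Finset.sum_congr rfl fun k _ => hsymm k a]
  ring

/-- **Thickening.** The curves `c i` can be replaced by bunches of parallel curves, one curve for
each `k` with `f k = i`. The number of crossings is the weighted number of crossings of the
original family. -/
theorem Pic.thicken {ι κ : Type*} [Finite ι] [Fintype κ] {P : Set Plane} {c : ι → ℝ → Plane}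
    (h : Pic P c) (f : κ → ι) (hf : ∀ k l, k ≠ l → f k = f l → c (f k) 0 ≠ c (f k) 1) :
    ∃ c' : κ → ℝ → Plane, Pic P c' ∧ (∀ k, c' k 0 = c (f k) 0 ∧ c' k 1 = c (f k) 1) ∧
      ∑ k, ∑ l, crossCount c' k l ≤ ∑ k, ∑ l, crossCount c (f k) (f l) := by
  classical
  have hcard : ∀ {β : Type _} (g : κ → β), (range g).ncard ≤ Fintype.card κ := fun g => by
    rw [← image_univ, ← Nat.card_eq_fintype_card, ← ncard_univ]
    exact ncard_image_le
  obtain ⟨d, hd⟩ : ∃ d, Fintype.card κ = (range f).ncard + d :=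
    ⟨_, (Nat.add_sub_of_le (hcard f)).symm⟩
  clear hcard
  induction d generalizing ι with
  | zero =>
    have hinj : Function.Injective f := by
      rw [add_zero, ← image_univ, ← Nat.card_eq_fintype_card, ← ncard_univ] at hd
      exact injOn_univ.1 (injOn_of_ncard_image_eq hd.symm)
    exact ⟨fun k => c (f k), h.comp hinj, fun k => ⟨rfl, rfl⟩, by
      simp only [crossCount_comp hinj, le_refl]⟩
  | succ d ih =>
    have hninj : ¬ Function.Injective f := by
      intro hinj
      rw [← image_univ, ncard_image_of_injective _ hinj, ncard_univ, Nat.card_eq_fintype_card] at hd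
      omega
    unfold Function.Injective at hninj
    push Not at hninj
    obtain ⟨a, b, hab, hne⟩ := hninj
    obtain ⟨δ, hδ, hδ0, hδ1, hsum⟩ := h.exists_double (hf a b hne hab) (Finset.univ.erase a) f
    let f' : κ → Option ι := fun k => if k = a then none else some (f k)
    have hf'a : f' a = none := if_pos rfl
    have hf' : ∀ k, k ≠ a → f' k = some (f k) := fun k hk => if_neg hk
    have himg : range f' = insert none (some '' range f) := by
      ext o
      constructor
      · rintro ⟨k, rfl⟩
        by_cases hk : k = a
        · exact Or.inl (hk ▸ hf'a)
        · exact Or.inr ⟨f k, ⟨k, rfl⟩, (hf' k hk).symm⟩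
      · rintro (rfl | ⟨_, ⟨k, rfl⟩, rfl⟩)
        · exact ⟨a, hf'a⟩
        · by_cases hk : k = a
          · exact ⟨b, by rw [hf' b hne.symm, hk, hab]⟩
          · exact ⟨k, hf' k hk⟩
    obtain ⟨c', hc', hends, hle⟩ := ih hδ f' (by
      intro k l hkl hkl'
      by_cases hk : k = a
      · rw [hk, hf'a]
        simp only [Option.elim]
        rw [hδ0, hδ1]
        exact hf a b hne hab
      · rw [hf' k hk] at hkl' ⊢
        have hl : l ≠ a := by
          rintro rfl
          rw [hf'a] at hkl'
          simp at hkl'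
        rw [hf' l hl] at hkl'
        exact hf k l hkl (Option.some_injective _ hkl')) (by
      rw [himg, ncard_insert_of_notMem (by simp), ncard_image_of_injective _ (Option.some_injective _)]
      omega)
    refine ⟨c', hc', fun k => ?_, hle.trans ?_⟩
    · by_cases hk : k = a
      · have := hends k
        rw [hk, hf'a] at this
        simp only [Option.elim] at this
        rw [hk, ← hδ0, ← hδ1]
        exact this
      · have := hends k
        rw [hf' k hk] at this
        exact this
    · rw [sum_sum_erase _ (fun k l => crossCount_comm _ _) (fun k => crossCount_self _) a,
        sum_sum_erase (fun k l => crossCount c (f k) (f l)) (fun k l => crossCount_comm _ _)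
          (fun k => crossCount_self _) a, hf'a]
      refine add_le_add (le_of_eq ?_) (Nat.mul_le_mul_left 2 (le_trans (le_of_eq ?_) hsum))
      · refine Finset.sum_congr rfl fun k hk => Finset.sum_congr rfl fun l hl => ?_
        rw [hf' k (Finset.ne_of_mem_erase hk), hf' l (Finset.ne_of_mem_erase hl)]
        exact (crossCount_comp (c := fun o : Option ι => o.elim δ c) (Option.some_injective _) _ _).symm
      · exact Finset.sum_congr rfl fun k hk => by rw [hf' k (Finset.ne_of_mem_erase hk)]

/-- Each crossing of a family of curves is counted for two ordered pairs of curves. -/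
theorem Pic.sum_crossCount {ι : Type*} [Fintype ι] {P : Set Plane} {c : ι → ℝ → Plane} (h : Pic P c) :
    {p | ∃ i j, i ≠ j ∧ p ∈ c i '' Ioo 0 1 ∧ p ∈ c j '' Ioo 0 1}.Finite ∧
    ∑ i, ∑ j, crossCount c i j =
      2 * {p | ∃ i j, i ≠ j ∧ p ∈ c i '' Ioo 0 1 ∧ p ∈ c j '' Ioo 0 1}.ncard := by
  classical
  set K := {p | ∃ i j, i ≠ j ∧ p ∈ c i '' Ioo 0 1 ∧ p ∈ c j '' Ioo 0 1} with hKdef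
  have hK : K.Finite := by
    refine (finite_iUnion fun i => finite_iUnion fun j => finite_iUnion fun hij : i ≠ j =>
      h.finite i j hij).subset ?_
    rintro p ⟨i, j, hij, h1, h2⟩
    simp only [mem_iUnion]
    exact ⟨i, j, hij, h1, h2⟩
  refine ⟨hK, ?_⟩
  have h1 : ∀ i j, crossCount c i j = ∑ p ∈ hK.toFinset,
      if i ≠ j ∧ p ∈ c i '' Ioo 0 1 ∧ p ∈ c j '' Ioo 0 1 then 1 else 0 := by
    intro i j
    by_cases hij : i = j
    · simp [hij]
    · rw [crossCount_of_ne hij, Finset.sum_boole, Nat.cast_id, ← ncard_coe_finset]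
      congr 1
      ext p
      simp only [mem_inter_iff, Finset.coe_filter, Finite.mem_toFinset, mem_ofPred_eq]
      constructor
      · rintro ⟨hi, hj⟩
        exact ⟨⟨i, j, hij, hi, hj⟩, hij, hi, hj⟩
      · rintro ⟨-, -, hi, hj⟩
        exact ⟨hi, hj⟩
  simp only [h1]
  have h2 : ∀ p ∈ hK.toFinset, ∑ i, ∑ j,
      (if i ≠ j ∧ p ∈ c i '' Ioo 0 1 ∧ p ∈ c j '' Ioo 0 1 then 1 else 0) = 2 := by
    intro p hp
    obtain ⟨i, j, hij, hi, hj⟩ := hK.mem_toFinset.1 hp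
    have hfil : Finset.univ.filter (fun k => p ∈ c k '' Ioo 0 1) = {i, j} := by
      ext k
      simp only [Finset.mem_filter, Finset.mem_univ, true_and, Finset.mem_insert,
        Finset.mem_singleton]
      constructor
      · intro hk
        by_contra hc
        rw [not_or] at hc
        exact h.no_triple i j k hij (Ne.symm hc.1) (Ne.symm hc.2) p ⟨hi, hj, hk⟩
      · rintro (rfl | rfl)
        exacts [hi, hj]
    have hoff : ((Finset.univ.filter (fun k => p ∈ c k '' Ioo 0 1)).offDiag).card = 2 := by
      rw [hfil, Finset.offDiag_card, Finset.card_pair hij]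
    rw [← Finset.sum_product', Finset.sum_boole, Nat.cast_id, ← hoff]
    congr 1
    ext ⟨k, l⟩
    simp only [Finset.mem_filter, Finset.mem_offDiag, Finset.mem_product, Finset.mem_univ, true_and]
    tauto
  rw [Finset.sum_congr rfl fun i _ => Finset.sum_comm, Finset.sum_comm, Finset.sum_congr rfl h2,
    Finset.sum_const, smul_eq_mul, ncard_eq_toFinset_card K hK, mul_comm]

/-- Redrawing all members of a bunch `F` along a member with fewest outside crossings does not
increase the number of crossings. -/
theorem exists_bundle {κ : Type*} [Fintype κ] [DecidableEq κ] (x : κ → κ → ℕ)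
    (hsymm : ∀ k l, x k l = x l k) (hdiag : ∀ k, x k k = 0) (F : Finset κ) (hF : F.Nonempty) :
    ∃ e ∈ F, ∑ k, ∑ l, x (if k ∈ F then e else k) (if l ∈ F then e else l) ≤ ∑ k, ∑ l, x k l := by
  obtain ⟨e, he, hmin⟩ := F.exists_min_image (fun k => ∑ l ∈ Fᶜ, x k l) hF
  refine ⟨e, he, ?_⟩
  have split : ∀ g : κ → κ → ℕ, (∀ k l, g k l = g l k) → ∑ k, ∑ l, g k l =
      ∑ k ∈ F, ∑ l ∈ F, g k l + 2 * ∑ k ∈ F, ∑ l ∈ Fᶜ, g k l + ∑ k ∈ Fᶜ, ∑ l ∈ Fᶜ, g k l := by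
    intro g hg
    have h1 : ∀ k, ∑ l, g k l = ∑ l ∈ F, g k l + ∑ l ∈ Fᶜ, g k l := fun k =>
      (Finset.sum_add_sum_compl F _).symm
    have h2 : ∑ k ∈ Fᶜ, ∑ l ∈ F, g k l = ∑ k ∈ F, ∑ l ∈ Fᶜ, g k l := by
      rw [Finset.sum_comm]
      exact Finset.sum_congr rfl fun k _ => Finset.sum_congr rfl fun l _ => hg _ _
    rw [← Finset.sum_add_sum_compl F]
    simp only [h1, Finset.sum_add_distrib]
    rw [h2]
    ring
  rw [split _ fun k l => hsymm _ _, split x hsymm]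
  have hc : ∀ l ∈ Fᶜ, (if l ∈ F then e else l) = l := fun l hl =>
    if_neg (Finset.mem_compl.1 hl)
  have hi : ∀ l ∈ F, (if l ∈ F then e else l) = e := fun l hl => if_pos hl
  refine add_le_add (add_le_add ?_ (Nat.mul_le_mul_left 2 ?_)) (le_of_eq ?_)
  · refine le_trans (le_of_eq ?_) (Nat.zero_le _)
    refine Finset.sum_eq_zero fun k hk => Finset.sum_eq_zero fun l hl => ?_
    rw [hi k hk, hi l hl, hdiag]
  · refine Finset.sum_le_sum fun k hk => ?_
    refine le_trans (le_of_eq ?_) (hmin k hk)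
    exact Finset.sum_congr rfl fun l hl => by rw [hi k hk, hc l hl]
  · exact Finset.sum_congr rfl fun k hk => Finset.sum_congr rfl fun l hl => by rw [hc k hk, hc l hl]

/-- Every bunch of a partition into bunches can be represented by one member, so that redrawing all
bunches along their representatives does not increase the number of crossings. -/
theorem exists_representatives {κ ι : Type*} [Fintype κ] [Finite ι] (x : κ → κ → ℕ)
    (hsymm : ∀ k l, x k l = x l k) (hdiag : ∀ k, x k k = 0) (f : κ → ι)
    (hf : Function.Surjective f) :
    ∃ r : ι → κ, (∀ i, f (r i) = i) ∧ ∑ k, ∑ l, x (r (f k)) (r (f l)) ≤ ∑ k, ∑ l, x k l := by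
  classical
  have := Fintype.ofFinite ι
  have key : ∀ S : Finset ι, ∃ r : κ → κ, (∀ k, f (r k) = f k) ∧
      (∀ k l, f k = f l → f k ∈ S → r k = r l) ∧ ∑ k, ∑ l, x (r k) (r l) ≤ ∑ k, ∑ l, x k l := by
    intro S
    induction S using Finset.induction_on with
    | empty => exact ⟨id, fun _ => rfl, fun k l _ h => absurd h (by simp), le_rfl⟩
    | insert i S hi ih =>
      obtain ⟨r, h1, h2, h3⟩ := ih
      obtain ⟨k₀, hk₀⟩ := hf i
      obtain ⟨e, he, hle⟩ := exists_bundle (fun k l => x (r k) (r l)) (fun k l => hsymm _ _)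
        (fun k => hdiag _) (Finset.univ.filter fun k => f k = i) ⟨k₀, by simp [hk₀]⟩
      have hei : f e = i := (Finset.mem_filter.1 he).2
      simp only [Finset.mem_filter, Finset.mem_univ, true_and] at hle
      refine ⟨fun k => r (if f k = i then e else k), fun k => ?_, fun k l hkl hk => ?_, hle.trans h3⟩
      · rw [h1]
        split_ifs with hk
        · rw [hei, hk]
        · rfl
      · beta_reduce
        by_cases hki : f k = i
        · simp only [hki, hkl.symm.trans hki, if_true]
        · rw [if_neg hki, if_neg (hkl ▸ hki)]
          exact h2 k l hkl ((Finset.mem_insert.1 hk).resolve_left hki)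
  obtain ⟨r, h1, h2, h3⟩ := key Finset.univ
  choose g hg using hf
  refine ⟨fun i => r (g i), fun i => (h1 _).trans (hg i), ?_⟩
  have : ∀ k, r (g (f k)) = r k := fun k => h2 _ _ (hg _) (Finset.mem_univ _)
  simpa only [this] using h3

/-! ### Weighted numbers of crossings and drawings of graphs -/

/-- Twice the number of crossings of the drawing in which the `i`-th curve of the family `c` is
replaced by `W i` parallel copies. -/
noncomputable def cost {ι : Type*} [Fintype ι] (W : ι → ℕ) (c : ι → ℝ → Plane) : ℕ :=
  ∑ i, ∑ j, W i * W j * crossCount c i j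

theorem sum_comp_eq_sum_ncard_mul {κ ι : Type*} [Fintype κ] [Fintype ι] (f : κ → ι) (g : ι → ℕ) :
    ∑ k, g (f k) = ∑ i, {k | f k = i}.ncard * g i := by
  classical
  have h1 : ∀ k, g (f k) = ∑ i, if f k = i then g i else 0 := fun k => by simp
  rw [Finset.sum_congr rfl fun k _ => h1 k, Finset.sum_comm]
  refine Finset.sum_congr rfl fun i _ => ?_
  rw [← Finset.sum_filter, Finset.sum_const, smul_eq_mul, ← ncard_coe_finset]
  congr 2
  ext k
  simp

theorem sum_sum_comp_eq {κ ι : Type*} [Fintype κ] [Fintype ι] (f : κ → ι) (x : ι → ι → ℕ) :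
    ∑ k, ∑ l, x (f k) (f l) =
      ∑ i, ∑ j, {k | f k = i}.ncard * {k | f k = j}.ncard * x i j := by
  rw [sum_comp_eq_sum_ncard_mul f fun i => ∑ l, x i (f l)]
  refine Finset.sum_congr rfl fun i _ => ?_
  rw [sum_comp_eq_sum_ncard_mul f fun j => x i j, Finset.mul_sum]
  exact Finset.sum_congr rfl fun j _ => (mul_assoc _ _ _).symm

section Graph

variable {α β ι : Type*} {K : Graph α β}

/-- A drawing of a family of arcs is turned into one of a graph `K` whose edges are distributed
over the arcs, those in `F i` running along the `i`-th arc: each arc is replaced by as many parallel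
copies as needed. -/
theorem crossingNumber_lt [Fintype ι] (hE : K.edgeSet.Finite) {pos : α → Plane}
    (hpos : InjOn pos K.vertexSet) {P : Set Plane} {c : ι → ℝ → Plane} (h : Pic P c)
    (hP : pos '' K.vertexSet ⊆ P) (F : ι → Set β) (hF : ∀ e ∈ K.edgeSet, ∃ i, e ∈ F i)
    (a b : ι → α) (hlink : ∀ i, ∀ e ∈ F i, e ∈ K.edgeSet → K.IsLink e (a i) (b i))
    (hends : ∀ i, s(c i 0, c i 1) = s(pos (a i), pos (b i))) (W : ι → ℕ)
    (hW : ∀ i, (F i ∩ K.edgeSet).ncard ≤ W i)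
    (hloop : ∀ i, W i ≤ 1 ∨ c i 0 ≠ c i 1) {m : ℕ} (hm : cost W c < 2 * m) :
    K.crossingNumber < m := by
  classical
  have := hE.fintype
  have hF' : ∀ e : K.edgeSet, ∃ i, (e : β) ∈ F i := fun e => hF e e.2
  choose f hf using hF'
  have hfW : ∀ i, {k | f k = i}.ncard ≤ W i := fun i => by
    refine le_trans ?_ (hW i)
    rw [← ncard_image_of_injective _ Subtype.val_injective]
    refine ncard_le_ncard ?_ (hE.subset inter_subset_right)
    rintro _ ⟨k, rfl, rfl⟩
    exact ⟨hf k, k.2⟩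
  obtain ⟨c', hc', hends', hsum⟩ := h.thicken f (by
    intro k l hkl hfkl
    refine (hloop (f k)).resolve_left fun hle => hkl ?_
    exact (ncard_le_one (toFinite _)).1 ((hfW _).trans hle) k rfl l hfkl.symm)
  obtain ⟨hKfin, hK⟩ := hc'.sum_crossCount
  rw [sum_sum_comp_eq f (crossCount c)] at hsum
  have hcost : ∑ k, ∑ l, crossCount c' k l ≤ cost W c := by
    refine hsum.trans (Finset.sum_le_sum fun i _ => Finset.sum_le_sum fun j _ => ?_)
    exact Nat.mul_le_mul_right _ (Nat.mul_le_mul (hfW i) (hfW j))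
  let cur : β → ℝ → Plane := fun e => if he : e ∈ K.edgeSet then c' ⟨e, he⟩ else fun _ => 0
  have hcur : ∀ e (he : e ∈ K.edgeSet), cur e = c' ⟨e, he⟩ := fun e he => dif_pos he
  let D : K.Drawing :=
    { pos := pos
      curve := cur
      pos_injOn := hpos
      polygonal := fun e he => by rw [hcur e he]; exact hc'.polygonal _
      joins := fun e he => by
        rw [hcur e he]
        have hl := hlink _ e (hf ⟨e, he⟩) he
        rw [(hends' ⟨e, he⟩).1, (hends' ⟨e, he⟩).2]
        rcases Sym2.eq_iff.1 (hends (f ⟨e, he⟩)) with ⟨h0, h1⟩ | ⟨h0, h1⟩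
        exacts [⟨_, _, hl, h0, h1⟩, ⟨_, _, hl.symm, h0, h1⟩]
      simple := fun e he => by rw [hcur e he]; exact hc'.simple _
      avoids := fun e he x hx => by
        rw [hcur e he]; exact hc'.avoids _ _ (hP (mem_image_of_mem _ hx))
      no_triple := fun e he f hf g hg hef heg hfg => by
        rw [hcur e he, hcur f hf, hcur g hg]
        exact hc'.no_triple _ _ _ (fun h => hef (congrArg Subtype.val h))
          (fun h => heg (congrArg Subtype.val h)) (fun h => hfg (congrArg Subtype.val h)) }
  have hD : D.crossings ⊆ {p | ∃ i j, i ≠ j ∧ p ∈ c' i '' Ioo 0 1 ∧ p ∈ c' j '' Ioo 0 1} := by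
    rintro p ⟨e, he, f, hf, hef, h1, h2⟩
    change p ∈ cur e '' _ at h1
    change p ∈ cur f '' _ at h2
    rw [hcur e he] at h1
    rw [hcur f hf] at h2
    exact ⟨_, _, fun h => hef (congrArg Subtype.val h), h1, h2⟩
  refine iInf_lt_iff.2 ⟨D, (encard_le_encard hD).trans_lt ?_⟩
  rw [← hKfin.cast_ncard_eq]
  have : ncard {p | ∃ i j, i ≠ j ∧ p ∈ c' i '' Ioo 0 1 ∧ p ∈ c' j '' Ioo 0 1} < m := by omega
  exact_mod_cast this

/-- If the edges of `K` are distributed over the classes in `ι`, all edges of a class being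
parallel, then a drawing of `K` with fewer than `m` crossings contains a family of curves, one for each class, such that
bundling all edges of a class along its curve does not increase the number of crossings. -/
theorem exists_pic_of_crossingNumber_lt [Fintype ι] (hV : K.vertexSet.Finite)
    (hE : K.edgeSet.Finite) {m : ℕ} (hm : K.crossingNumber < m) (F : ι → Set β)
    (hF : ∀ e ∈ K.edgeSet, ∃ i, e ∈ F i) (hdisj : ∀ i j, i ≠ j → Disjoint (F i) (F j))
    (a b : ι → α) (hlink : ∀ i, ∀ e ∈ F i, e ∈ K.edgeSet → K.IsLink e (a i) (b i)) (W : ι → ℕ)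
    (hW : ∀ i, W i ≤ (F i ∩ K.edgeSet).ncard) (hW0 : ∀ i, 0 < W i) :
    ∃ (pos : α → Plane) (c : ι → ℝ → Plane), InjOn pos K.vertexSet ∧ Pic (pos '' K.vertexSet) c ∧
      (∀ i, c i 0 = pos (a i)) ∧ (∀ i, c i 1 = pos (b i)) ∧ cost W c < 2 * m := by
  classical
  have := hE.fintype
  obtain ⟨D, hD⟩ := iInf_lt_iff.1 hm
  have hDfin : D.crossings.Finite := finite_of_encard_le_coe hD.le
  have hpic : Pic (D.pos '' K.vertexSet) (fun e : K.edgeSet => D.curve e) :=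
    { finite_pts := hV.image _
      polygonal := fun e => D.polygonal e e.2
      simple := fun e => D.simple e e.2
      left_mem := fun e => by
        obtain ⟨x, y, hl, h0, h1⟩ := D.joins e e.2
        exact ⟨x, hl.left_mem, h0.symm⟩
      right_mem := fun e => by
        obtain ⟨x, y, hl, h0, h1⟩ := D.joins e e.2
        exact ⟨y, hl.right_mem, h1.symm⟩
      avoids := by
        rintro e _ ⟨x, hx, rfl⟩
        exact D.avoids e e.2 x hx
      finite := fun e f hef => hDfin.subset fun p hp =>
        ⟨e, e.2, f, f.2, fun h => hef (Subtype.ext h), hp.1, hp.2⟩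
      no_triple := fun e f g hef heg hfg => D.no_triple e e.2 f f.2 g g.2
        (fun h => hef (Subtype.ext h)) (fun h => heg (Subtype.ext h))
        (fun h => hfg (Subtype.ext h)) }
  obtain ⟨-, hsum⟩ := hpic.sum_crossCount
  have hF' : ∀ e : K.edgeSet, ∃ i, (e : β) ∈ F i := fun e => hF e e.2
  choose f hf using hF'
  have hfeq : ∀ (e : K.edgeSet) i, (e : β) ∈ F i → f e = i := fun e i he => by
    by_contra hne
    exact disjoint_left.1 (hdisj _ _ hne) (hf e) he
  have hfW : ∀ i, W i ≤ {k | f k = i}.ncard := fun i => by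
    refine (hW i).trans ?_
    rw [← ncard_image_of_injective _ Subtype.val_injective]
    refine ncard_le_ncard ?_ (toFinite _)
    exact fun e he => ⟨⟨e, he.2⟩, hfeq ⟨e, he.2⟩ i he.1, rfl⟩
  have hlink : ∀ e : K.edgeSet, K.IsLink e (a (f e)) (b (f e)) := fun e => hlink _ e (hf e) e.2
  have hsurj : Function.Surjective f := by
    intro i
    obtain ⟨e, he⟩ := nonempty_of_ncard_ne_zero ((hW0 i).trans_le (hfW i)).ne'
    exact ⟨e, he⟩
  obtain ⟨r, hr, hrsum⟩ := exists_representatives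
    (crossCount fun e : K.edgeSet => D.curve e) (fun _ _ => crossCount_comm _ _)
    (fun _ => crossCount_self _) f hsurj
  have hrinj : Function.Injective r := fun i j hij => by rw [← hr i, ← hr j, hij]
  have hcomp := hpic.comp hrinj
  -- Each curve is traversed in the direction prescribed by `a` and `b`.
  have hor : ∀ i, ∃ δ : ℝ → Plane, IsPolygonal δ ∧ InjOn δ (Ioo 0 1) ∧ δ 0 = D.pos (a i) ∧
      δ 1 = D.pos (b i) ∧ δ '' Ioo 0 1 = D.curve (r i) '' Ioo 0 1 := by
    intro i
    obtain ⟨x, y, hl, h0, h1⟩ := D.joins _ (r i).2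
    have hl' := hlink (r i)
    rw [hr i] at hl'
    rcases hl.eq_and_eq_or_eq_and_eq hl' with ⟨rfl, rfl⟩ | ⟨rfl, rfl⟩
    · exact ⟨_, D.polygonal _ (r i).2, D.simple _ (r i).2, h0, h1, rfl⟩
    · have him : (fun t : ℝ => 1 - t) '' Ioo 0 1 = Ioo 0 1 := by
        rw [image_const_sub_Ioo]; norm_num
      have hmaps : MapsTo (fun t : ℝ => 1 - t) (Ioo 0 1) (Ioo 0 1) := fun t ht => by
        constructor <;> linarith [ht.1, ht.2]
      refine ⟨fun t => D.curve (r i) (1 - t), ?_, ?_, by simpa using h1, by simpa using h0, ?_⟩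
      · have := (D.polygonal _ (r i).2).comp_affine (c := -1) (d := 1) (by norm_num) (by simp)
          (by simp)
        simpa only [neg_mul, one_mul, neg_add_eq_sub] using this
      · intro u hu v hv huv
        have := D.simple _ (r i).2 (hmaps hu) (hmaps hv) huv
        linarith
      · rw [← image_image (D.curve (r i)) (fun t : ℝ => 1 - t), him]
  choose δ hδp hδi hδ0 hδ1 hδim using hor
  have hcc : ∀ i j, crossCount δ i j = crossCount (fun e : K.edgeSet => D.curve e) (r i) (r j) := by
    intro i j
    rw [← crossCount_comp hrinj]
    by_cases hij : i = j
    · rw [hij, crossCount_self, crossCount_self]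
    · rw [crossCount_of_ne hij, crossCount_of_ne hij, hδim, hδim]
  refine ⟨D.pos, δ, D.pos_injOn, ?_, hδ0, hδ1, ?_⟩
  · exact
    { finite_pts := hV.image _
      polygonal := hδp
      simple := hδi
      left_mem := fun i => by
        obtain ⟨e, he⟩ := hsurj i
        rw [hδ0, ← he]
        exact mem_image_of_mem _ (hlink e).left_mem
      right_mem := fun i => by
        obtain ⟨e, he⟩ := hsurj i
        rw [hδ1, ← he]
        exact mem_image_of_mem _ (hlink e).right_mem
      avoids := fun i => by rw [hδim]; exact hcomp.avoids i
      finite := fun i j hij => by rw [hδim, hδim]; exact hcomp.finite i j hij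
      no_triple := fun i j k => by rw [hδim, hδim, hδim]; exact hcomp.no_triple i j k }
  · have hle : cost W δ ≤ ∑ k : K.edgeSet, ∑ l : K.edgeSet,
        crossCount (fun e : K.edgeSet => D.curve e) (r (f k)) (r (f l)) := by
      rw [sum_sum_comp_eq f fun i j =>
        crossCount (fun e : K.edgeSet => D.curve e) (r i) (r j)]
      refine Finset.sum_le_sum fun i _ => Finset.sum_le_sum fun j _ => ?_
      rw [hcc]
      exact Nat.mul_le_mul_right _ (Nat.mul_le_mul (hfW i) (hfW j))
    have hlt : ncard {p | ∃ e f : K.edgeSet, e ≠ f ∧ p ∈ D.curve e '' Ioo 0 1 ∧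
        p ∈ D.curve f '' Ioo 0 1} < m := by
      have hsub : {p | ∃ e f : K.edgeSet, e ≠ f ∧ p ∈ D.curve e '' Ioo 0 1 ∧
          p ∈ D.curve f '' Ioo 0 1} ⊆ D.crossings := by
        rintro p ⟨e, f, hef, hp⟩
        exact ⟨e, e.2, f, f.2, fun h => hef (Subtype.ext h), hp⟩
      refine (ncard_le_ncard hsub hDfin).trans_lt ?_
      rw [← hDfin.cast_ncard_eq] at hD
      exact_mod_cast hD
    omega

end Graph

/-! ### Cutting and rejoining curves -/

namespace Pic
variable {ι κ : Type*} {P P' : Set Plane} {c : ι → ℝ → Plane} {c' : κ → ℝ → Plane}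

/-- A new family of curves, composed of parts of the curves of a family. The `k`-th new curve runs
along the curves in `S k`, apart from points of `P`, and different new curves use different parts. -/
theorem reroute [Finite ι] (h : Pic P c) (hP' : P'.Finite) (hpoly : ∀ k, IsPolygonal (c' k))
    (hinj : ∀ k, InjOn (c' k) (Ioo 0 1)) (h0 : ∀ k, c' k 0 ∈ P') (h1 : ∀ k, c' k 1 ∈ P')
    (havoid : ∀ k, ∀ p ∈ P', p ∉ c' k '' Ioo 0 1) (S : κ → Set ι)
    (hS : ∀ k, ∀ p ∈ c' k '' Ioo 0 1, p ∈ P ∨ ∃ i ∈ S k, p ∈ c i '' Ioo 0 1)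
    (hP : ∀ k l, k ≠ l → ∀ p ∈ c' k '' Ioo 0 1, p ∈ c' l '' Ioo 0 1 → p ∉ P)
    (hdisj : ∀ k l, k ≠ l → Disjoint (S k) (S l) ∨ Disjoint (c' k '' Ioo 0 1) (c' l '' Ioo 0 1)) :
    Pic P' c' where
  finite_pts := hP'
  polygonal := hpoly
  simple := hinj
  left_mem := h0
  right_mem := h1
  avoids := havoid
  finite k l hkl := by
    rcases hdisj k l hkl with hd | hd
    · refine (finite_iUnion fun i => finite_iUnion fun j => finite_iUnion fun hij : i ≠ j =>
        h.finite i j hij).subset ?_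
      rintro p ⟨hk, hl⟩
      have hpP := hP k l hkl p hk hl
      obtain ⟨i, hi, hpi⟩ := (hS k p hk).resolve_left hpP
      obtain ⟨j, hj, hpj⟩ := (hS l p hl).resolve_left hpP
      simp only [mem_iUnion]
      exact ⟨i, j, disjoint_left.1 hd |> fun hd he => hd hi (he ▸ hj), hpi, hpj⟩
    · rw [disjoint_iff_inter_eq_empty.1 hd]
      exact finite_empty
  no_triple k l m hkl hkm hlm p := by
    rintro ⟨hk, hl, hm⟩
    have hpP := hP k l hkl p hk hl
    obtain ⟨i, hi, hpi⟩ := (hS k p hk).resolve_left hpP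
    obtain ⟨j, hj, hpj⟩ := (hS l p hl).resolve_left hpP
    obtain ⟨n, hn, hpn⟩ := (hS m p hm).resolve_left hpP
    have key : ∀ {k l}, k ≠ l → p ∈ c' k '' Ioo 0 1 → p ∈ c' l '' Ioo 0 1 → ∀ {i j}, i ∈ S k →
        j ∈ S l → i ≠ j := by
      intro k l hkl hk hl i j hi hj hij
      rcases hdisj k l hkl with hd | hd
      · exact disjoint_left.1 hd hi (hij ▸ hj)
      · exact disjoint_left.1 hd hk hl
    exact h.no_triple i j n (key hkl hk hl hi hj) (key hkm hk hm hi hn) (key hlm hl hm hj hn) p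
      ⟨hpi, hpj, hpn⟩

end Pic

section crossCount
variable {ι κ : Type*} {P P' : Set Plane} {c : ι → ℝ → Plane} {c' : κ → ℝ → Plane}

theorem Pic.crossCount_le_sum [Finite ι] (h : Pic P c) {k l : κ} (S T : Finset ι)
    (hS : ∀ p ∈ c' k '' Ioo 0 1, p ∈ P ∨ ∃ i ∈ S, p ∈ c i '' Ioo 0 1)
    (hT : ∀ p ∈ c' l '' Ioo 0 1, p ∈ P ∨ ∃ i ∈ T, p ∈ c i '' Ioo 0 1)
    (hP : ∀ p ∈ c' k '' Ioo 0 1, p ∈ c' l '' Ioo 0 1 → p ∉ P)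
    (hST : Disjoint S T) :
    crossCount c' k l ≤ ∑ i ∈ S, ∑ j ∈ T, crossCount c i j := by
  classical
  unfold crossCount
  split_ifs with hkl
  · exact Nat.zero_le _
  have hne : ∀ i ∈ S, ∀ j ∈ T, i ≠ j := fun i hi j hj hij =>
    Finset.disjoint_left.1 hST hi (hij ▸ hj)
  have hfin : ∀ i ∈ S, ∀ j ∈ T, (c i '' Ioo 0 1 ∩ c j '' Ioo 0 1).Finite := fun i hi j hj =>
    h.finite i j (hne i hi j hj)
  have hsub : c' k '' Ioo 0 1 ∩ c' l '' Ioo 0 1 ⊆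
      ⋃ i ∈ S, ⋃ j ∈ T, (c i '' Ioo 0 1 ∩ c j '' Ioo 0 1) := by
    rintro p ⟨hk, hl⟩
    have hpP := hP p hk hl
    obtain ⟨i, hi, hpi⟩ := (hS p hk).resolve_left hpP
    obtain ⟨j, hj, hpj⟩ := (hT p hl).resolve_left hpP
    simp only [mem_iUnion]
    exact ⟨i, hi, j, hj, hpi, hpj⟩
  refine (ncard_le_ncard hsub (S.finite_toSet.biUnion fun i hi =>
    T.finite_toSet.biUnion fun j hj => hfin i hi j hj)).trans ?_
  refine (Finset.set_ncard_biUnion_le S _).trans (Finset.sum_le_sum fun i hi => ?_)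
  refine (Finset.set_ncard_biUnion_le T _).trans (Finset.sum_le_sum fun j hj => ?_)
  rw [if_neg (hne i hi j hj)]

theorem Pic.crossCount_mono (h : Pic P c) {k l : κ} {i j : ι} (hij : i ≠ j)
    (hk : c' k '' Ioo 0 1 ⊆ c i '' Ioo 0 1) (hl : c' l '' Ioo 0 1 ⊆ c j '' Ioo 0 1) :
    crossCount c' k l ≤ crossCount c i j := by
  by_cases hkl : k = l
  · rw [hkl, crossCount_self]
    exact Nat.zero_le _
  · rw [crossCount_of_ne hkl, crossCount_of_ne hij]
    exact ncard_le_ncard (inter_subset_inter hk hl) (h.finite i j hij)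

end crossCount

section cost
variable {ι κ : Type*} [Fintype ι] [Fintype κ] {c : ι → ℝ → Plane} {W : ι → ℕ}

/-- The cost of an additional curve `L` of weight `w`. -/
theorem cost_option (L : ℝ → Plane) (w : ℕ) :
    cost (fun o : Option ι => o.elim w W) (fun o : Option ι => o.elim L c) =
      cost W c + 2 * ∑ i, w * W i * (L '' Ioo 0 1 ∩ c i '' Ioo 0 1).ncard := by
  have h1 : ∀ i, crossCount (fun o : Option ι => o.elim L c) none (some i) =
      (L '' Ioo 0 1 ∩ c i '' Ioo 0 1).ncard := fun i => crossCount_of_ne (by simp)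
  have h2 : ∀ i j, crossCount (fun o : Option ι => o.elim L c) (some i) (some j) = crossCount c i j :=
    fun i j => (crossCount_comp (c := fun o : Option ι => o.elim L c)
      (Option.some_injective _) i j).symm
  unfold cost
  simp only [Fintype.sum_option, crossCount_self, h1, h2, Option.elim_none, Option.elim_some,
    mul_zero, zero_add, Finset.sum_add_distrib]
  simp only [crossCount_comm _ none, h1, mul_comm _ w]
  ring

/-- Increasing the weight of one curve by `k` costs `k` times its weighted number of crossings. -/
theorem cost_update [DecidableEq ι] (e : ι) (w k : ℕ) :
    cost (Function.update W e (w + k)) c =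
      cost (Function.update W e w) c + 2 * ∑ i, k * W i * crossCount c e i := by
  unfold cost
  rw [sum_sum_erase _ (fun i j => by rw [crossCount_comm]; ring) (fun i => by simp) e,
    sum_sum_erase (fun i j => Function.update W e w i * Function.update W e w j * crossCount c i j)
      (fun i j => by rw [crossCount_comm]; ring) (fun i => by simp) e,
    ← Finset.add_sum_erase _ (fun i => k * W i * crossCount c e i) (Finset.mem_univ e),
    crossCount_self, mul_zero, zero_add, add_assoc, ← mul_add, ← Finset.sum_add_distrib]
  refine congrArg₂ _ (Finset.sum_congr rfl fun i hi => Finset.sum_congr rfl fun j hj => ?_)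
    (congrArg _ (Finset.sum_congr rfl fun i hi => ?_))
  · rw [Function.update_of_ne (Finset.ne_of_mem_erase hi), Function.update_of_ne
      (Finset.ne_of_mem_erase hj), Function.update_of_ne (Finset.ne_of_mem_erase hi),
      Function.update_of_ne (Finset.ne_of_mem_erase hj)]
  · simp only [Function.update_self, Function.update_of_ne (Finset.ne_of_mem_erase hi)]
    ring

theorem cost_mono {W' : ι → ℕ} {d : ι → ℝ → Plane} (hW : ∀ i, W i ≤ W' i)
    (hc : ∀ i j, i ≠ j → crossCount c i j ≤ crossCount d i j) : cost W c ≤ cost W' d := by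
  refine Finset.sum_le_sum fun i _ => Finset.sum_le_sum fun j _ => ?_
  by_cases hij : i = j
  · rw [hij, crossCount_self, mul_zero]
    exact Nat.zero_le _
  · exact Nat.mul_le_mul (Nat.mul_le_mul (hW i) (hW j)) (hc i j hij)

end cost

namespace Pic
variable {ι : Type*} {P : Set Plane} {c : ι → ℝ → Plane}

/-- A curve of the family can be subdivided by a new point `p` so close to its first end that the
first part `u` is not crossed by any other curve. -/
theorem exists_subdivision [Finite ι] [DecidableEq ι] (h : Pic P c) {e : ι} {x y : Plane} (he : IsArc (c e) x y) :
    ∃ p u v, p ∉ P ∧ p ∈ c e '' Ioo 0 1 ∧ IsArc u x p ∧ IsArc v p y ∧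
      u '' Ioo 0 1 ⊆ c e '' Ioo 0 1 ∧ v '' Ioo 0 1 ⊆ c e '' Ioo 0 1 ∧
      Disjoint (u '' Ioo 0 1) (v '' Ioo 0 1) ∧
      (∀ i, i ≠ e → Disjoint (u '' Ioo 0 1) (c i '' Ioo 0 1)) ∧
      Pic (insert p P) (fun o : Option ι => o.elim u (Function.update c e v)) := by
  have hx : x ∈ P := he.left ▸ h.left_mem e
  have hy : y ∈ P := he.right ▸ h.right_mem e
  -- Finitely many parameters belong to crossings; a point before all of them is chosen.
  have hT : {t | t ∈ Ioo (0 : ℝ) 1 ∧ ∃ i, i ≠ e ∧ c e t ∈ c i '' Ioo 0 1}.Finite := by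
    refine Finite.of_finite_image ((finite_iUnion fun i => finite_iUnion fun hi : i ≠ e =>
      h.finite i e hi).subset ?_) (fun s hs t ht hst => h.simple e hs.1 ht.1 hst)
    rintro _ ⟨t, ⟨ht, i, hi, hti⟩, rfl⟩
    simp only [mem_iUnion]
    exact ⟨i, hi, hti, mem_image_of_mem _ ht⟩
  obtain ⟨t₀, ht₀, hmin⟩ : ∃ t₀ ∈ Ioc (0 : ℝ) 1, ∀ t ∈ Ioo 0 1, (∃ i, i ≠ e ∧ c e t ∈ c i '' Ioo 0 1) →
      t₀ ≤ t := by
    rcases (insert 1 hT.toFinset : Finset ℝ).exists_min_image id ⟨1, by simp⟩ with ⟨t₀, ht₀, hle⟩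
    refine ⟨t₀, ?_, fun t ht hti => hle t (Finset.mem_insert_of_mem (hT.mem_toFinset.2 ⟨ht, hti⟩))⟩
    rcases Finset.mem_insert.1 ht₀ with rfl | ht₀
    · exact ⟨one_pos, le_rfl⟩
    · exact ⟨(hT.mem_toFinset.1 ht₀).1.1, (hT.mem_toFinset.1 ht₀).1.2.le⟩
  set t := t₀ / 2 with htdef
  have ht0 : 0 < t := by linarith [ht₀.1]
  have ht1 : t < 1 := by linarith [ht₀.2]
  have htt : t < t₀ := by linarith [ht₀.1]
  have hfree : ∀ s ∈ Ioc (0 : ℝ) t, ∀ i, i ≠ e → c e s ∉ c i '' Ioo 0 1 := fun s hs i hi hsi => by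
    have := hmin s ⟨hs.1, hs.2.trans_lt ht1⟩ ⟨i, hi, hsi⟩
    linarith [hs.2]
  have hu := he.sub le_rfl ht0 ht1.le
  have hv := he.sub ht0.le ht1 le_rfl
  have huim := image_sub_Ioo (c e) ht0
  have hvim := image_sub_Ioo (c e) ht1
  have hpe : c e t ∈ c e '' Ioo 0 1 := mem_image_of_mem _ ⟨ht0, ht1⟩
  have hpP : c e t ∉ P := fun hp => h.avoids e _ hp hpe
  rw [he.left] at hu
  rw [he.right] at hv
  set u : ℝ → Plane := fun r => c e ((t - 0) * r + 0)
  set v : ℝ → Plane := fun r => c e ((1 - t) * r + t)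
  have hue : u '' Ioo 0 1 ⊆ c e '' Ioo 0 1 := by
    rw [huim]; exact image_mono (Ioo_subset_Ioo_right ht1.le)
  have hve : v '' Ioo 0 1 ⊆ c e '' Ioo 0 1 := by
    rw [hvim]; exact image_mono (Ioo_subset_Ioo_left ht0.le)
  have hpu : c e t ∉ u '' Ioo 0 1 := by
    have := hu.right_notMem
    exact this
  have hpv : c e t ∉ v '' Ioo 0 1 := hv.left_notMem
  have huv : Disjoint (u '' Ioo 0 1) (v '' Ioo 0 1) := by
    rw [huim, hvim, disjoint_left]
    rintro _ ⟨r, hr, rfl⟩ ⟨s, hs, hrs⟩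
    have := h.simple e ⟨ht0.trans hs.1, hs.2⟩ ⟨hr.1, hr.2.trans ht1⟩ hrs
    linarith [hr.2, hs.1]
  have hui : ∀ i, i ≠ e → Disjoint (u '' Ioo 0 1) (c i '' Ioo 0 1) := by
    intro i hi
    rw [huim, disjoint_left]
    rintro _ ⟨r, hr, rfl⟩ hri
    exact hfree r ⟨hr.1, hr.2.le⟩ i hi hri
  refine ⟨c e t, u, v, hpP, hpe, hu, hv, hue, hve, huv, hui, ?_⟩
  have hupd : ∀ i, i ≠ e → Function.update c e v i = c i := fun i hi => Function.update_of_ne hi _ _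
  have hupe : Function.update c e v e = v := Function.update_self _ _ _
  have hsub : ∀ i, Function.update c e v i '' Ioo 0 1 ⊆ c i '' Ioo 0 1 := fun i => by
    by_cases hi : i = e
    · rw [hi, hupe]; exact hve
    · rw [hupd i hi]
  refine h.reroute (S := fun o => o.elim {e} fun i => {i}) (h.finite_pts.insert _) ?_ ?_ ?_ ?_ ?_ ?_ ?_ ?_
  · rintro (_ | i)
    · exact hu.polygonal
    · by_cases hi : i = e
      · simpa [hi] using hv.polygonal
      · simpa [hupd i hi] using h.polygonal i
  · rintro (_ | i)
    · exact hu.injOn_Ioo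
    · by_cases hi : i = e
      · simpa [hi] using hv.injOn_Ioo
      · simpa [hupd i hi] using h.simple i
  · rintro (_ | i)
    · change u 0 ∈ _
      rw [hu.left]; exact mem_insert_of_mem _ hx
    · by_cases hi : i = e
      · simp [hi, hv.left]
      · simpa [hupd i hi] using Or.inr (h.left_mem i)
  · rintro (_ | i)
    · change u 1 ∈ _
      rw [hu.right]; exact mem_insert _ _
    · by_cases hi : i = e
      · simpa [hi, hv.right] using Or.inr hy
      · simpa [hupd i hi] using Or.inr (h.right_mem i)
  · rintro (_ | i) p hp hpi
    · rcases hp with rfl | hp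
      · exact hpu hpi
      · exact h.avoids e p hp (hue hpi)
    · change p ∈ Function.update c e v i '' _ at hpi
      rcases hp with rfl | hp
      · by_cases hi : i = e
        · rw [hi, hupe] at hpi
          exact hpv hpi
        · rw [hupd i hi] at hpi
          exact hfree t ⟨ht0, le_rfl⟩ i hi hpi
      · exact h.avoids i p hp (hsub i hpi)
  · rintro (_ | i) p hp
    · exact Or.inr ⟨e, rfl, hue hp⟩
    · exact Or.inr ⟨i, rfl, hsub i hp⟩
  · rintro (_ | i) l - p hp - hpP
    · exact h.avoids e p hpP (hue hp)
    · exact h.avoids i p hpP (hsub i hp)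
  · rintro (_ | i) (_ | j) hij
    · exact absurd rfl hij
    · right
      change Disjoint _ (Function.update c e v j '' _)
      by_cases hj : j = e
      · rw [hj, hupe]; exact huv
      · rw [hupd j hj]; exact hui j hj
    · right
      change Disjoint (Function.update c e v i '' _) _
      by_cases hi : i = e
      · rw [hi, hupe]; exact huv.symm
      · rw [hupd i hi]; exact (hui i hi).symm
    · left
      simpa using fun h => hij (by rw [h])

end Pic

/-! ### Disjoint arcs from a vertex, and stars -/

namespace Pic
variable {ι : Type*} {P : Set Plane} {c : ι → ℝ → Plane}

/-- Two arcs starting at a common point `z` and crossing each other are cut at the crossing `p` that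
comes last on the first one. Behind `p` they are disjoint. The first part of the second arc is
deleted. -/
theorem exists_last_crossing [Finite ι] [DecidableEq ι] (h : Pic P c) {a b : ι} (hab : a ≠ b) {x y z : Plane}
    (ha : IsArc (c a) z x) (hb : IsArc (c b) z y)
    (hne : ¬ Disjoint (c a '' Ioo 0 1) (c b '' Ioo 0 1)) :
    ∃ p u v w, p ∉ P ∧ p ∈ c a '' Ioo 0 1 ∧ p ∈ c b '' Ioo 0 1 ∧ IsArc u z p ∧ IsArc v p x ∧
      IsArc w p y ∧ u '' Ioo 0 1 ⊆ c a '' Ioo 0 1 ∧ v '' Ioo 0 1 ⊆ c a '' Ioo 0 1 ∧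
      w '' Ioo 0 1 ⊆ c b '' Ioo 0 1 ∧ Disjoint (u '' Ioo 0 1) (v '' Ioo 0 1) ∧
      Disjoint (v '' Ioo 0 1) (w '' Ioo 0 1) ∧
      Pic (insert p P) (fun o : Option ι =>
        o.elim u (Function.update (Function.update c a v) b w)) := by
  have hx : x ∈ P := ha.right ▸ h.right_mem a
  have hy : y ∈ P := hb.right ▸ h.right_mem b
  have hz : z ∈ P := ha.left ▸ h.left_mem a
  have hT : {t | t ∈ Ioo (0 : ℝ) 1 ∧ c a t ∈ c b '' Ioo 0 1}.Finite := by
    refine Finite.of_finite_image ((h.finite a b hab).subset ?_)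
      (fun s hs t ht hst => h.simple a hs.1 ht.1 hst)
    rintro _ ⟨t, ⟨ht, hti⟩, rfl⟩
    exact ⟨mem_image_of_mem _ ht, hti⟩
  obtain ⟨q, ⟨t', ht', rfl⟩, hqb⟩ := not_disjoint_iff.1 hne
  obtain ⟨t, ht, hmax⟩ := hT.exists_maximalFor id _ ⟨t', ht', hqb⟩
  have hlast : ∀ s ∈ Ioo 0 1, c a s ∈ c b '' Ioo 0 1 → s ≤ t := fun s hs hsb => by
    by_contra! hlt
    exact hlt.not_ge (hmax ⟨hs, hsb⟩ hlt.le)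
  obtain ⟨⟨ht0, ht1⟩, r, ⟨hr0, hr1⟩, hrt⟩ := ht
  have hpa : c a t ∈ c a '' Ioo 0 1 := mem_image_of_mem _ ⟨ht0, ht1⟩
  have hpb : c a t ∈ c b '' Ioo 0 1 := ⟨r, ⟨hr0, hr1⟩, hrt⟩
  have hpP : c a t ∉ P := fun hp => h.avoids a _ hp hpa
  have hpi : ∀ i, i ≠ a → i ≠ b → c a t ∉ c i '' Ioo 0 1 := fun i hia hib hpi =>
    h.no_triple a b i hab hia.symm hib.symm _ ⟨hpa, hpb, hpi⟩
  have hu := ha.sub le_rfl ht0 ht1.le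
  have hv := ha.sub ht0.le ht1 le_rfl
  have hw := hb.sub hr0.le hr1 le_rfl
  have huim := image_sub_Ioo (c a) ht0
  have hvim := image_sub_Ioo (c a) ht1
  have hwim := image_sub_Ioo (c b) hr1
  rw [ha.left] at hu
  rw [ha.right] at hv
  rw [hb.right, hrt] at hw
  set u : ℝ → Plane := fun r => c a ((t - 0) * r + 0)
  set v : ℝ → Plane := fun r => c a ((1 - t) * r + t)
  set w : ℝ → Plane := fun s => c b ((1 - r) * s + r)
  have hua : u '' Ioo 0 1 ⊆ c a '' Ioo 0 1 := by
    rw [huim]; exact image_mono (Ioo_subset_Ioo_right ht1.le)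
  have hva : v '' Ioo 0 1 ⊆ c a '' Ioo 0 1 := by
    rw [hvim]; exact image_mono (Ioo_subset_Ioo_left ht0.le)
  have hwb : w '' Ioo 0 1 ⊆ c b '' Ioo 0 1 := by
    rw [hwim]; exact image_mono (Ioo_subset_Ioo_left hr0.le)
  have huv : Disjoint (u '' Ioo 0 1) (v '' Ioo 0 1) := by
    rw [huim, hvim, disjoint_left]
    rintro _ ⟨r, hr, rfl⟩ ⟨s, hs, hrs⟩
    have := h.simple a ⟨ht0.trans hs.1, hs.2⟩ ⟨hr.1, hr.2.trans ht1⟩ hrs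
    linarith [hr.2, hs.1]
  have hvw : Disjoint (v '' Ioo 0 1) (w '' Ioo 0 1) := by
    rw [hvim, disjoint_left]
    rintro _ ⟨s, hs, rfl⟩ hsw
    exact absurd (hlast s ⟨ht0.trans hs.1, hs.2⟩ (hwb hsw)) (not_le.2 hs.1)
  refine ⟨c a t, u, v, w, hpP, hpa, hpb, hu, hv, hw, hua, hva, hwb, huv, hvw, ?_⟩
  set d := Function.update (Function.update c a v) b w with hddef
  have hdb : d b = w := Function.update_self _ _ _
  have hda : d a = v := by rw [hddef, Function.update_of_ne hab, Function.update_self]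
  have hd : ∀ i, i ≠ a → i ≠ b → d i = c i := fun i hia hib => by
    rw [hddef, Function.update_of_ne hib, Function.update_of_ne hia]
  have hcases : ∀ i, i = a ∨ i = b ∨ i ≠ a ∧ i ≠ b := fun i => by tauto
  have hsub : ∀ i, d i '' Ioo 0 1 ⊆ c i '' Ioo 0 1 := fun i => by
    rcases hcases i with rfl | rfl | ⟨hia, hib⟩
    · rw [hda]; exact hva
    · rw [hdb]; exact hwb
    · rw [hd i hia hib]
  refine h.reroute (S := fun o => o.elim {a} fun i => {i}) (h.finite_pts.insert _) ?_ ?_ ?_ ?_ ?_ ?_ ?_ ?_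
  · rintro (_ | i)
    · exact hu.polygonal
    · change IsPolygonal (d i)
      rcases hcases i with rfl | rfl | ⟨hia, hib⟩
      · rw [hda]; exact hv.polygonal
      · rw [hdb]; exact hw.polygonal
      · rw [hd i hia hib]; exact h.polygonal i
  · rintro (_ | i)
    · exact hu.injOn_Ioo
    · change InjOn (d i) _
      rcases hcases i with rfl | rfl | ⟨hia, hib⟩
      · rw [hda]; exact hv.injOn_Ioo
      · rw [hdb]; exact hw.injOn_Ioo
      · rw [hd i hia hib]; exact h.simple i
  · rintro (_ | i)
    · change u 0 ∈ _
      rw [hu.left]; exact mem_insert_of_mem _ hz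
    · change d i 0 ∈ _
      rcases hcases i with rfl | rfl | ⟨hia, hib⟩
      · rw [hda, hv.left]; exact mem_insert _ _
      · rw [hdb, hw.left]; exact mem_insert _ _
      · rw [hd i hia hib]; exact mem_insert_of_mem _ (h.left_mem i)
  · rintro (_ | i)
    · change u 1 ∈ _
      rw [hu.right]; exact mem_insert _ _
    · change d i 1 ∈ _
      rcases hcases i with rfl | rfl | ⟨hia, hib⟩
      · rw [hda, hv.right]; exact mem_insert_of_mem _ hx
      · rw [hdb, hw.right]; exact mem_insert_of_mem _ hy
      · rw [hd i hia hib]; exact mem_insert_of_mem _ (h.right_mem i)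
  · rintro (_ | i) p hp hpi'
    · rcases hp with rfl | hp
      · exact hu.right_notMem hpi'
      · exact h.avoids a p hp (hua hpi')
    · change p ∈ d i '' _ at hpi'
      rcases hp with rfl | hp
      · rcases hcases i with rfl | rfl | ⟨hia, hib⟩
        · rw [hda] at hpi'; exact hv.left_notMem hpi'
        · rw [hdb] at hpi'; exact hw.left_notMem hpi'
        · rw [hd i hia hib] at hpi'; exact hpi i hia hib hpi'
      · exact h.avoids i p hp (hsub i hpi')
  · rintro (_ | i) p hp
    · exact Or.inr ⟨a, rfl, hua hp⟩
    · exact Or.inr ⟨i, rfl, hsub i hp⟩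
  · rintro (_ | i) l - p hp - hpP
    · exact h.avoids a p hpP (hua hp)
    · exact h.avoids i p hpP (hsub i hp)
  · have hnone : ∀ i, Disjoint ({a} : Set ι) {i} ∨ Disjoint (u '' Ioo 0 1) (d i '' Ioo 0 1) := by
      intro i
      by_cases hi : i = a
      · right; rw [hi, hda]; exact huv
      · left; simpa using Ne.symm hi
    rintro (_ | i) (_ | j) hij
    · exact absurd rfl hij
    · exact hnone j
    · exact (hnone i).imp (fun h => h.symm) fun h => h.symm
    · left
      simpa using fun h => hij (by rw [h])

end Pic

section Fin
variable {O : Type*} [Fintype O]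

/-- Twice the number of crossings among the curves indexed by `O`. -/
noncomputable def oldCost {n : ℕ} (c : O ⊕ Fin n → ℝ → Plane) : ℕ :=
  ∑ o, ∑ o', crossCount c (.inl o) (.inl o')

/-- The number of crossings of the `p`-th special curve with the curves indexed by `O`. -/
noncomputable def crossOld {n : ℕ} (c : O ⊕ Fin n → ℝ → Plane) (p : Fin n) : ℕ :=
  ∑ o, crossCount c (.inr p) (.inl o)

theorem oldCost_congr {n m : ℕ} {c : O ⊕ Fin n → ℝ → Plane} {c' : O ⊕ Fin m → ℝ → Plane}
    (h : ∀ o, c' (.inl o) = c (.inl o)) : oldCost c' = oldCost c := by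
  refine Finset.sum_congr rfl fun o _ => Finset.sum_congr rfl fun o' _ => ?_
  rcases eq_or_ne o o' with rfl | hne
  · rw [crossCount_self, crossCount_self]
  · rw [crossCount_of_ne (Sum.inl_injective.ne hne), crossCount_of_ne (Sum.inl_injective.ne hne), h, h]

/-- The cost of a family in which the old curves have weight 1, split by the kinds of crossings. -/
theorem cost_sum {n : ℕ} (w : Fin n → ℕ) (c : O ⊕ Fin n → ℝ → Plane) :
    cost (Sum.elim (fun _ => 1) w) c = oldCost c + 2 * ∑ p, w p * crossOld c p +
      ∑ p, ∑ q, w p * w q * crossCount c (.inr p) (.inr q) := by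
  unfold cost oldCost crossOld
  simp only [Fintype.sum_sum_type, Sum.elim_inl, Sum.elim_inr, one_mul, mul_one,
    Finset.sum_add_distrib, Finset.mul_sum]
  rw [Finset.sum_comm (f := fun o p => w p * crossCount c (Sum.inl o) (Sum.inr p))]
  simp only [crossCount_comm (Sum.inl _) (Sum.inr _), two_mul, Finset.sum_add_distrib]
  ring

/-- Three curves from `s`, two of which are composed of two curves of the given family, joined at
the points `y` and `z`. -/
theorem Pic.exists_star {P : Set Plane} {c : O ⊕ Fin 6 → ℝ → Plane} (h : Pic P c)
    {r : Fin 5 → Fin 6} (hr : Function.Injective r) {s y z t₀ t₁ t₂ : Plane}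
    (h0 : ∃ γ, IsArc γ s t₀ ∧ γ '' Ioo 0 1 = c (.inr (r 0)) '' Ioo 0 1)
    (h1 : ∃ γ, IsArc γ s y ∧ γ '' Ioo 0 1 = c (.inr (r 1)) '' Ioo 0 1)
    (h2 : ∃ γ, IsArc γ y t₁ ∧ γ '' Ioo 0 1 = c (.inr (r 2)) '' Ioo 0 1)
    (h3 : ∃ γ, IsArc γ s z ∧ γ '' Ioo 0 1 = c (.inr (r 3)) '' Ioo 0 1)
    (h4 : ∃ γ, IsArc γ z t₂ ∧ γ '' Ioo 0 1 = c (.inr (r 4)) '' Ioo 0 1)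
    (hs : s ∈ P) (hy : y ∈ P) (hz : z ∈ P) (ht₀ : t₀ ∈ P \ {y, z}) (ht₁ : t₁ ∈ P \ {y, z}) (ht₂ : t₂ ∈ P \ {y, z})
    (hst₁ : s ≠ t₁) (hst₂ : s ≠ t₂) (hyz : y ≠ z)
    (hold0 : ∀ o, c (.inl o) 0 ∉ ({y, z} : Set Plane))
    (hold1 : ∀ o, c (.inl o) 1 ∉ ({y, z} : Set Plane)) :
    ∃ c' : O ⊕ Fin 3 → ℝ → Plane, Pic (P \ {y, z}) c' ∧ (∀ o, c' (.inl o) = c (.inl o)) ∧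
      (∀ p, c' (.inr p) 0 = s) ∧ (∀ p, c' (.inr p) 1 = ![t₀, t₁, t₂] p) ∧
      ∀ w₀ w₁ w₂, cost (Sum.elim (fun _ => 1) ![w₀, w₁, w₂]) c' ≤ oldCost c +
        2 * (w₀ * crossOld c (r 0) + w₁ * (crossOld c (r 1) + crossOld c (r 2)) +
          w₂ * (crossOld c (r 3) + crossOld c (r 4))) +
        2 * (w₀ * w₁ * (crossCount c (.inr (r 0)) (.inr (r 1)) +
            crossCount c (.inr (r 0)) (.inr (r 2))) +
          w₀ * w₂ * (crossCount c (.inr (r 0)) (.inr (r 3)) +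
            crossCount c (.inr (r 0)) (.inr (r 4))) +
          w₁ * w₂ * (crossCount c (.inr (r 1)) (.inr (r 3)) +
            crossCount c (.inr (r 1)) (.inr (r 4)) + crossCount c (.inr (r 2)) (.inr (r 3)) +
            crossCount c (.inr (r 2)) (.inr (r 4)))) := by
  obtain ⟨γ₀, h0, e0⟩ := h0
  obtain ⟨γ₁, h1, e1⟩ := h1
  obtain ⟨γ₂, h2, e2⟩ := h2
  obtain ⟨γ₃, h3, e3⟩ := h3
  obtain ⟨γ₄, h4, e4⟩ := h4
  have hIcc : ∀ {γ : ℝ → Plane} {x x' p i}, IsArc γ x x' → γ '' Ioo 0 1 = c i '' Ioo 0 1 → p ∈ P →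
      p ≠ x → p ≠ x' → p ∉ γ '' Icc 0 1 := by
    intro γ x x' p i hγ he hp hx hx'
    rw [hγ.image_Icc, he]
    have := h.avoids i p hp
    simp [hx, hx', this]
  obtain ⟨δ₁, hδ₁, hδ₁s⟩ := h1.merge h2 (hIcc h2 e2 hs h1.ne hst₁)
    (hIcc h1 e1 ht₁.1 hst₁.symm h2.ne.symm)
  obtain ⟨δ₂, hδ₂, hδ₂s⟩ := h3.merge h4 (hIcc h4 e4 hs h3.ne hst₂)
    (hIcc h3 e3 ht₂.1 hst₂.symm h4.ne.symm)
  rw [e1, e2] at hδ₁s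
  rw [e3, e4] at hδ₂s
  have hsP : s ∈ P \ {y, z} := ⟨hs, by simp [h1.ne, h3.ne]⟩
  let c' : O ⊕ Fin 3 → ℝ → Plane := Sum.elim (fun o => c (.inl o)) ![γ₀, δ₁, δ₂]
  let S : O ⊕ Fin 3 → Finset (O ⊕ Fin 6) := by
    classical
    exact Sum.elim (fun o => {.inl o})
      ![{.inr (r 0)}, {.inr (r 1), .inr (r 2)}, {.inr (r 3), .inr (r 4)}]
  -- The only points of `P` inside a new curve are the joints.
  let J : O ⊕ Fin 3 → Set Plane := Sum.elim (fun _ => ∅) ![∅, {y}, {z}]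
  have hJP : ∀ k, J k ⊆ {y, z} := by
    rintro (o | p)
    · exact empty_subset _
    · fin_cases p <;> simp [J]
  have hSJ : ∀ k, ∀ p ∈ c' k '' Ioo 0 1, p ∈ J k ∨ ∃ i ∈ S k, p ∈ c i '' Ioo 0 1 := by
    rintro (o | p) q hq
    · exact Or.inr ⟨.inl o, by simp [S], hq⟩
    · fin_cases p
      · exact Or.inr ⟨.inr (r 0), by simp [S], e0 ▸ hq⟩
      · rcases hδ₁s hq with (hq | hq) | hq
        · exact Or.inr ⟨.inr (r 1), by simp [S], hq⟩
        · exact Or.inl hq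
        · exact Or.inr ⟨.inr (r 2), by simp [S], hq⟩
      · rcases hδ₂s hq with (hq | hq) | hq
        · exact Or.inr ⟨.inr (r 3), by simp [S], hq⟩
        · exact Or.inl hq
        · exact Or.inr ⟨.inr (r 4), by simp [S], hq⟩
  have hyzP : ({y, z} : Set Plane) ⊆ P := by
    rintro _ (rfl | rfl)
    exacts [hy, hz]
  have hSP : ∀ k, ∀ p ∈ c' k '' Ioo 0 1, p ∈ P ∨ ∃ i ∈ S k, p ∈ c i '' Ioo 0 1 := fun k p hp =>
    (hSJ k p hp).imp_left fun hp => hyzP (hJP k hp)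
  have hSJP : ∀ k, ∀ p ∈ c' k '' Ioo 0 1, p ∈ P → p ∈ J k := fun k p hp hpP =>
    (hSJ k p hp).resolve_right fun ⟨i, _, hi⟩ => h.avoids i p hpP hi
  have hJ : ∀ k l, k ≠ l → Disjoint (J k) (J l) := by
    rintro (o | p) (o' | q) hkl
    · exact disjoint_bot_left
    · exact disjoint_bot_left
    · exact disjoint_bot_right
    · fin_cases p <;> fin_cases q <;> first | exact absurd rfl hkl | simp [J, hyz, hyz.symm]
  have hP : ∀ k l, k ≠ l → ∀ p ∈ c' k '' Ioo 0 1, p ∈ c' l '' Ioo 0 1 → p ∉ P :=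
    fun k l hkl p hk hl hpP =>
      disjoint_left.1 (hJ k l hkl) (hSJP k p hk hpP) (hSJP l p hl hpP)
  have hSdisj : ∀ k l, k ≠ l → Disjoint (S k) (S l) := by
    rintro (o | p) (o' | q) hkl
    · simpa [S] using hkl
    · fin_cases q <;> simp [S]
    · fin_cases p <;> simp [S]
    · fin_cases p <;> fin_cases q <;> first | exact absurd rfl hkl | simp [S, hr.eq_iff]
  have hcc : ∀ k l, k ≠ l → crossCount c' k l ≤ ∑ i ∈ S k, ∑ j ∈ S l, crossCount c i j :=
    fun k l hkl => h.crossCount_le_sum _ _ (hSP k) (hSP l) (hP k l hkl) (hSdisj k l hkl)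
  have hleft : ∀ p, c' (.inr p) 0 = s := by
    intro p
    fin_cases p
    exacts [h0.left, hδ₁.left, hδ₂.left]
  have hright : ∀ p, c' (.inr p) 1 = ![t₀, t₁, t₂] p := by
    intro p
    fin_cases p
    exacts [h0.right, hδ₁.right, hδ₂.right]
  refine ⟨c', ?_, fun o => rfl, hleft, hright, fun w₀ w₁ w₂ => ?_⟩
  · refine h.reroute (S := fun k => S k) (h.finite_pts.subset sdiff_subset) ?_ ?_ ?_ ?_ ?_ hSP hP ?_
    · rintro (o | p)
      · exact h.polygonal _
      · fin_cases p
        exacts [h0.polygonal, hδ₁.polygonal, hδ₂.polygonal]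
    · rintro (o | p)
      · exact h.simple _
      · fin_cases p
        exacts [h0.injOn_Ioo, hδ₁.injOn_Ioo, hδ₂.injOn_Ioo]
    · rintro (o | p)
      · exact ⟨h.left_mem _, hold0 o⟩
      · rw [hleft]; exact hsP
    · rintro (o | p)
      · exact ⟨h.right_mem _, hold1 o⟩
      · rw [hright]
        fin_cases p
        exacts [ht₀, ht₁, ht₂]
    · exact fun k p hp hpk => hp.2 (hJP k (hSJP k p hpk hp.1))
    · exact fun k l hkl => Or.inl (Finset.disjoint_coe.2 (hSdisj k l hkl))
  · have hold : oldCost c' = oldCost c := oldCost_congr fun o => rfl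
    have c0 : crossOld c' 0 ≤ crossOld c (r 0) :=
      Finset.sum_le_sum fun o _ => (hcc (.inr 0) (.inl o) (by simp)).trans (by simp [S])
    have c1 : crossOld c' 1 ≤ crossOld c (r 1) + crossOld c (r 2) := by
      unfold crossOld
      rw [← Finset.sum_add_distrib]
      exact Finset.sum_le_sum fun o _ => (hcc (.inr 1) (.inl o) (by simp)).trans
        (by simp [S, hr.eq_iff])
    have c2 : crossOld c' 2 ≤ crossOld c (r 3) + crossOld c (r 4) := by
      unfold crossOld
      rw [← Finset.sum_add_distrib]
      exact Finset.sum_le_sum fun o _ => (hcc (.inr 2) (.inl o) (by simp)).trans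
        (by simp [S, hr.eq_iff])
    have c01 := hcc (.inr 0) (.inr 1) (by simp)
    have c02 := hcc (.inr 0) (.inr 2) (by simp)
    have c12 := hcc (.inr 1) (.inr 2) (by simp)
    simp only [S, Sum.elim_inr, Matrix.cons_val, hr.eq_iff, Finset.sum_singleton, Finset.sum_pair,
      ne_eq, Sum.inr.injEq, Fin.reduceEq, not_false_eq_true] at c01 c02 c12
    rw [cost_sum]
    simp only [Fin.sum_univ_three, crossCount_self, hold, Matrix.cons_val]
    rw [crossCount_comm (c := c') (.inr 1) (.inr 0), crossCount_comm (c := c') (.inr 2) (.inr 0),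
      crossCount_comm (c := c') (.inr 2) (.inr 1)]
    have m0 := Nat.mul_le_mul_left w₀ c0
    have m1 := Nat.mul_le_mul_left w₁ c1
    have m2 := Nat.mul_le_mul_left w₂ c2
    have m01 := Nat.mul_le_mul_left (w₀ * w₁) c01
    have m02 := Nat.mul_le_mul_left (w₀ * w₂) c02
    have m12 := Nat.mul_le_mul_left (w₁ * w₂) c12
    linarith

theorem sum_sum_six (x : Fin 6 → Fin 6 → ℕ) (hx : ∀ p q, x p q = x q p) (h0 : ∀ p, x p p = 0) :
    ∑ p, ∑ q, x p q = 2 * (x 0 1 + x 0 2 + x 0 3 + x 0 4 + x 0 5 + x 1 2 + x 1 3 + x 1 4 + x 1 5 +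
      x 2 3 + x 2 4 + x 2 5 + x 3 4 + x 3 5 + x 4 5) := by
  simp only [Fin.sum_univ_six, h0]
  rw [hx 1 0, hx 2 0, hx 3 0, hx 4 0, hx 5 0, hx 2 1, hx 3 1, hx 4 1, hx 5 1, hx 3 2, hx 4 2, hx 5 2,
    hx 4 3, hx 5 3, hx 5 4]
  ring

theorem cost_six (c : O ⊕ Fin 6 → ℝ → Plane) :
    cost (Sum.elim (fun _ => 1) ![4, 4, 3, 1, 1, 1]) c = oldCost c +
      2 * (4 * crossOld c 0 + 4 * crossOld c 1 + 3 * crossOld c 2 + crossOld c 3 + crossOld c 4 +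
        crossOld c 5) +
      2 * (16 * crossCount c (.inr 0) (.inr 1) + 12 * crossCount c (.inr 0) (.inr 2) +
        4 * crossCount c (.inr 0) (.inr 3) + 4 * crossCount c (.inr 0) (.inr 4) +
        4 * crossCount c (.inr 0) (.inr 5) + 12 * crossCount c (.inr 1) (.inr 2) +
        4 * crossCount c (.inr 1) (.inr 3) + 4 * crossCount c (.inr 1) (.inr 4) +
        4 * crossCount c (.inr 1) (.inr 5) + 3 * crossCount c (.inr 2) (.inr 3) +
        3 * crossCount c (.inr 2) (.inr 4) + 3 * crossCount c (.inr 2) (.inr 5) +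
        crossCount c (.inr 3) (.inr 4) + crossCount c (.inr 3) (.inr 5) +
        crossCount c (.inr 4) (.inr 5)) := by
  rw [cost_sum, sum_sum_six]
  · simp only [Fin.sum_univ_six, Matrix.cons_val]
    ring
  · intro p q
    rw [crossCount_comm, mul_comm (_ : ℕ) (![4, 4, 3, 1, 1, 1] q)]
  · simp

/-- Two curves from `z` to `x` and `y` that cross each other can be made disjoint without an
increase of the number of crossings: the third curve `d` from `z` takes over the part of the first
curve up to its last crossing `p` with the second one, and `p` replaces `z`. -/
theorem Pic.exists_disjoint {P : Set Plane} {c : O ⊕ Fin 6 → ℝ → Plane} (h : Pic P c)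
    {x y z t : Plane} (ha : IsArc (c (.inr 3)) z x) (hb : IsArc (c (.inr 4)) z y)
    (hd : IsArc (c (.inr 5)) z t)
    (hz : ∀ i, i ≠ .inr 3 → i ≠ .inr 4 → i ≠ .inr 5 → c i 0 ≠ z ∧ c i 1 ≠ z)
    (hxz : x ≠ z) (hyz : y ≠ z) (htz : t ≠ z) :
    ∃ p c', p ∉ P \ {z} ∧ Pic (insert p (P \ {z})) c' ∧
      (∀ i, i ≠ .inr 3 → i ≠ .inr 4 → i ≠ .inr 5 → c' i = c i) ∧ IsArc (c' (.inr 3)) p x ∧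
      IsArc (c' (.inr 4)) p y ∧ IsArc (c' (.inr 5)) p t ∧ crossCount c' (.inr 3) (.inr 4) = 0 ∧
      cost (Sum.elim (fun _ => 1) ![4, 4, 3, 1, 1, 1]) c' ≤
        cost (Sum.elim (fun _ => 1) ![4, 4, 3, 1, 1, 1]) c := by
  classical
  by_cases hab : Disjoint (c (.inr 3) '' Ioo 0 1) (c (.inr 4) '' Ioo 0 1)
  · have hzP : z ∈ P := ha.left ▸ h.left_mem (.inr 3)
    refine ⟨z, c, fun hz => hz.2 rfl, ?_, fun _ _ _ _ => rfl, ha, hb, hd,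
      crossCount_eq_zero_of_disjoint hab, le_rfl⟩
    rwa [insert_sdiff_singleton, insert_eq_of_mem hzP]
  obtain ⟨p, u, v, w, hpP, hpa, hpb, hu, hv, hw, hua, hva, hwb, huv, hvw, h₁⟩ :=
    h.exists_last_crossing (by simp) ha hb hab
  have hzP : z ∈ P := ha.left ▸ h.left_mem (.inr 3)
  have htP : t ∈ P := hd.right ▸ h.right_mem (.inr 5)
  have hxP : x ∈ P := ha.right ▸ h.right_mem (.inr 3)
  have hyP : y ∈ P := hb.right ▸ h.right_mem (.inr 4)
  have hpne : ∀ {q}, q ∈ P → q ≠ p := fun hq he => hpP (he ▸ hq)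
  have hpd : p ∉ c (.inr 5) '' Ioo 0 1 := fun hpd =>
    h.no_triple (.inr 3) (.inr 4) (.inr 5) (by simp) (by simp) (by simp) p ⟨hpa, hpb, hpd⟩
  obtain ⟨ε, hε, hεu⟩ := hu.reverse
  obtain ⟨δ, hδ, hδs⟩ := hε.merge hd
    (by rw [hd.image_Icc]; simp [hpd, (hpne hzP).symm, (hpne htP).symm])
    (by rw [hε.image_Icc, hεu]
        have : t ∉ u '' Ioo 0 1 := fun htu => h.avoids _ t htP (hua htu)
        simp [this, htz, hpne htP])
  rw [hεu] at hδs
  set d₁ := Function.update (Function.update c (.inr 3) v) (.inr 4) w with hd₁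
  have e3 : d₁ (.inr 3) = v := by
    rw [hd₁, Function.update_of_ne (by simp), Function.update_self]
  have e4 : d₁ (.inr 4) = w := Function.update_self _ _ _
  have ei : ∀ i, i ≠ .inr 3 → i ≠ .inr 4 → d₁ i = c i := fun i h3 h4 => by
    rw [hd₁, Function.update_of_ne h4, Function.update_of_ne h3]
  have hsub₁ : ∀ i, d₁ i '' Ioo 0 1 ⊆ c i '' Ioo 0 1 := fun i => by
    by_cases h3 : i = .inr 3
    · rw [h3, e3]; exact hva
    by_cases h4 : i = .inr 4
    · rw [h4, e4]; exact hwb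
    rw [ei i h3 h4]
  set c' := Function.update d₁ (.inr 5) δ with hc'
  have f5 : c' (.inr 5) = δ := Function.update_self _ _ _
  have fi : ∀ i, i ≠ .inr 5 → c' i = d₁ i := fun i hi => Function.update_of_ne hi _ _
  have f3 : c' (.inr 3) = v := by rw [fi _ (by simp), e3]
  have f4 : c' (.inr 4) = w := by rw [fi _ (by simp), e4]
  set c₁ : Option (O ⊕ Fin 6) → ℝ → Plane := fun o => o.elim u d₁ with hc₁
  let S : O ⊕ Fin 6 → Finset (Option (O ⊕ Fin 6)) := fun i =>
    if i = .inr 5 then {none, some (.inr 5)} else {some i}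
  have hS5 : S (.inr 5) = {none, some (.inr 5)} := if_pos rfl
  have hSi : ∀ i, i ≠ .inr 5 → S i = {some i} := fun i hi => if_neg hi
  have hP₁ : insert p (P \ {z}) ⊆ insert p P := insert_subset_insert sdiff_subset
  have hδc : ∀ q ∈ δ '' Ioo 0 1, q = z ∨ q ∈ c₁ none '' Ioo 0 1 ∨ q ∈ c₁ (some (.inr 5)) '' Ioo 0 1 := by
    intro q hq
    rcases hδs hq with (hq | hq) | hq
    · exact Or.inr (Or.inl hq)
    · exact Or.inl hq
    · exact Or.inr (Or.inr (by simpa [hc₁, ei] using hq))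
  have hSP : ∀ k, ∀ q ∈ c' k '' Ioo 0 1, q ∈ insert p P ∨ ∃ i ∈ S k, q ∈ c₁ i '' Ioo 0 1 := by
    intro k q hq
    by_cases hk : k = .inr 5
    · rw [hk, f5] at hq
      rw [hk, hS5]
      rcases hδc q hq with rfl | hq | hq
      · exact Or.inl (mem_insert_of_mem _ hzP)
      · exact Or.inr ⟨_, by simp, hq⟩
      · exact Or.inr ⟨_, by simp, hq⟩
    · rw [fi k hk] at hq
      rw [hSi k hk]
      exact Or.inr ⟨some k, by simp, hq⟩
  have hPi : ∀ k, k ≠ .inr 5 → ∀ q ∈ c' k '' Ioo 0 1, q ∉ insert p P := fun k hk q hq hqP => by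
    rw [fi k hk] at hq
    exact h₁.avoids (some k) q hqP hq
  have hPP : ∀ k l, k ≠ l → ∀ q ∈ c' k '' Ioo 0 1, q ∈ c' l '' Ioo 0 1 → q ∉ insert p P := by
    intro k l hkl q hqk hql
    by_cases hk : k = .inr 5
    · exact hPi l (fun hl => hkl (hk.trans hl.symm)) q hql
    · exact hPi k hk q hqk
  have hSdisj : ∀ k l, k ≠ l → Disjoint (S k) (S l) := by
    have h5 : ∀ k, k ≠ .inr 5 → Disjoint (S (.inr 5)) (S k) := fun k hk => by
      rw [hS5, hSi k hk]
      simpa using hk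
    intro k l hkl
    by_cases hk : k = .inr 5
    · rw [hk] at hkl ⊢
      exact h5 l hkl.symm
    by_cases hl : l = .inr 5
    · rw [hl]
      exact (h5 k hk).symm
    rw [hSi k hk, hSi l hl]
    simpa using hkl
  have g3 : IsArc (c' (.inr 3)) p x := by rw [f3]; exact hv
  have g4 : IsArc (c' (.inr 4)) p y := by rw [f4]; exact hw
  have g5 : IsArc (c' (.inr 5)) p t := by rw [f5]; exact hδ
  have hother : ∀ i, i ≠ .inr 3 → i ≠ .inr 4 → i ≠ .inr 5 → c' i = c i := fun i h3 h4 h5 => by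
    rw [fi i h5, ei i h3 h4]
  have hcases : ∀ i : O ⊕ Fin 6, i = .inr 3 ∨ i = .inr 4 ∨ i = .inr 5 ∨
      i ≠ .inr 3 ∧ i ≠ .inr 4 ∧ i ≠ .inr 5 := fun i => by tauto
  have h₂ : Pic (insert p (P \ {z})) c' := by
    refine h₁.reroute (S := fun k => S k) ((h.finite_pts.subset sdiff_subset).insert _)
      ?_ ?_ ?_ ?_ ?_ hSP hPP fun k l hkl => Or.inl (Finset.disjoint_coe.2 (hSdisj k l hkl))
    · intro i
      rcases hcases i with rfl | rfl | rfl | ⟨h3, h4, h5⟩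
      · exact g3.polygonal
      · exact g4.polygonal
      · exact g5.polygonal
      · rw [hother i h3 h4 h5]; exact h.polygonal i
    · intro i
      rcases hcases i with rfl | rfl | rfl | ⟨h3, h4, h5⟩
      · exact g3.injOn_Ioo
      · exact g4.injOn_Ioo
      · exact g5.injOn_Ioo
      · rw [hother i h3 h4 h5]; exact h.simple i
    · intro i
      rcases hcases i with rfl | rfl | rfl | ⟨h3, h4, h5⟩
      · rw [g3.left]; exact mem_insert _ _
      · rw [g4.left]; exact mem_insert _ _
      · rw [g5.left]; exact mem_insert _ _
      · rw [hother i h3 h4 h5]; exact mem_insert_of_mem _ ⟨h.left_mem i, (hz i h3 h4 h5).1⟩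
    · intro i
      rcases hcases i with rfl | rfl | rfl | ⟨h3, h4, h5⟩
      · rw [g3.right]; exact mem_insert_of_mem _ ⟨hxP, hxz⟩
      · rw [g4.right]; exact mem_insert_of_mem _ ⟨hyP, hyz⟩
      · rw [g5.right]; exact mem_insert_of_mem _ ⟨htP, htz⟩
      · rw [hother i h3 h4 h5]; exact mem_insert_of_mem _ ⟨h.right_mem i, (hz i h3 h4 h5).2⟩
    · intro k q hq hqk
      by_cases hk : k = .inr 5
      · rw [hk, f5] at hqk
        rcases hδc q hqk with rfl | hqk | hqk
        · rcases hq with rfl | hq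
          · exact hpP hzP
          · exact hq.2 rfl
        · exact h₁.avoids _ q (hP₁ hq) hqk
        · exact h₁.avoids _ q (hP₁ hq) hqk
      · exact hPi k hk q hqk (hP₁ hq)
  have hmono : ∀ i j, i ≠ j → i ≠ .inr 5 → j ≠ .inr 5 → crossCount c' i j ≤ crossCount c i j := by
    intro i j hij hi hj
    refine h.crossCount_mono hij ?_ ?_
    · rw [fi i hi]; exact hsub₁ i
    · rw [fi j hj]; exact hsub₁ j
  have h5 : ∀ j, j ≠ .inr 5 → crossCount c' (.inr 5) j ≤
      (u '' Ioo 0 1 ∩ d₁ j '' Ioo 0 1).ncard + crossCount c (.inr 5) j := by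
    intro j hj
    refine (h₁.crossCount_le_sum _ _ (hSP _) (hSP j) (hPP _ j hj.symm) (hSdisj _ j hj.symm)).trans ?_
    rw [hS5, hSi j hj, Finset.sum_pair (by simp), Finset.sum_singleton, Finset.sum_singleton]
    refine Nat.add_le_add (crossCount_of_ne (by simp)).le
      (h.crossCount_mono hj.symm (hsub₁ (.inr 5)) (hsub₁ j))
  have hsplit : ∀ j, j ≠ .inr 3 → j ≠ .inr 4 → j ≠ .inr 5 →
      crossCount c' (.inr 3) j + crossCount c' (.inr 5) j ≤
        crossCount c (.inr 3) j + crossCount c (.inr 5) j := by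
    intro j j3 j4 j5
    have hfin := h.finite _ _ j3.symm
    have := h5 j j5
    rw [crossCount_of_ne j3.symm, crossCount_of_ne j3.symm, f3, fi j j5]
    rw [ei j j3 j4] at this ⊢
    have hle : (u '' Ioo 0 1 ∩ c j '' Ioo 0 1).ncard + (v '' Ioo 0 1 ∩ c j '' Ioo 0 1).ncard ≤
        (c (.inr 3) '' Ioo 0 1 ∩ c j '' Ioo 0 1).ncard := by
      rw [← ncard_union_eq (huv.mono inter_subset_left inter_subset_left)
        (hfin.subset (inter_subset_inter_left _ hua)) (hfin.subset (inter_subset_inter_left _ hva)),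
        ← union_inter_distrib_right]
      exact ncard_le_ncard (inter_subset_inter_left _ (union_subset hua hva)) hfin
    omega
  have h34 : crossCount c' (.inr 3) (.inr 4) = 0 :=
    crossCount_eq_zero_of_disjoint (by rw [f3, f4]; exact hvw)
  have h35 : crossCount c' (.inr 3) (.inr 5) ≤ crossCount c (.inr 3) (.inr 5) := by
    have := h5 (.inr 3) (by simp)
    rw [e3, disjoint_iff_inter_eq_empty.1 huv, ncard_empty] at this
    rw [crossCount_comm, crossCount_comm (c := c) (.inr 3)]
    omega
  have h45 : crossCount c' (.inr 4) (.inr 5) ≤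
      crossCount c (.inr 3) (.inr 4) + crossCount c (.inr 4) (.inr 5) := by
    have := h5 (.inr 4) (by simp)
    rw [crossCount_comm, crossCount_comm (c := c) (.inr 4)]
    refine this.trans (Nat.add_le_add_right ?_ _)
    rw [crossCount_of_ne (by simp), e4]
    exact ncard_le_ncard (inter_subset_inter hua hwb) (h.finite _ _ (by simp))
  refine ⟨p, c', fun hp => hpP hp.1, h₂, hother, g3, g4, g5, h34, ?_⟩
  have ho : ∀ q, q ≠ 5 → crossOld c' q ≤ crossOld c q := fun q hq =>
    Finset.sum_le_sum fun o _ => hmono _ _ (by simp) (by simpa using hq) (by simp)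
  have ho35 : crossOld c' 3 + crossOld c' 5 ≤ crossOld c 3 + crossOld c 5 := by
    unfold crossOld
    rw [← Finset.sum_add_distrib, ← Finset.sum_add_distrib]
    exact Finset.sum_le_sum fun o _ => hsplit _ (by simp) (by simp) (by simp)
  have hold : oldCost c' = oldCost c := oldCost_congr fun o => hother _ (by simp) (by simp) (by simp)
  have hm : ∀ p q : Fin 6, p ≠ q → p ≠ 5 → q ≠ 5 →
      crossCount c' (.inr p) (.inr q) ≤ crossCount c (.inr p) (.inr q) := fun p q hpq hp hq =>
    hmono _ _ (by simpa using hpq) (by simpa using hp) (by simpa using hq)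
  have hs : ∀ p : Fin 6, p ≠ 3 → p ≠ 4 → p ≠ 5 →
      crossCount c' (.inr p) (.inr 3) + crossCount c' (.inr p) (.inr 5) ≤
        crossCount c (.inr p) (.inr 3) + crossCount c (.inr p) (.inr 5) := fun p p3 p4 p5 => by
    have := hsplit (.inr p) (by simpa using p3) (by simpa using p4) (by simpa using p5)
    rw [crossCount_comm (c := c') (.inr p) (.inr 3), crossCount_comm (c := c') (.inr p) (.inr 5),
      crossCount_comm (c := c) (.inr p) (.inr 3), crossCount_comm (c := c) (.inr p) (.inr 5)]
    exact this
  have o0 := ho 0 (by decide)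
  have o1 := ho 1 (by decide)
  have o2 := ho 2 (by decide)
  have o4 := ho 4 (by decide)
  have m01 := hm 0 1 (by decide) (by decide) (by decide)
  have m02 := hm 0 2 (by decide) (by decide) (by decide)
  have m12 := hm 1 2 (by decide) (by decide) (by decide)
  have m04 := hm 0 4 (by decide) (by decide) (by decide)
  have m14 := hm 1 4 (by decide) (by decide) (by decide)
  have m24 := hm 2 4 (by decide) (by decide) (by decide)
  have s0 := hs 0 (by decide) (by decide) (by decide)
  have s1 := hs 1 (by decide) (by decide) (by decide)
  have s2 := hs 2 (by decide) (by decide) (by decide)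
  rw [cost_six, cost_six]
  linarith

end Fin

/-! ### The new edges of an expansion -/

section

open Graph

instance : Finite NewEdge :=
  Finite.of_surjective
    (fun x : Fin 4 ⊕ Fin 4 ⊕ Fin 3 ⊕ Unit ⊕ Unit ⊕ Unit =>
      Sum.elim NewEdge.s1t1 (Sum.elim NewEdge.s2t2 (Sum.elim NewEdge.s1s2
        (Sum.elim (fun _ => NewEdge.s3s1) (Sum.elim (fun _ => NewEdge.s3s2)
          fun _ => NewEdge.s3t3)))) x) (by
    rintro (i | i | i | - | - | -)
    exacts [⟨.inl i, rfl⟩, ⟨.inr (.inl i), rfl⟩, ⟨.inr (.inr (.inl i)), rfl⟩,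
      ⟨.inr (.inr (.inr (.inl ()))), rfl⟩, ⟨.inr (.inr (.inr (.inr (.inl ())))), rfl⟩,
      ⟨.inr (.inr (.inr (.inr (.inr ())))), rfl⟩])

instance : Finite NewVertex :=
  Finite.of_surjective (fun i : Fin 3 => ![NewVertex.s1, NewVertex.s2, NewVertex.s3] i) (by
    rintro (_ | _ | _)
    exacts [⟨0, rfl⟩, ⟨1, rfl⟩, ⟨2, rfl⟩])

/-- The six bunches of new edges of a 4-to-3 expansion. -/
def newBunch {β : Type*} : Fin 6 → Set (β ⊕ NewEdge) :=
  ![range fun i => .inr (.s1t1 i), range fun i => .inr (.s2t2 i), range fun i => .inr (.s1s2 i),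
    {.inr .s3s1}, {.inr .s3s2}, {.inr .s3t3}]

section
variable {α β : Type*} {G : Graph α β} {s t₁ t₂ t₃ : α}

theorem ncard_newBunch (p : Fin 6) :
    (newBunch p : Set (β ⊕ NewEdge)).ncard = ![4, 4, 3, 1, 1, 1] p := by
  have key : ∀ {n : ℕ} (g : Fin n → NewEdge), Function.Injective g →
      (range fun i => (Sum.inr (g i) : β ⊕ NewEdge)).ncard = n := fun {n} g hg => by
    have hinj : Function.Injective fun i => (Sum.inr (g i) : β ⊕ NewEdge) :=
      Sum.inr_injective.comp hg
    rw [← image_univ, ncard_image_of_injective _ hinj, ncard_univ, Nat.card_eq_fintype_card,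
      Fintype.card_fin]
  fin_cases p
  · exact key _ fun i j h => by simpa using h
  · exact key _ fun i j h => by simpa using h
  · exact key _ fun i j h => by simpa using h
  · exact ncard_singleton _
  · exact ncard_singleton _
  · exact ncard_singleton _

theorem finite_newBunch (p : Fin 6) : (newBunch p : Set (β ⊕ NewEdge)).Finite :=
  finite_of_ncard_pos (by
    rw [ncard_newBunch]
    revert p
    decide)

theorem ncard_newBunch_inter_le (p : Fin 6) (E : Set (β ⊕ NewEdge)) :
    (newBunch p ∩ E).ncard ≤ ![4, 4, 3, 1, 1, 1] p :=
  (ncard_le_ncard inter_subset_left (finite_newBunch p)).trans (ncard_newBunch p).le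

theorem exists_mem_newBunch (n : NewEdge) : ∃ p, (.inr n : β ⊕ NewEdge) ∈ newBunch p := by
  rcases n with i | i | i | _ | _ | _
  exacts [⟨0, i, rfl⟩, ⟨1, i, rfl⟩, ⟨2, i, rfl⟩, ⟨3, rfl⟩, ⟨4, rfl⟩, ⟨5, rfl⟩]

theorem inl_notMem_newBunch (e : β) (p : Fin 6) : (.inl e : β ⊕ NewEdge) ∉ newBunch p := by
  fin_cases p <;> simp [newBunch]

theorem disjoint_newBunch (p q : Fin 6) (hpq : p ≠ q) :
    Disjoint (newBunch p : Set (β ⊕ NewEdge)) (newBunch q) := by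
  rw [disjoint_left]
  rintro (e | n) hp hq
  · exact inl_notMem_newBunch e p hp
  · fin_cases p <;> fin_cases q <;> first | exact absurd rfl hpq | skip
    all_goals
      rcases n with i | i | i | _ | _ | _ <;> simp [newBunch] at hp hq

/-- The first ends of the edges of the six bunches. -/
def newLeft (α : Type*) : Fin 6 → α ⊕ NewVertex :=
  ![.inr .s1, .inr .s2, .inr .s1, .inr .s3, .inr .s3, .inr .s3]

/-- The second ends of the edges of the six bunches. -/
def newRight (t₁ t₂ t₃ : α) : Fin 6 → α ⊕ NewVertex :=
  ![.inl t₁, .inl t₂, .inr .s2, .inr .s1, .inr .s2, .inl t₃]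

variable (hs : G.IsExpandable s t₁ t₂ t₃)

theorem isLink_newBunch (p : Fin 6) {e : β ⊕ NewEdge} (he : e ∈ newBunch p) :
    (G.expansion s t₁ t₂ t₃ hs).IsLink e (newLeft α p) (newRight t₁ t₂ t₃ p) := by
  fin_cases p
  · obtain ⟨i, rfl⟩ := he; rfl
  · obtain ⟨i, rfl⟩ := he; rfl
  · obtain ⟨i, rfl⟩ := he; rfl
  · obtain rfl := he; rfl
  · obtain rfl := he; rfl
  · obtain rfl := he; rfl

theorem isLink_expansion_inl {e : β} {x y : α} (h : G.IsLink e x y) (hx : x ≠ s) (hy : y ≠ s) :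
    (G.expansion s t₁ t₂ t₃ hs).IsLink (.inl e) (.inl x) (.inl y) :=
  ⟨x, y, by simp [deleteVerts_isLink, h, hx, hy], rfl, rfl⟩

theorem inl_mem_edgeSet_expansion {e : β} :
    .inl e ∈ (G.expansion s t₁ t₂ t₃ hs).edgeSet ↔ e ∈ G.edgeSet ∧ ¬ G.Inc e s := by
  constructor
  · intro he
    obtain ⟨_, _, x, y, hl, rfl, rfl⟩ := exists_isLink_of_mem_edgeSet he
    rw [deleteVerts_isLink] at hl
    obtain ⟨hl, hx, hy⟩ := hl
    refine ⟨hl.edge_mem, ?_⟩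
    rintro ⟨z, hz⟩
    rcases hz.left_eq_or_eq hl with rfl | rfl
    · exact hx rfl
    · exact hy rfl
  · rintro ⟨he, hes⟩
    obtain ⟨x, y, hl⟩ := exists_isLink_of_mem_edgeSet he
    refine (isLink_expansion_inl hs hl ?_ ?_).edge_mem
    · rintro rfl
      exact hes hl.inc_left
    · rintro rfl
      exact hes hl.inc_right

theorem finite_edgeSet_expansion (hE : G.edgeSet.Finite) :
    (G.expansion s t₁ t₂ t₃ hs).edgeSet.Finite := by
  refine ((hE.image Sum.inl).union (finite_range Sum.inr)).subset ?_
  rintro (e | n) he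
  · exact Or.inl ⟨e, ((inl_mem_edgeSet_expansion hs).1 he).1, rfl⟩
  · exact Or.inr ⟨n, rfl⟩

theorem finite_vertexSet_expansion (hV : G.vertexSet.Finite) :
    (G.expansion s t₁ t₂ t₃ hs).vertexSet.Finite :=
  ((hV.subset sdiff_subset).image _).union (finite_range _)

theorem inl_mem_vertexSet_expansion {x : α} :
    .inl x ∈ (G.expansion s t₁ t₂ t₃ hs).vertexSet ↔ x ∈ G.vertexSet ∧ x ≠ s := by
  simp [expansion]

theorem inr_mem_vertexSet_expansion (v : NewVertex) :
    .inr v ∈ (G.expansion s t₁ t₂ t₃ hs).vertexSet := Or.inr ⟨v, rfl⟩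

theorem exists_ends {O : Set β} (hO : ∀ e ∈ O, e ∈ G.edgeSet ∧ ¬ G.Inc e s) :
    ∃ x y : O → α, ∀ o : O, G.IsLink o (x o) (y o) ∧ x o ≠ s ∧ y o ≠ s := by
  have : ∀ o : O, ∃ x y, G.IsLink o x y ∧ x ≠ s ∧ y ≠ s := fun o => by
    obtain ⟨he, hes⟩ := hO o o.2
    obtain ⟨x, y, hl⟩ := exists_isLink_of_mem_edgeSet he
    refine ⟨x, y, hl, ?_, ?_⟩
    · rintro rfl
      exact hes hl.inc_left
    · rintro rfl
      exact hes hl.inc_right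
  choose x y h using this
  exact ⟨x, y, h⟩

theorem IsThickEdge.finite_and_ncard {α β : Type*} {G : Graph α β} {k : ℕ} {x y : α} {F : Set β}
    (h : G.IsThickEdge k x y F) : F.Finite ∧ F.ncard = k := by
  have hfin : F.Finite := finite_of_encard_eq_coe h.2.1
  refine ⟨hfin, ?_⟩
  have := h.2.1
  rw [← hfin.cast_ncard_eq] at this
  exact_mod_cast this

/-- A family of curves, three of which join `s` to the other ends of its thick edges while the
others are the edges not incident with `s`, is a drawing of `G` after thickening. -/
theorem crossingNumber_lt_of_star (hE : G.edgeSet.Finite) {F : Fin 3 → Set β} {w : Fin 3 → ℕ}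
    {T : Fin 3 → α} (hF : ∀ p, G.IsThickEdge (w p) s (T p) (F p))
    (hinc : ∀ e, G.Inc e s → ∃ p, e ∈ F p) {O : Set β} [Fintype O]
    (hO : O = {e | e ∈ G.edgeSet ∧ ¬ G.Inc e s}) {x y : O → α}
    (hxy : ∀ o : O, G.IsLink o (x o) (y o)) {pos : α → Plane} (hpos : InjOn pos G.vertexSet)
    {P : Set Plane} {c : O ⊕ Fin 3 → ℝ → Plane} (h : Pic P c) (hP : pos '' G.vertexSet ⊆ P)
    (hx : ∀ o, c (.inl o) 0 = pos (x o)) (hy : ∀ o, c (.inl o) 1 = pos (y o))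
    (hs : ∀ p, c (.inr p) 0 = pos s) (hT : ∀ p, c (.inr p) 1 = pos (T p)) {m : ℕ}
    (hm : cost (Sum.elim (fun _ => 1) w) c < 2 * m) : G.crossingNumber < m := by
  have hw := fun p => IsThickEdge.finite_and_ncard (hF p)
  refine crossingNumber_lt hE hpos h hP (Sum.elim (fun o => {(o : β)}) F) ?_ (Sum.elim x fun _ => s)
    (Sum.elim y T) ?_ ?_ _ ?_ ?_ hm
  · intro e he
    by_cases hes : G.Inc e s
    · obtain ⟨p, hp⟩ := hinc e hes
      exact ⟨.inr p, hp⟩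
    · exact ⟨.inl ⟨e, hO ▸ ⟨he, hes⟩⟩, rfl⟩
  · rintro (o | p) e he -
    · obtain rfl := he
      exact hxy o
    · exact (hF p).2.2 e he
  · rintro (o | p)
    · exact congrArg₂ Sym2.mk (hx o) (hy o)
    · exact congrArg₂ Sym2.mk (hs p) (hT p)
  · rintro (o | p)
    · exact (ncard_le_ncard inter_subset_left (finite_singleton _)).trans (ncard_singleton _).le
    · exact (ncard_le_ncard inter_subset_left (hw p).1).trans (hw p).2.le
  · rintro (o | p)
    · exact Or.inl le_rfl
    · by_cases hp : w p = 0
      · exact Or.inl (by simp [hp])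
      right
      rw [hs, hT]
      have hmem := (hF p).right_mem hp
      obtain ⟨e, he⟩ : (F p).Nonempty := nonempty_of_ncard_ne_zero (by rw [(hw p).2]; exact hp)
      exact fun heq => (hF p).1 (hpos ((hF p).2.2 e he).left_mem hmem.1 heq)

end

end

/-! ### Lower bound for the crossing number of an expansion -/

section

open Graph

section
variable {α β : Type*} {G : Graph α β} {s t₁ t₂ t₃ : α}

/-- If all three ways to turn a drawing of the expansion with at most 12 crossings into a drawing of
the original graph gave at least 13 crossings, then the numbers of crossings would contradict each
other. Here `A`, `B`, `C`, `a`, `b`, `d` are the six bunches and `o` collects the old edges. -/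
theorem expansion_arithmetic {oo oA oB oC oa ob od AB AC Aa Ab Ad BC Ba Bb Bd Ca Cb Cd ad bd : ℕ}
    (h : oo + 2 * (4 * oA + 4 * oB + 3 * oC + oa + ob + od) + 2 * (16 * AB + 12 * AC + 4 * Aa +
      4 * Ab + 4 * Ad + 12 * BC + 4 * Ba + 4 * Bb + 4 * Bd + 3 * Ca + 3 * Cb + 3 * Cd + 0 + ad + bd) <
      2 * 13)
    (h₁ : 2 * 13 ≤ oo + 2 * (4 * oA + 4 * (oC + oB) + 1 * (oa + od)) +
      2 * (4 * 4 * (AC + AB) + 4 * 1 * (Aa + Ad) + 4 * 1 * (Ca + Cd + Ba + Bd)))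
    (h₂ : 2 * 13 ≤ oo + 2 * (4 * oB + 4 * (oC + oA) + 1 * (ob + od)) +
      2 * (4 * 4 * (BC + AB) + 4 * 1 * (Bb + Bd) + 4 * 1 * (Cb + Cd + Ab + Ad)))
    (h₃ : 2 * 13 ≤ oo + 2 * (1 * od + 4 * (oa + oA) + 4 * (ob + oB)) +
      2 * (1 * 4 * (ad + Ad) + 1 * 4 * (bd + Bd) + 4 * 4 * (0 + Ba + Ab + AB))) : False := by
  -- `k₁`, `k₂`: the difference of the first two hypotheses, and of the first and the third one.
  have k₁ : 1 + ob + 4 * Ab + 12 * BC + 4 * Bb + 3 * Cb + ad + bd ≤ oC + 4 * AC + Ca + Cd := by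
    linarith
  have k₂ : 1 + oa + 4 * Ba + 12 * AC + 4 * Aa + 3 * Ca + ad + bd ≤ oC + 4 * BC + Cb + Cd := by
    linarith
  -- In terms of `u` and `v`, the sum of `k₁` and `k₂`, the hypothesis `h₃` compared with `h`, and `h`
  -- itself have no integral solution.
  obtain ⟨u, hu⟩ : ∃ u, u = oC + Cd := ⟨_, rfl⟩
  obtain ⟨v, hv⟩ : ∃ v, v = oa + ob + 4 * Ab + 4 * Ba + ad + bd := ⟨_, rfl⟩
  have k₃ : 2 + v ≤ 2 * u := by linarith
  have k₄ : 1 + 3 * u ≤ 3 * v := by linarith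
  have k₅ : 3 * u + v ≤ 12 := by linarith
  clear * - k₃ k₄ k₅
  omega

/-- The expansion has crossing number at least 13: if it had a drawing with at most 12 crossings,
then one of three contractions of the new vertices to a single vertex would draw `G` with at most 12
crossings. -/
theorem thirteen_le_crossingNumber_expansion (hV : G.vertexSet.Finite) (hE : G.edgeSet.Finite)
    (hG : (13 : ℕ∞) ≤ G.crossingNumber) (hs : G.IsExpandable s t₁ t₂ t₃) :
    (13 : ℕ∞) ≤ (G.expansion s t₁ t₂ t₃ hs).crossingNumber := by
  classical
  by_contra! hlt
  obtain ⟨F₁, F₂, F₃, h₁, h₂, h₃, d₁₂, d₁₃, d₂₃, hinc⟩ := id hs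
  have m₁ := h₁.right_mem (by norm_num)
  have m₂ := h₂.right_mem (by norm_num)
  have m₃ := h₃.right_mem (by norm_num)
  obtain ⟨O, hO⟩ : ∃ O : Set β, O = {e | e ∈ G.edgeSet ∧ ¬ G.Inc e s} := ⟨_, rfl⟩
  have := (hE.subset (show O ⊆ G.edgeSet by rw [hO]; exact fun e he => he.1)).fintype
  obtain ⟨x, y, hxy⟩ := exists_ends (G := G) (s := s) (O := O) fun e he => by rw [hO] at he; exact he
  have hE₁ := finite_edgeSet_expansion hs hE
  have hWpos : ∀ p : Fin 6, 0 < (![4, 4, 3, 1, 1, 1] : Fin 6 → ℕ) p := by decide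
  -- All edges of a bunch are redrawn along the cheapest one of them.
  obtain ⟨pos, c, hpos, h, hc0, hc1, hcost⟩ := exists_pic_of_crossingNumber_lt (ι := O ⊕ Fin 6)
    (finite_vertexSet_expansion hs hV) hE₁ (m := 13) hlt
    (Sum.elim (fun o => {.inl (o : β)}) newBunch) (by
      rintro (e | n) he
      · exact ⟨.inl ⟨e, by rw [hO]; exact (inl_mem_edgeSet_expansion hs).1 he⟩, rfl⟩
      · obtain ⟨p, hp⟩ := exists_mem_newBunch n
        exact ⟨.inr p, hp⟩) (by
      rintro (o | p) (o' | q) hij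
      · simpa [Subtype.ext_iff] using hij
      · simpa using inl_notMem_newBunch _ _
      · simpa using inl_notMem_newBunch _ _
      · exact disjoint_newBunch p q fun h => hij (by rw [h]))
    (Sum.elim (fun o => .inl (x o)) (newLeft α)) (Sum.elim (fun o => .inl (y o)) (newRight t₁ t₂ t₃))
    (by
      rintro (o | p) e he -
      · obtain rfl := he
        exact isLink_expansion_inl hs (hxy o).1 (hxy o).2.1 (hxy o).2.2
      · exact isLink_newBunch hs p he)
    (Sum.elim (fun _ => 1) ![4, 4, 3, 1, 1, 1]) (by
      rintro (o | p)
      · have : ({.inl (o : β)} ∩ (G.expansion s t₁ t₂ t₃ hs).edgeSet) = {.inl (o : β)} := by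
          rw [inter_eq_left, singleton_subset_iff]
          exact (isLink_expansion_inl hs (hxy o).1 (hxy o).2.1 (hxy o).2.2).edge_mem
        simp [this]
      · have : (newBunch p ∩ (G.expansion s t₁ t₂ t₃ hs).edgeSet) = newBunch p := by
          rw [inter_eq_left]
          exact fun e he => (isLink_newBunch hs p he).edge_mem
        simp [this, ncard_newBunch])
    (by
      rintro (o | p)
      · exact one_pos
      · exact hWpos p)
  set V₁ := (G.expansion s t₁ t₂ t₃ hs).vertexSet with hV₁
  set P := pos '' V₁ with hPdef
  have hmem : ∀ {x}, x ∈ G.vertexSet → x ≠ s → (.inl x : α ⊕ NewVertex) ∈ V₁ := fun hx hxs =>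
    (inl_mem_vertexSet_expansion hs).2 ⟨hx, hxs⟩
  have hnew : ∀ v, (.inr v : α ⊕ NewVertex) ∈ V₁ := inr_mem_vertexSet_expansion hs
  have hne : ∀ {x} v, x ∈ G.vertexSet → x ≠ s → pos (.inl x) ≠ pos (.inr v) := fun v hx hxs he => by
    simpa using hpos (hmem hx hxs) (hnew v) he
  have hnn : ∀ {v w}, v ≠ w → pos (.inr v) ≠ pos (.inr w) := fun hvw he =>
    hvw (by simpa using hpos (hnew _) (hnew _) he)
  have hne₁ := fun v => hne v m₁.1 m₁.2
  have hne₂ := fun v => hne v m₂.1 m₂.2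
  have hne₃ := fun v => hne v m₃.1 m₃.2
  have harc : ∀ p : Fin 6, pos (newLeft α p) ≠ pos (newRight t₁ t₂ t₃ p) →
      IsArc (c (.inr p)) (pos (newLeft α p)) (pos (newRight t₁ t₂ t₃ p)) := fun p hp => by
    have h0 : c (.inr p) 0 = pos (newLeft α p) := hc0 (.inr p)
    have h1 : c (.inr p) 1 = pos (newRight t₁ t₂ t₃ p) := hc1 (.inr p)
    have := h.isArc (i := .inr p) (by rw [h0, h1]; exact hp)
    rwa [h0, h1] at this
  have hA : IsArc (c (.inr 0)) (pos (.inr .s1)) (pos (.inl t₁)) := harc 0 (hne₁ .s1).symm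
  have hB : IsArc (c (.inr 1)) (pos (.inr .s2)) (pos (.inl t₂)) := harc 1 (hne₂ .s2).symm
  have hC : IsArc (c (.inr 2)) (pos (.inr .s1)) (pos (.inr .s2)) := harc 2 (hnn (by simp))
  have ha : IsArc (c (.inr 3)) (pos (.inr .s3)) (pos (.inr .s1)) := harc 3 (hnn (by simp))
  have hb : IsArc (c (.inr 4)) (pos (.inr .s3)) (pos (.inr .s2)) := harc 4 (hnn (by simp))
  have hd : IsArc (c (.inr 5)) (pos (.inr .s3)) (pos (.inl t₃)) := harc 5 (hne₃ .s3).symm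
  have hold0 : ∀ o, c (.inl o) 0 = pos (.inl (x o)) := fun o => hc0 (.inl o)
  have hold1 : ∀ o, c (.inl o) 1 = pos (.inl (y o)) := fun o => hc1 (.inl o)
  have hx := fun o : O => (hxy o).1.left_mem
  have hy := fun o : O => (hxy o).1.right_mem
  have hends : ∀ {γ : ℝ → Plane} {u v w : Plane}, IsArc γ u v → u ≠ w → v ≠ w → γ 0 ≠ w ∧ γ 1 ≠ w :=
    fun hγ hu hv => ⟨by rwa [hγ.left], by rwa [hγ.right]⟩
  -- The edges `s³s¹` and `s³s²` are made disjoint; the vertex `s³` moves to the point `q`.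
  obtain ⟨q, c', hq, h', hc', ha', hb', hd', hab, hle⟩ := h.exists_disjoint ha hb hd (by
    rintro (o | p) h3 h4 h5
    · rw [hold0, hold1]
      exact ⟨hne _ (hx o) (hxy o).2.1, hne _ (hy o) (hxy o).2.2⟩
    · fin_cases p
      · exact hends hA (hnn (by simp)) (hne₁ _)
      · exact hends hB (hnn (by simp)) (hne₂ _)
      · exact hends hC (hnn (by simp)) (hnn (by simp))
      · exact absurd rfl h3
      · exact absurd rfl h4
      · exact absurd rfl h5) (hnn (by simp)) (hnn (by simp)) (hne₃ _)
  rw [← hc' (.inr 0) (by simp) (by simp) (by simp)] at hA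
  rw [← hc' (.inr 1) (by simp) (by simp) (by simp)] at hB
  rw [← hc' (.inr 2) (by simp) (by simp) (by simp)] at hC
  have hold : ∀ o, c' (.inl o) = c (.inl o) := fun o => hc' _ (by simp) (by simp) (by simp)
  set P' := insert q (P \ {pos (.inr .s3)}) with hP'
  have hqP' : q ∈ P' := mem_insert _ _
  have hP'₁ : pos (.inr .s1) ∈ P' := mem_insert_of_mem _ ⟨mem_image_of_mem _ (hnew _), hnn (by simp)⟩
  have hP'₂ : pos (.inr .s2) ∈ P' := mem_insert_of_mem _ ⟨mem_image_of_mem _ (hnew _), hnn (by simp)⟩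
  have hoP : ∀ {v}, v ∈ G.vertexSet → v ≠ s → pos (.inl v) ∈ P \ {pos (.inr .s3)} := fun hv hvs =>
    ⟨mem_image_of_mem _ (hmem hv hvs), hne _ hv hvs⟩
  have hoq : ∀ {v}, v ∈ G.vertexSet → v ≠ s → pos (.inl v) ≠ q := fun hv hvs he => hq (he ▸ hoP hv hvs)
  have hq₁ : pos (.inr .s1) ≠ q := fun he =>
    hq (he ▸ ⟨mem_image_of_mem _ (hnew _), hnn (by simp)⟩)
  have hq₂ : pos (.inr .s2) ≠ q := fun he =>
    hq (he ▸ ⟨mem_image_of_mem _ (hnew _), hnn (by simp)⟩)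
  have hJ : ∀ {v}, v ∈ G.vertexSet → v ≠ s → ∀ {j k}, pos (.inl v) ≠ j → pos (.inl v) ≠ k →
      pos (.inl v) ∈ P' \ {j, k} := by
    intro v hv hvs j k hj hk
    exact ⟨mem_insert_of_mem _ (hoP hv hvs), by simp [hj, hk]⟩
  -- Each star with the right ends is a drawing of `G`, which has at least 13 crossings.
  have key : ∀ {F : Fin 3 → Set β} {w : Fin 3 → ℕ} {T : Fin 3 → α},
      (∀ p, G.IsThickEdge (w p) s (T p) (F p)) → (∀ e, G.Inc e s → ∃ p, e ∈ F p) →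
      ∀ {S j k : Plane} {c'' : O ⊕ Fin 3 → ℝ → Plane}, Pic (P' \ {j, k}) c'' →
      (∀ o, c'' (.inl o) = c' (.inl o)) → (∀ p, c'' (.inr p) 0 = S) →
      (∀ p, c'' (.inr p) 1 = pos (.inl (T p))) →
      (∀ {v}, v ∈ G.vertexSet → v ≠ s → pos (.inl v) ≠ j ∧ pos (.inl v) ≠ k ∧ pos (.inl v) ≠ S) →
      2 * 13 ≤ cost (Sum.elim (fun _ => 1) w) c'' := by
    intro F w T hF hF' S j k c'' h'' hco hcS hcT hjk
    by_contra! hlt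
    obtain ⟨pos', hpos's, hpos'⟩ : ∃ pos' : α → Plane, pos' s = S ∧ ∀ v, v ≠ s → pos' v = pos (.inl v) :=
      ⟨Function.update (fun v => pos (.inl v)) s S, Function.update_self _ _ _,
        fun v hv => Function.update_of_ne hv _ _⟩
    have hinj : InjOn pos' G.vertexSet := by
      intro u hu v hv huv
      by_cases hus : u = s
      · by_cases hvs : v = s
        · rw [hus, hvs]
        · rw [hus, hpos's, hpos' v hvs] at huv
          exact absurd huv.symm (hjk hv hvs).2.2
      · by_cases hvs : v = s
        · rw [hvs, hpos's, hpos' u hus] at huv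
          exact absurd huv (hjk hu hus).2.2
        · rw [hpos' u hus, hpos' v hvs] at huv
          exact Sum.inl_injective (hpos (hmem hu hus) (hmem hv hvs) huv)
    refine absurd (crossingNumber_lt_of_star hE hF hF' hO (fun o => (hxy o).1) hinj h'' ?_ ?_ ?_ ?_ ?_ hlt)
      (not_lt.2 hG)
    · rintro _ ⟨v, hv, rfl⟩
      by_cases hvs : v = s
      · rw [hvs, hpos's, ← hcS 0]
        exact h''.left_mem _
      · rw [hpos' v hvs]
        exact hJ hv hvs (hjk hv hvs).1 (hjk hv hvs).2.1
    · intro o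
      rw [hco, hold, hold0, hpos' _ (hxy o).2.1]
    · intro o
      rw [hco, hold, hold1, hpos' _ (hxy o).2.2]
    · intro p
      rw [hcS, hpos's]
    · intro p
      rw [hcT, hpos' _ (hF p).1.symm]
  have hjoint0 : ∀ {j k}, (∀ {v}, v ∈ G.vertexSet → v ≠ s → pos (.inl v) ≠ j ∧ pos (.inl v) ≠ k) →
      ∀ o, c' (.inl o) 0 ∉ ({j, k} : Set Plane) := fun hjk o => by
    rw [hold, hold0]
    simpa using hjk (hx o) (hxy o).2.1
  have hjoint1 : ∀ {j k}, (∀ {v}, v ∈ G.vertexSet → v ≠ s → pos (.inl v) ≠ j ∧ pos (.inl v) ≠ k) →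
      ∀ o, c' (.inl o) 1 ∉ ({j, k} : Set Plane) := fun hjk o => by
    rw [hold, hold1]
    simpa using hjk (hy o) (hxy o).2.2
  have hmemF : ∀ e, G.Inc e s → e ∈ F₁ ∨ e ∈ F₂ ∨ e ∈ F₃ := fun e he => by
    simpa [or_assoc] using (hinc e).1 he
  -- `s` is placed at `s¹`; the edge `s³s²` is dropped.
  obtain ⟨c₁, hc₁, o₁, l₁, r₁, w₁⟩ := h'.exists_star (r := ![0, 2, 1, 3, 5]) (by decide)
    (t₀ := pos (.inl t₁)) (t₁ := pos (.inl t₂)) (t₂ := pos (.inl t₃))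
    ⟨_, hA, rfl⟩ ⟨_, hC, rfl⟩ ⟨_, hB, rfl⟩ ha'.reverse ⟨_, hd', rfl⟩ hP'₁ hP'₂ hqP'
    (hJ m₁.1 m₁.2 (hne₁ _) (hoq m₁.1 m₁.2)) (hJ m₂.1 m₂.2 (hne₂ _) (hoq m₂.1 m₂.2))
    (hJ m₃.1 m₃.2 (hne₃ _) (hoq m₃.1 m₃.2)) (hne₂ _).symm (hne₃ _).symm hq₂
    (hjoint0 fun hv hvs => ⟨hne _ hv hvs, hoq hv hvs⟩) (hjoint1 fun hv hvs => ⟨hne _ hv hvs, hoq hv hvs⟩)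
  -- `s` is placed at `s²`; the edge `s³s¹` is dropped.
  obtain ⟨c₂, hc₂, o₂, l₂, r₂, w₂⟩ := h'.exists_star (r := ![1, 2, 0, 4, 5]) (by decide)
    (t₀ := pos (.inl t₂)) (t₁ := pos (.inl t₁)) (t₂ := pos (.inl t₃))
    ⟨_, hB, rfl⟩ hC.reverse ⟨_, hA, rfl⟩ hb'.reverse ⟨_, hd', rfl⟩ hP'₂ hP'₁ hqP'
    (hJ m₂.1 m₂.2 (hne₂ _) (hoq m₂.1 m₂.2)) (hJ m₁.1 m₁.2 (hne₁ _) (hoq m₁.1 m₁.2))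
    (hJ m₃.1 m₃.2 (hne₃ _) (hoq m₃.1 m₃.2)) (hne₁ _).symm (hne₃ _).symm hq₁
    (hjoint0 fun hv hvs => ⟨hne _ hv hvs, hoq hv hvs⟩) (hjoint1 fun hv hvs => ⟨hne _ hv hvs, hoq hv hvs⟩)
  -- `s` is placed at the new position `q` of `s³`; the thick edge `s¹s²` is dropped.
  obtain ⟨c₃, hc₃, o₃, l₃, r₃, w₃⟩ := h'.exists_star (r := ![5, 3, 0, 4, 1]) (by decide)
    (t₀ := pos (.inl t₃)) (t₁ := pos (.inl t₁)) (t₂ := pos (.inl t₂))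
    ⟨_, hd', rfl⟩ ⟨_, ha', rfl⟩ ⟨_, hA, rfl⟩ ⟨_, hb', rfl⟩ ⟨_, hB, rfl⟩ hqP' hP'₁ hP'₂
    (hJ m₃.1 m₃.2 (hne₃ _) (hne₃ _)) (hJ m₁.1 m₁.2 (hne₁ _) (hne₁ _))
    (hJ m₂.1 m₂.2 (hne₂ _) (hne₂ _)) (hoq m₁.1 m₁.2).symm (hoq m₂.1 m₂.2).symm (hnn (by simp))
    (hjoint0 fun hv hvs => ⟨hne _ hv hvs, hne _ hv hvs⟩) (hjoint1 fun hv hvs => ⟨hne _ hv hvs, hne _ hv hvs⟩)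
  have g₁ := (key (F := ![F₁, F₂, F₃]) (w := ![4, 4, 1]) (T := ![t₁, t₂, t₃])
    (by intro p; fin_cases p; exacts [h₁, h₂, h₃])
    (fun e he => by
      rcases hmemF e he with he | he | he
      exacts [⟨0, he⟩, ⟨1, he⟩, ⟨2, he⟩]) hc₁ o₁ l₁
    (by intro p; rw [r₁]; fin_cases p <;> rfl)
    fun hv hvs => ⟨hne _ hv hvs, hoq hv hvs, hne _ hv hvs⟩).trans (w₁ 4 4 1)
  have g₂ := (key (F := ![F₂, F₁, F₃]) (w := ![4, 4, 1]) (T := ![t₂, t₁, t₃])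
    (by intro p; fin_cases p; exacts [h₂, h₁, h₃])
    (fun e he => by
      rcases hmemF e he with he | he | he
      exacts [⟨1, he⟩, ⟨0, he⟩, ⟨2, he⟩]) hc₂ o₂ l₂
    (by intro p; rw [r₂]; fin_cases p <;> rfl)
    fun hv hvs => ⟨hne _ hv hvs, hoq hv hvs, hne _ hv hvs⟩).trans (w₂ 4 4 1)
  have g₃ := (key (F := ![F₃, F₁, F₂]) (w := ![1, 4, 4]) (T := ![t₃, t₁, t₂])
    (by intro p; fin_cases p; exacts [h₃, h₁, h₂])
    (fun e he => by
      rcases hmemF e he with he | he | he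
      exacts [⟨1, he⟩, ⟨2, he⟩, ⟨0, he⟩]) hc₃ o₃ l₃
    (by intro p; rw [r₃]; fin_cases p <;> rfl)
    fun hv hvs => ⟨hne _ hv hvs, hne _ hv hvs, hoq hv hvs⟩).trans (w₃ 1 4 4)
  have g₀ := hle.trans_lt hcost
  rw [cost_six, hab] at g₀
  simp only [Matrix.cons_val, hab] at g₁ g₂ g₃
  rw [crossCount_comm (c := c') (.inr 1) (.inr 0)] at g₂
  rw [crossCount_comm (c := c') (.inr 5) (.inr 3), crossCount_comm (c := c') (.inr 5) (.inr 0),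
    crossCount_comm (c := c') (.inr 5) (.inr 4), crossCount_comm (c := c') (.inr 5) (.inr 1),
    crossCount_comm (c := c') (.inr 3) (.inr 1)] at g₃
  exact expansion_arithmetic g₀ g₁ g₂ g₃

end

end

/-! ### The triangle of an expansion -/

section cost
variable {ι κ : Type*} [Fintype ι] [Fintype κ] {c : ι → ℝ → Plane} {W : ι → ℕ}

theorem cost_comp_le {g : κ → ι} (hg : Function.Injective g) :
    cost (fun k => W (g k)) (fun k => c (g k)) ≤ cost W c := by
  have key : ∀ f : ι → ℕ, ∑ k, f (g k) ≤ ∑ i, f i := fun f => by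
    rw [show ∑ k, f (g k) = ∑ i ∈ Finset.univ.map ⟨g, hg⟩, f i from
      (Finset.sum_map Finset.univ ⟨g, hg⟩ f).symm]
    exact Finset.sum_le_univ_sum_of_nonneg fun _ => Nat.zero_le _
  unfold cost
  simp only [crossCount_comp hg]
  refine le_trans (Finset.sum_le_sum fun k _ => ?_) (key fun i => ∑ j, W i * W j * crossCount c i j)
  exact key fun j => W (g k) * W j * crossCount c (g k) j

/-- A curve `u` that is not crossed by any other curve can have any weight. -/
theorem cost_option_of_disjoint {u : ℝ → Plane} (w : ℕ)
    (hu : ∀ i, Disjoint (u '' Ioo 0 1) (c i '' Ioo 0 1)) :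
    cost (fun o : Option ι => o.elim w W) (fun o : Option ι => o.elim u c) = cost W c := by
  rw [cost_option]
  simp [fun i => disjoint_iff_inter_eq_empty.1 (hu i)]

theorem Pic.cost_update_le [DecidableEq ι] {P : Set Plane} (h : Pic P c) {e : ι} {v : ℝ → Plane}
    (hv : v '' Ioo 0 1 ⊆ c e '' Ioo 0 1) : cost W (Function.update c e v) ≤ cost W c := by
  have hsub : ∀ i, Function.update c e v i '' Ioo 0 1 ⊆ c i '' Ioo 0 1 := fun i => by
    by_cases hi : i = e
    · rw [hi, Function.update_self]; exact hv
    · rw [Function.update_of_ne hi]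
  exact cost_mono (fun _ => le_rfl) fun i j hij => h.crossCount_mono hij (hsub i) (hsub j)

end cost

/-- The triangle of an expansion: near the vertex `s`, where the curves `C`, `d` and at most one
further curve end, a new vertex `s₃` subdivides `d`, and there are curves `L` from `s₃` to the other
end `s₁` of `C` and `R` from `s` to `s₁`, one on each side of the path `s₃ s s₁`. Together they cost
at most as much as two further copies of `C`. -/
theorem Pic.exists_triangle {κ : Type*} [Fintype κ] [DecidableEq κ] {P : Set Plane}
    {c : κ → ℝ → Plane} (h : Pic P c) {C d : κ} (hCd : C ≠ d) {s s₁ t : Plane}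
    (hC : ∃ γ, IsArc γ s s₁ ∧ γ '' Ioo 0 1 = c C '' Ioo 0 1) (hd : IsArc (c d) s t) (hs₁ : s₁ ∈ P)
    (hone : ∀ j k, j ≠ C → j ≠ d → k ≠ C → k ≠ d → ∀ t u : ℝ, t = 0 ∨ t = 1 → u = 0 ∨ u = 1 →
      c j t = s → c k u = s → j = k ∧ t = u) :
    ∃ s₃ b d' L R, s₃ ∉ P ∧ IsArc b s s₃ ∧ IsArc d' s₃ t ∧ IsArc L s₃ s₁ ∧ IsArc R s s₁ ∧
      Pic (insert s₃ P) (fun o : Option (Option (Option κ)) => o.elim L fun o => o.elim R fun o =>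
        o.elim b (Function.update c d d')) ∧
      ∀ (W : κ → ℕ) (k : ℕ), cost (fun o : Option (Option (Option κ)) => o.elim k fun o =>
          o.elim k fun o => o.elim 1 W)
        (fun o : Option (Option (Option κ)) => o.elim L fun o => o.elim R fun o =>
          o.elim b (Function.update c d d')) ≤ cost (Function.update W C (W C + 2 * k)) c := by
  have hs : s ∈ P := hd.left ▸ h.left_mem d
  obtain ⟨γ, hγ, hγC⟩ := hC
  obtain ⟨s₃, b, d', hs₃, hs₃d, hb, hd', hbd, hd'd, hbd', hbi, h₁⟩ := h.exists_subdivision hd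
  set c₂ := Function.update c d d' with hc₂
  have e₂ : ∀ j, j ≠ d → c₂ j = c j := fun j hj => Function.update_of_ne hj _ _
  have ed : c₂ d = d' := Function.update_self _ _ _
  have hb₂ : ∀ j, Disjoint (b '' Ioo 0 1) (c₂ j '' Ioo 0 1) := fun j => by
    by_cases hj : j = d
    · rw [hj, ed]; exact hbd'
    · rw [e₂ j hj]; exact hbi j hj
  have hC₂ : γ '' Ioo 0 1 = c₂ C '' Ioo 0 1 := by rw [e₂ C hCd, hγC]
  have hav : ∀ {p}, p ∈ insert s₃ P → p ∉ b '' Ioo 0 1 ∧ ∀ j, p ∉ c₂ j '' Ioo 0 1 := fun hp =>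
    ⟨h₁.avoids none _ hp, fun j => h₁.avoids (some j) _ hp⟩
  obtain ⟨β, hβ, hβb⟩ := hb.reverse
  obtain ⟨ε, hε, hεs⟩ := hβ.concat hγ (by
    intro p hp hp'
    rw [hβ.image_Icc, hβb] at hp
    rw [hγ.image_Icc, hC₂] at hp'
    rcases hp with rfl | rfl | hp
    · rcases hp' with rfl | rfl | hp'
      · rfl
      · exact absurd hs₁ hs₃
      · exact absurd hp' ((hav (mem_insert _ _)).2 C)
    · rfl
    · rcases hp' with rfl | rfl | hp'
      · rfl
      · exact absurd hp (hav (mem_insert_of_mem _ hs₁)).1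
      · exact absurd hp' (disjoint_left.1 (hb₂ C) hp))
  rw [hβb, hC₂] at hεs
  obtain ⟨ts, hts, htss⟩ : s ∈ ε '' Ioo 0 1 := by rw [hεs]; exact Or.inl (Or.inr rfl)
  obtain ⟨L, R, hL, hR, h₃, hLε, hRε, hLR, hLR2⟩ := h₁.exists_two_sided {none, some C} hε
    (ts := ts) ⟨hts.1.le, hts.2⟩ (mem_insert _ _) (mem_insert_of_mem _ hs₁)
    (by rw [htss]; exact mem_insert_of_mem _ hs)
    (by
      intro p hp hps
      rw [hεs] at hp
      rcases hp with (hp | rfl) | hp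
      · exact ⟨none, by simp, hp⟩
      · exact absurd htss.symm hps
      · exact ⟨some C, by simp, hp⟩)
    (by
      rintro _ (rfl | rfl) p hp
      · rw [hεs]; exact Or.inl (Or.inl hp)
      · rw [hεs]; exact Or.inr hp)
    (by
      have hend : ∀ j (t : ℝ), t = 0 ∨ t = 1 → c₂ j t = s → j ≠ d := by
        rintro j t ht hjt rfl
        rw [ed] at hjt
        rcases ht with rfl | rfl
        · rw [hd'.left] at hjt
          exact hs₃ (hjt ▸ hs)
        · rw [hd'.right] at hjt
          exact hd.ne hjt.symm
      rintro - (_ | j) (_ | k) hj hk t u ht hu hjt hku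
      · exact absurd (Or.inl rfl) hj
      · exact absurd (Or.inl rfl) hj
      · exact absurd (Or.inl rfl) hk
      · rw [htss] at hjt hku
        change c₂ j t = s at hjt
        change c₂ k u = s at hku
        have hjd := hend j t ht hjt
        have hkd := hend k u hu hku
        rw [e₂ j hjd] at hjt
        rw [e₂ k hkd] at hku
        have := hone j k (fun h => hj (Or.inr (by rw [h]; rfl))) hjd
          (fun h => hk (Or.inr (by rw [h]; rfl))) hkd t u ht hu hjt hku
        exact ⟨by rw [this.1], this.2⟩)
  rw [htss] at hR
  refine ⟨s₃, b, d', L, R, hs₃, hb, hd', hL, hR, h₃, fun W k => ?_⟩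
  have hεIoo : ε '' Ioo 0 1 ⊆ ε '' Icc 0 1 := image_mono Ioo_subset_Icc_self
  have hbε : b '' Ioo 0 1 ⊆ ε '' Icc 0 1 := fun p hp => hεIoo (by rw [hεs]; exact Or.inl (Or.inl hp))
  have hCε : c₂ C '' Ioo 0 1 ⊆ ε '' Icc 0 1 := fun p hp => hεIoo (by rw [hεs]; exact Or.inr hp)
  have hzero : ∀ {A B : Set Plane}, Disjoint A B → (A ∩ B).ncard = 0 := fun hAB => by
    rw [disjoint_iff_inter_eq_empty.1 hAB, ncard_empty]
  have hcount : ∀ j, (L '' Ioo 0 1 ∩ c₂ j '' Ioo 0 1).ncard +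
      (R '' Ioo 0 1 ∩ c₂ j '' Ioo 0 1).ncard ≤ 2 * crossCount c₂ C j := by
    intro j
    by_cases hj : j = C
    · rw [hj, hzero (hLε.mono_right hCε), hzero (hRε.mono_right hCε)]
      exact Nat.zero_le _
    · refine (hLR2 (some j) (by simpa using hj)).trans (Nat.mul_le_mul_left _ ?_)
      rw [crossCount_of_ne (Ne.symm hj)]
      refine ncard_le_ncard ?_ (h₁.finite (some C) (some j) (by simpa using Ne.symm hj))
      rintro p ⟨hp, hpj⟩
      refine ⟨?_, hpj⟩
      rw [hεs] at hp
      rcases hp with (hp | rfl) | hp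
      · exact absurd hpj (disjoint_left.1 (hb₂ j) hp)
      · exact absurd hpj ((hav (mem_insert_of_mem _ hs)).2 j)
      · exact hp
  rw [cost_option, cost_option, cost_option_of_disjoint _ hb₂]
  simp only [Fintype.sum_option, Option.elim_none, Option.elim_some, hzero hLR,
    hzero (hLε.mono_right hbε), hzero (hRε.mono_right hbε), mul_zero, zero_add]
  have hle : cost (Function.update W C (W C + 2 * k)) c₂ ≤ cost (Function.update W C (W C + 2 * k)) c :=
    h.cost_update_le hd'd
  refine le_trans ?_ hle
  rw [cost_update, Function.update_eq_self, add_assoc, ← mul_add, ← Finset.sum_add_distrib]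
  refine Nat.add_le_add_left (Nat.mul_le_mul_left _ (Finset.sum_le_sum fun j _ => ?_)) _
  calc k * W j * (R '' Ioo 0 1 ∩ c₂ j '' Ioo 0 1).ncard + k * W j * (L '' Ioo 0 1 ∩ c₂ j '' Ioo 0 1).ncard
      = k * W j * ((L '' Ioo 0 1 ∩ c₂ j '' Ioo 0 1).ncard +
          (R '' Ioo 0 1 ∩ c₂ j '' Ioo 0 1).ncard) := by ring
    _ ≤ k * W j * (2 * crossCount c₂ C j) := Nat.mul_le_mul_left _ (hcount j)
    _ = 2 * k * W j * crossCount c₂ C j := by ring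

/-! ### Drawing the triangle near a subdivided edge -/

section

variable {O : Type*} [Fintype O] {P : Set Plane}

/-- The triangle of an expansion, where the special curves are `A`, `B`, `C`, `d`. In the new family
they are followed by the curves from `s₃` to `s₁`, from `s` to `s₃`, from `s₃` to `t`, and by a second
curve from `s` to `s₁`. -/
theorem Pic.exists_expansion {c : O ⊕ Fin 4 → ℝ → Plane} (h : Pic P c) {s s₁ t : Plane}
    (hC : ∃ γ, IsArc γ s s₁ ∧ γ '' Ioo 0 1 = c (.inr 2) '' Ioo 0 1)
    (hd : IsArc (c (.inr 3)) s t) (hs₁ : s₁ ∈ P)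
    (hA : c (.inr 0) 0 ≠ s ∧ c (.inr 0) 1 ≠ s) (hB : c (.inr 1) 1 ≠ s)
    (hold : ∀ o, c (.inl o) 0 ≠ s ∧ c (.inl o) 1 ≠ s) :
    ∃ (s₃ : Plane) (c' : O ⊕ Fin 7 → ℝ → Plane), s₃ ∉ P ∧ Pic (insert s₃ P) c' ∧
      (∀ o, c' (.inl o) = c (.inl o)) ∧ c' (.inr 0) = c (.inr 0) ∧ c' (.inr 1) = c (.inr 1) ∧
      c' (.inr 2) = c (.inr 2) ∧ IsArc (c' (.inr 3)) s₃ s₁ ∧ IsArc (c' (.inr 4)) s s₃ ∧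
      IsArc (c' (.inr 5)) s₃ t ∧ IsArc (c' (.inr 6)) s s₁ ∧
      ∀ w₀ w₁ w₂ k, cost (Sum.elim (fun _ => 1) ![w₀, w₁, w₂, k, 1, 1, k]) c' ≤
        cost (Sum.elim (fun _ => 1) ![w₀, w₁, w₂ + 2 * k, 1]) c := by
  classical
  have hB' : ∀ j : O ⊕ Fin 4, j ≠ .inr 2 → j ≠ .inr 3 → ∀ t : ℝ, t = 0 ∨ t = 1 → c j t = s →
      j = .inr 1 ∧ t = 0 := by
    rintro (o | p) h2 h3 t ht hjt
    · rcases ht with rfl | rfl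
      · exact absurd hjt (hold o).1
      · exact absurd hjt (hold o).2
    · fin_cases p
      · rcases ht with rfl | rfl
        · exact absurd hjt hA.1
        · exact absurd hjt hA.2
      · rcases ht with rfl | rfl
        · exact ⟨rfl, rfl⟩
        · exact absurd hjt hB
      · exact absurd rfl h2
      · exact absurd rfl h3
  obtain ⟨s₃, b, d', L, R, hs₃, hb, hd', hL, hR, h', hcost⟩ := h.exists_triangle
    (C := .inr 2) (d := .inr 3) (by simp) hC hd hs₁ (by
      intro j k hj2 hj3 hk2 hk3 t u ht hu hjt hku
      obtain ⟨rfl, rfl⟩ := hB' j hj2 hj3 t ht hjt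
      obtain ⟨rfl, rfl⟩ := hB' k hk2 hk3 u hu hku
      exact ⟨rfl, rfl⟩)
  let g : O ⊕ Fin 7 → Option (Option (Option (O ⊕ Fin 4))) :=
    Sum.elim (fun o => some (some (some (.inl o))))
      ![some (some (some (.inr 0))), some (some (some (.inr 1))), some (some (some (.inr 2))), none,
        some (some none), some (some (some (.inr 3))), some none]
  have hg : Function.Injective g := by
    rintro (o | p) (o' | q) h
    · simpa [g] using h
    · fin_cases q <;> simp [g] at h
    · fin_cases p <;> simp [g] at h
    · fin_cases p <;> fin_cases q <;> first | rfl | simp [g] at h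
  have hupd : ∀ j : O ⊕ Fin 4, j ≠ .inr 3 → Function.update c (.inr 3) d' j = c j := fun j hj =>
    Function.update_of_ne hj _ _
  refine ⟨s₃, _, hs₃, h'.comp hg, fun o => hupd (.inl o) (by simp), hupd (.inr 0) (by simp),
    hupd (.inr 1) (by simp), hupd (.inr 2) (by simp), hL, hb, ?_, hR, fun w₀ w₁ w₂ k => ?_⟩
  · change IsArc (Function.update c (.inr 3) d' (.inr 3)) s₃ t
    rwa [Function.update_self]
  · refine le_trans (le_trans (le_of_eq ?_) (cost_comp_le hg))
      ((hcost (Sum.elim (fun _ => 1) ![w₀, w₁, w₂, 1]) k).trans (le_of_eq ?_))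
    · congr 1
      funext i
      rcases i with o | p
      · rfl
      · fin_cases p <;> rfl
    · congr 1
      funext i
      rcases i with o | p
      · rfl
      · fin_cases p <;> rfl

/-- The first special curve is subdivided by a new point `p` near its first end. The short part `u`
can have any weight. -/
theorem Pic.exists_subdivision_first {c : O ⊕ Fin 3 → ℝ → Plane} (h : Pic P c) {x y : Plane}
    (hA : IsArc (c (.inr 0)) x y) :
    ∃ p u v, p ∉ P ∧ IsArc u x p ∧ IsArc v p y ∧
      Pic (insert p P) (Sum.elim (fun o => c (.inl o)) ![v, c (.inr 1), u, c (.inr 2)]) ∧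
      Pic (insert p P) (Sum.elim (fun o => c (.inl o)) ![u, c (.inr 1), v, c (.inr 2)]) ∧
      (∀ m w₀ w₁ w₂, cost (Sum.elim (fun _ => 1) ![w₀, w₁, m, w₂])
          (Sum.elim (fun o => c (.inl o)) ![v, c (.inr 1), u, c (.inr 2)]) ≤
        cost (Sum.elim (fun _ => 1) ![w₀, w₁, w₂]) c) ∧
      ∀ m w₀ w₁ w₂, cost (Sum.elim (fun _ => 1) ![m, w₁, w₀, w₂])
          (Sum.elim (fun o => c (.inl o)) ![u, c (.inr 1), v, c (.inr 2)]) ≤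
        cost (Sum.elim (fun _ => 1) ![w₀, w₁, w₂]) c := by
  classical
  obtain ⟨p, u, v, hp, -, hu, hv, -, hvA, huv, hui, h'⟩ := h.exists_subdivision hA
  have hcost : ∀ (W : O ⊕ Fin 3 → ℕ) (m : ℕ), cost (fun o : Option (O ⊕ Fin 3) => o.elim m W)
      (fun o : Option (O ⊕ Fin 3) => o.elim u (Function.update c (.inr 0) v)) ≤ cost W c := by
    intro W m
    rw [cost_option_of_disjoint]
    · exact h.cost_update_le hvA
    · intro i
      by_cases hi : i = .inr 0
      · rw [hi, Function.update_self]; exact huv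
      · rw [Function.update_of_ne hi]; exact hui i hi
  have hupd : ∀ j : O ⊕ Fin 3, j ≠ .inr 0 → Function.update c (.inr 0) v j = c j := fun j hj =>
    Function.update_of_ne hj _ _
  have hself : Function.update c (.inr 0) v (.inr 0) = v := Function.update_self _ _ _
  let g : O ⊕ Fin 4 → Option (O ⊕ Fin 3) :=
    Sum.elim (fun o => some (.inl o)) ![some (.inr 0), some (.inr 1), none, some (.inr 2)]
  let g' : O ⊕ Fin 4 → Option (O ⊕ Fin 3) :=
    Sum.elim (fun o => some (.inl o)) ![none, some (.inr 1), some (.inr 0), some (.inr 2)]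
  have hg : Function.Injective g := by
    rintro (o | p) (o' | q) h
    · simpa [g] using h
    · fin_cases q <;> simp [g] at h
    · fin_cases p <;> simp [g] at h
    · fin_cases p <;> fin_cases q <;> first | rfl | simp [g] at h
  have hg' : Function.Injective g' := by
    rintro (o | p) (o' | q) h
    · simpa [g'] using h
    · fin_cases q <;> simp [g'] at h
    · fin_cases p <;> simp [g'] at h
    · fin_cases p <;> fin_cases q <;> first | rfl | simp [g'] at h
  have e : (fun k => (g k).elim u (Function.update c (.inr 0) v)) =
      Sum.elim (fun o => c (.inl o)) ![v, c (.inr 1), u, c (.inr 2)] := by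
    funext i
    rcases i with o | p
    · exact hupd (.inl o) (by simp)
    · fin_cases p
      exacts [hself, hupd (.inr 1) (by simp), rfl, hupd (.inr 2) (by simp)]
  have e' : (fun k => (g' k).elim u (Function.update c (.inr 0) v)) =
      Sum.elim (fun o => c (.inl o)) ![u, c (.inr 1), v, c (.inr 2)] := by
    funext i
    rcases i with o | p
    · exact hupd (.inl o) (by simp)
    · fin_cases p
      exacts [rfl, hupd (.inr 1) (by simp), hself, hupd (.inr 2) (by simp)]
  refine ⟨p, u, v, hp, hu, hv, e ▸ h'.comp hg, e' ▸ h'.comp hg', fun m w₀ w₁ w₂ => ?_,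
    fun m w₀ w₁ w₂ => ?_⟩
  · rw [← e]
    refine le_trans (le_trans (le_of_eq ?_) (cost_comp_le hg))
      (hcost (Sum.elim (fun _ => 1) ![w₀, w₁, w₂]) m)
    congr 1
    funext i
    rcases i with o | p
    · rfl
    · fin_cases p <;> rfl
  · rw [← e']
    refine le_trans (le_trans (le_of_eq ?_) (cost_comp_le hg'))
      (hcost (Sum.elim (fun _ => 1) ![w₀, w₁, w₂]) m)
    congr 1
    funext i
    rcases i with o | p
    · rfl
    · fin_cases p <;> rfl

/-- The triangle of an expansion without the edge from `s₃` to `t₃`: near its first end `s`, the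
first special curve is subdivided by `s₁`, the short part is doubled, and one of the two copies is
subdivided by `s₃`. -/
theorem Pic.exists_expansion_two {c : O ⊕ Fin 2 → ℝ → Plane} (h : Pic P c) {s t : Plane}
    (hA : IsArc (c (.inr 0)) s t) :
    ∃ (s₁ s₃ : Plane) (c' : O ⊕ Fin 5 → ℝ → Plane), s₁ ∉ P ∧ s₃ ∉ insert s₁ P ∧
      Pic (insert s₃ (insert s₁ P)) c' ∧ (∀ o, c' (.inl o) = c (.inl o)) ∧
      IsArc (c' (.inr 0)) s₁ t ∧ c' (.inr 1) = c (.inr 1) ∧ IsArc (c' (.inr 2)) s s₁ ∧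
      IsArc (c' (.inr 3)) s₃ s₁ ∧ IsArc (c' (.inr 4)) s s₃ ∧
      ∀ w₀ w₁ w₂ w₃ w₄, cost (Sum.elim (fun _ => 1) ![w₀, w₁, w₂, w₃, w₄]) c' ≤
        cost (Sum.elim (fun _ => 1) ![w₀, w₁]) c := by
  classical
  obtain ⟨s₁, u, v, hs₁, -, hu, hv, -, hvA, huv, hui, h₁⟩ := h.exists_subdivision hA
  have hs : s ∈ P := hA.left ▸ h.left_mem _
  set c₁ := Function.update c (.inr 0) v with hc₁
  have e0 : c₁ (.inr 0) = v := Function.update_self _ _ _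
  have e : ∀ j, j ≠ .inr 0 → c₁ j = c j := fun j hj => Function.update_of_ne hj _ _
  have hu₁ : ∀ j, Disjoint (u '' Ioo 0 1) (c₁ j '' Ioo 0 1) := fun j => by
    by_cases hj : j = .inr 0
    · rw [hj, e0]; exact huv
    · rw [e j hj]; exact hui j hj
  obtain ⟨L, R, hL, -, h₂, hLu, -, -, hLR⟩ := h₁.exists_two_sided {none} hu (ts := 0)
    ⟨le_rfl, one_pos⟩ (mem_insert_of_mem _ hs) (mem_insert _ _)
    (by rw [hu.left]; exact mem_insert_of_mem _ hs) (fun p hp _ => ⟨none, rfl, hp⟩)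
    (by rintro _ rfl; exact subset_rfl) fun h0 => absurd h0 (by rw [hu.left]; exact hu.left_notMem)
  have h₃ := h₂.comp (f := fun o : Option (Option (O ⊕ Fin 2)) => o.elim none fun o => some (some o))
    (by rintro (_ | i) (_ | j) hij <;> simp_all)
  have hL₁ : ∀ j, Disjoint (L '' Ioo 0 1) (c₁ j '' Ioo 0 1) := fun j => by
    have hle := hLR (some j) (by simp)
    simp only [Option.elim_some, disjoint_iff_inter_eq_empty.1 (hu₁ j), ncard_empty, mul_zero] at hle
    have hfin : (L '' Ioo 0 1 ∩ c₁ j '' Ioo 0 1).Finite :=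
      h₂.finite none (some (some (some j))) (by simp)
    rw [disjoint_iff_inter_eq_empty, ← ncard_eq_zero hfin]
    exact Nat.le_zero.1 ((Nat.le_add_right _ _).trans hle)
  have hLu' : Disjoint (L '' Ioo 0 1) (u '' Ioo 0 1) :=
    hLu.mono_right (image_mono Ioo_subset_Icc_self)
  obtain ⟨s₃, b, a, hs₃, -, hb, ha, hbL, haL, hba, hbi, h₄⟩ := h₃.exists_subdivision (e := none) hL
  set c₂ : Option (Option (O ⊕ Fin 2)) → ℝ → Plane := fun o => o.elim a fun o => o.elim u c₁ with hc₂
  have e₂ : Function.update (fun k : Option (Option (O ⊕ Fin 2)) =>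
      ((k.elim none fun o => some (some o) : Option (Option (Option (O ⊕ Fin 2))))).elim L fun o =>
        o.elim R fun o => o.elim u c₁) none a = c₂ := by
    funext o
    rcases o with _ | o
    · exact Function.update_self _ _ _
    · exact Function.update_of_ne (by simp) _ _
  rw [e₂] at h₄
  let g : O ⊕ Fin 5 → Option (Option (Option (O ⊕ Fin 2))) :=
    Sum.elim (fun o => some (some (some (.inl o)))) ![some (some (some (.inr 0))),
      some (some (some (.inr 1))), some (some none), some none, none]
  have hg : Function.Injective g := by
    rintro (o | p) (o' | q) h
    · simpa [g] using h
    · fin_cases q <;> simp [g] at h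
    · fin_cases p <;> simp [g] at h
    · fin_cases p <;> fin_cases q <;> first | rfl | simp [g] at h
  refine ⟨s₁, s₃, _, hs₁, hs₃, h₄.comp hg, fun o => e (.inl o) (by simp), ?_, e (.inr 1) (by simp), hu, ha,
    hb, fun w₀ w₁ w₂ w₃ w₄ => ?_⟩
  · change IsArc (c₁ (.inr 0)) s₁ t
    rwa [e0]
  · have hcost : cost (fun o : Option (Option (Option (O ⊕ Fin 2))) => o.elim w₄ fun o => o.elim w₃
        fun o => o.elim w₂ (Sum.elim (fun _ => 1) ![w₀, w₁])) (fun o => o.elim b c₂) ≤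
        cost (Sum.elim (fun _ => 1) ![w₀, w₁]) c := by
      rw [cost_option_of_disjoint, cost_option_of_disjoint, cost_option_of_disjoint _ hu₁]
      · exact h.cost_update_le hvA
      · rintro (_ | j)
        · exact hLu'.mono_left haL
        · exact (hL₁ j).mono_left haL
      · rintro (_ | _ | j)
        · exact hba
        · exact hLu'.mono_left hbL
        · exact (hL₁ j).mono_left hbL
    refine le_trans (le_trans (le_of_eq ?_) (cost_comp_le hg)) hcost
    congr 1
    funext i
    rcases i with o | p
    · rfl
    · fin_cases p <;> rfl

end

/-! ### Drawing subgraphs of an expansion -/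

section

open Graph

section
variable {α β : Type*} {G : Graph α β} {s t₁ t₂ t₃ : α} (hs : G.IsExpandable s t₁ t₂ t₃)

theorem newLeft_ne_newRight (p : Fin 6) : newLeft α p ≠ newRight t₁ t₂ t₃ p := by
  fin_cases p <;> simp [newLeft, newRight]

/-- A subgraph `H` of the expansion can be drawn along a family of curves joining the right points,
where the bunches of new edges may be further subdivided into bunches `F p`. -/
theorem crossingNumber_lt_of_le_expansion (hE : G.edgeSet.Finite) {H : Graph (α ⊕ NewVertex) (β ⊕ NewEdge)}
    (hH : H ≤ G.expansion s t₁ t₂ t₃ hs) {O : Set β} [Fintype O]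
    (hO : ∀ e, .inl e ∈ H.edgeSet → e ∈ O) {x y : O → α}
    (hxy : ∀ o : O, G.IsLink o (x o) (y o) ∧ x o ≠ s ∧ y o ≠ s) {pos : α ⊕ NewVertex → Plane}
    (hpos : InjOn pos (G.expansion s t₁ t₂ t₃ hs).vertexSet) {P : Set Plane}
    (hP : pos '' (G.expansion s t₁ t₂ t₃ hs).vertexSet ⊆ P) {n : ℕ} {c : O ⊕ Fin n → ℝ → Plane}
    (h : Pic P c) (hx : ∀ o, c (.inl o) 0 = pos (.inl (x o)))
    (hy : ∀ o, c (.inl o) 1 = pos (.inl (y o))) (q : Fin n → Fin 6)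
    (hq : ∀ p, s(c (.inr p) 0, c (.inr p) 1) =
      s(pos (newLeft α (q p)), pos (newRight t₁ t₂ t₃ (q p))))
    {F : Fin n → Set (β ⊕ NewEdge)} (hF : ∀ p, F p ⊆ newBunch (q p))
    (hcov : ∀ p, ∀ e ∈ newBunch p, e ∈ H.edgeSet → ∃ p', e ∈ F p') {w : Fin n → ℕ}
    (hw : ∀ p, (F p ∩ H.edgeSet).ncard ≤ w p) {m : ℕ} (hm : cost (Sum.elim (fun _ => 1) w) c < 2 * m) :
    H.crossingNumber < m := by
  have hHE := Graph.IsSubgraph.edgeSet_mono hH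
  refine crossingNumber_lt ((finite_edgeSet_expansion hs hE).subset hHE)
    (hpos.mono hH.vertexSet_mono) h ((image_mono hH.vertexSet_mono).trans hP)
    (Sum.elim (fun o => {.inl (o : β)}) F) ?_
    (Sum.elim (fun o => .inl (x o)) fun p => newLeft α (q p))
    (Sum.elim (fun o => .inl (y o)) fun p => newRight t₁ t₂ t₃ (q p)) ?_ ?_ _ ?_ ?_ hm
  · rintro (e | n) he
    · exact ⟨.inl ⟨e, hO e he⟩, rfl⟩
    · obtain ⟨p, hp⟩ := exists_mem_newBunch n
      obtain ⟨p', hp'⟩ := hcov p _ hp he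
      exact ⟨.inr p', hp'⟩
  · rintro (o | p) e he heH
    · obtain rfl := he
      exact (Graph.IsSubgraph.isLink_iff hH heH).2
        (isLink_expansion_inl hs (hxy o).1 (hxy o).2.1 (hxy o).2.2)
    · exact (Graph.IsSubgraph.isLink_iff hH heH).2 (isLink_newBunch hs _ (hF p he))
  · rintro (o | p)
    · exact congrArg₂ Sym2.mk (hx o) (hy o)
    · exact hq p
  · rintro (o | p)
    · exact (ncard_le_ncard inter_subset_left (finite_singleton _)).trans (ncard_singleton _).le
    · exact hw p
  · rintro (o | p)
    · exact Or.inl le_rfl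
    · right
      have hne : pos (newLeft α (q p)) ≠ pos (newRight t₁ t₂ t₃ (q p)) := by
        obtain ⟨e, he⟩ : (newBunch (q p) : Set (β ⊕ NewEdge)).Nonempty := by
          refine nonempty_of_ncard_ne_zero ?_
          rw [ncard_newBunch]
          generalize q p = r
          revert r
          decide
        have hl := isLink_newBunch hs _ he
        exact fun heq => newLeft_ne_newRight (q p) (hpos hl.left_mem hl.right_mem heq)
      intro heq
      rcases Sym2.eq_iff.1 (hq p) with ⟨h0, h1⟩ | ⟨h0, h1⟩
      · exact hne (by rw [← h0, ← h1, heq])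
      · exact hne (by rw [← h0, ← h1, heq])

/-- The positions of the vertices of an expansion, where the old vertices stay in place and the new
vertices are placed by `z`. -/
theorem injOn_expansion {pos : α → Plane} (hpos : InjOn pos G.vertexSet) {z : NewVertex → Plane}
    (hz : Function.Injective z) (hzpos : ∀ v, ∀ x ∈ G.vertexSet, x ≠ s → pos x ≠ z v) :
    InjOn (Sum.elim pos z) (G.expansion s t₁ t₂ t₃ hs).vertexSet := by
  rintro (u | u) hu (v | v) hv huv
  · rw [inl_mem_vertexSet_expansion] at hu hv
    exact congrArg _ (hpos hu.1 hv.1 huv)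
  · rw [inl_mem_vertexSet_expansion] at hu
    exact absurd huv (hzpos v u hu.1 hu.2)
  · rw [inl_mem_vertexSet_expansion] at hv
    exact absurd huv.symm (hzpos u v hv.1 hv.2)
  · exact congrArg _ (hz huv)

/-- If an edge `f` of a critical graph is deleted, the remaining edges at `s` can be bundled. -/
theorem exists_pic_of_critical (hV : G.vertexSet.Finite) (hE : G.edgeSet.Finite) {m : ℕ}
    (hG : G.IsCrossingCritical m) {f : β} (hf : f ∈ G.edgeSet) {O : Set β} [Fintype O]
    (hO : O = {e | (e ∈ G.edgeSet ∧ ¬ G.Inc e s) ∧ e ≠ f}) {x y : O → α}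
    (hxy : ∀ o : O, G.IsLink o (x o) (y o)) {n : ℕ} {F : Fin n → Set β}
    (hF : ∀ e, G.Inc e s → e ≠ f → ∃ p, e ∈ F p) (hFf : ∀ p, ∀ e ∈ F p, G.Inc e s ∧ e ≠ f)
    (hdisj : ∀ p q, p ≠ q → Disjoint (F p) (F q)) {a b : Fin n → α}
    (hlink : ∀ p, ∀ e ∈ F p, G.IsLink e (a p) (b p)) {w : Fin n → ℕ} (hw : ∀ p, w p ≤ (F p).ncard)
    (hw0 : ∀ p, 0 < w p) :
    ∃ (pos : α → Plane) (c : O ⊕ Fin n → ℝ → Plane), InjOn pos G.vertexSet ∧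
      Pic (pos '' G.vertexSet) c ∧ (∀ o, c (.inl o) 0 = pos (x o)) ∧
      (∀ o, c (.inl o) 1 = pos (y o)) ∧ (∀ p, c (.inr p) 0 = pos (a p)) ∧
      (∀ p, c (.inr p) 1 = pos (b p)) ∧ cost (Sum.elim (fun _ => 1) w) c < 2 * m := by
  have hlt : G.deleteEdges {f} < G := by
    refine lt_of_le_of_ne deleteEdges_le fun heq => ?_
    have : f ∈ (G.deleteEdges {f}).edgeSet := heq.symm ▸ hf
    simp at this
  have hlink' : ∀ {e u v}, G.IsLink e u v → e ≠ f → (G.deleteEdges {f}).IsLink e u v :=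
    fun hl hef => by simpa using ⟨hl, hef⟩
  have hVeq : (G.deleteEdges {f}).vertexSet = G.vertexSet := by simp
  obtain ⟨pos, c, hpos, h, h0, h1, hcost⟩ := exists_pic_of_crossingNumber_lt (ι := O ⊕ Fin n)
    (by rw [hVeq]; exact hV) (hE.subset (Graph.IsSubgraph.edgeSet_mono hlt.le)) (hG.2 _ hlt)
    (Sum.elim (fun o => {(o : β)}) F) (by
      intro e he
      simp only [edgeSet_deleteEdges, mem_sdiff, mem_singleton_iff] at he
      by_cases hes : G.Inc e s
      · obtain ⟨p, hp⟩ := hF e hes he.2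
        exact ⟨.inr p, hp⟩
      · exact ⟨.inl ⟨e, by rw [hO]; exact ⟨⟨he.1, hes⟩, he.2⟩⟩, rfl⟩) (by
      have hOF : ∀ (o : O) p, (o : β) ∉ F p := fun o p hp => by
        have : (o : β) ∈ {e | (e ∈ G.edgeSet ∧ ¬ G.Inc e s) ∧ e ≠ f} := hO ▸ o.2
        exact this.1.2 (hFf p o hp).1
      rintro (o | p) (o' | q) hij
      · simpa [Subtype.ext_iff] using hij
      · simpa using hOF o q
      · simpa using hOF o' p
      · exact hdisj p q fun h => hij (by rw [h]))
    (Sum.elim x a) (Sum.elim y b) (by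
      rintro (o | p) e he heE
      · obtain rfl := he
        have : (o : β) ∈ {e | (e ∈ G.edgeSet ∧ ¬ G.Inc e s) ∧ e ≠ f} := hO ▸ o.2
        exact hlink' (hxy o) this.2
      · exact hlink' (hlink p e he) (hFf p e he).2)
    (Sum.elim (fun _ => 1) w) (by
      rintro (o | p)
      · have : (o : β) ∈ {e | (e ∈ G.edgeSet ∧ ¬ G.Inc e s) ∧ e ≠ f} := hO ▸ o.2
        have : ({(o : β)} ∩ (G.deleteEdges {f}).edgeSet) = {(o : β)} := by
          rw [inter_eq_left, singleton_subset_iff]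
          exact (hlink' (hxy o) this.2).edge_mem
        change 1 ≤ ({(o : β)} ∩ (G.deleteEdges {f}).edgeSet).ncard
        rw [this, ncard_singleton]
      · have : (F p ∩ (G.deleteEdges {f}).edgeSet) = F p := by
          rw [inter_eq_left]
          exact fun e he => (hlink' (hlink p e he) (hFf p e he).2).edge_mem
        change w p ≤ (F p ∩ (G.deleteEdges {f}).edgeSet).ncard
        rw [this]
        exact hw p)
    (by
      rintro (o | p)
      · exact one_pos
      · exact hw0 p)
  rw [hVeq] at hpos h
  exact ⟨pos, c, hpos, h, fun o => h0 (.inl o), fun o => h1 (.inl o), fun p => h0 (.inr p),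
    fun p => h1 (.inr p), hcost⟩

/-- Deleting an isolated vertex does not change the crossing number: it can be put back anywhere. -/
theorem crossingNumber_le_deleteVerts (hV : G.vertexSet.Finite) (hE : G.edgeSet.Finite) {v : α}
    (hv : ∀ e, ¬ G.Inc e v) : G.crossingNumber ≤ (G.deleteVerts {v}).crossingNumber := by
  classical
  refine le_iInf fun D => ?_
  have hlink : ∀ {e x y}, G.IsLink e x y → (G.deleteVerts {v}).IsLink e x y := fun {e x y} hl => by
    rw [deleteVerts_isLink]
    refine ⟨hl, ?_, ?_⟩
    · rintro rfl
      exact hv e hl.inc_left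
    · rintro rfl
      exact hv e hl.inc_right
  have hedge : ∀ {e}, e ∈ G.edgeSet → e ∈ (G.deleteVerts {v}).edgeSet := fun he => by
    obtain ⟨x, y, hl⟩ := exists_isLink_of_mem_edgeSet he
    exact (hlink hl).edge_mem
  have hcpt : IsCompact ((⋃ e ∈ G.edgeSet, D.curve e '' Icc 0 1) ∪ D.pos '' G.vertexSet) :=
    (hE.isCompact_biUnion fun e he => IsPolygonal.isCompact_image (D.polygonal e (hedge he))).union
      (hV.image _).isCompact
  obtain ⟨z, hz⟩ : ∃ z, z ∉ (⋃ e ∈ G.edgeSet, D.curve e '' Icc 0 1) ∪ D.pos '' G.vertexSet := by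
    by_contra! hall
    exact hcpt.ne_univ (eq_univ_of_forall hall)
  have hpos : ∀ {x}, x ≠ v → Function.update D.pos v z x = D.pos x := fun hx =>
    Function.update_of_ne hx _ _
  have hmem : ∀ {x}, x ∈ G.vertexSet → x ≠ v → x ∈ (G.deleteVerts {v}).vertexSet := fun hx hxv => by
    simpa using ⟨hx, hxv⟩
  let D' : G.Drawing :=
    { pos := Function.update D.pos v z
      curve := D.curve
      pos_injOn := by
        have hzx : ∀ {x}, x ∈ G.vertexSet → D.pos x ≠ z := fun hx he =>
          hz (Or.inr ⟨_, hx, he⟩)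
        intro x hx y hy hxy
        by_cases hxv : x = v
        · by_cases hyv : y = v
          · rw [hxv, hyv]
          · rw [hxv, Function.update_self, hpos hyv] at hxy
            exact absurd hxy.symm (hzx hy)
        · by_cases hyv : y = v
          · rw [hyv, Function.update_self, hpos hxv] at hxy
            exact absurd hxy (hzx hx)
          · rw [hpos hxv, hpos hyv] at hxy
            exact D.pos_injOn (hmem hx hxv) (hmem hy hyv) hxy
      polygonal := fun e he => D.polygonal e (hedge he)
      joins := fun e he => by
        obtain ⟨x, y, hl, h0, h1⟩ := D.joins e (hedge he)
        rw [deleteVerts_isLink] at hl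
        refine ⟨x, y, hl.1, ?_, ?_⟩
        · rw [hpos hl.2.1, h0]
        · rw [hpos hl.2.2, h1]
      simple := fun e he => D.simple e (hedge he)
      avoids := fun e he x hx hxe => by
        by_cases hxv : x = v
        · rw [hxv, Function.update_self] at hxe
          refine hz (Or.inl ?_)
          simp only [mem_iUnion]
          exact ⟨e, he, image_mono Ioo_subset_Icc_self hxe⟩
        · rw [hpos hxv] at hxe
          exact D.avoids e (hedge he) x (hmem hx hxv) hxe
      no_triple := fun e he f hf g hg => D.no_triple e (hedge he) f (hedge hf) g (hedge hg) }
  refine (iInf_le _ D').trans (encard_le_encard ?_)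
  rintro p ⟨e, he, f, hf, hef, hp⟩
  exact ⟨e, hedge he, f, hedge hf, hef, hp⟩

end

end

/-! ### Placing the new vertices -/

section

open Graph

theorem newVertex_cases {v₁ v₂ : NewVertex} (h₁₂ : v₁ ≠ v₂) (h₁₃ : v₁ ≠ .s3) (h₂₃ : v₂ ≠ .s3)
    (v : NewVertex) : v = v₁ ∨ v = v₂ ∨ v = .s3 := by
  rcases v with _ | _ | _ <;> rcases v₁ with _ | _ | _ <;> rcases v₂ with _ | _ | _ <;> simp_all

section
variable {α β : Type*} {G : Graph α β} {s t₁ t₂ t₃ : α} (hs : G.IsExpandable s t₁ t₂ t₃)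

/-- The last step of the construction of a drawing of a subgraph `H` of the expansion: the new
vertex `v₁` is placed at the point `s₁` on the thick edge `s tₐ`, the new vertex `v₂` at the place of
`s`, and the triangle is drawn as in `Pic.exists_expansion`. -/
theorem crossingNumber_lt_of_pic (hE : G.edgeSet.Finite) {H : Graph (α ⊕ NewVertex) (β ⊕ NewEdge)}
    (hH : H ≤ G.expansion s t₁ t₂ t₃ hs) {O : Set β} [Fintype O]
    (hO : ∀ e, .inl e ∈ H.edgeSet → e ∈ O) {x y : O → α}
    (hxy : ∀ o : O, G.IsLink o (x o) (y o) ∧ x o ≠ s ∧ y o ≠ s) {pos : α → Plane}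
    (hpos : InjOn pos G.vertexSet) {s₁ : Plane} (hs₁ : s₁ ∉ pos '' G.vertexSet)
    {c : O ⊕ Fin 4 → ℝ → Plane} (h : Pic (insert s₁ (pos '' G.vertexSet)) c)
    (hx : ∀ o, c (.inl o) 0 = pos (x o)) (hy : ∀ o, c (.inl o) 1 = pos (y o)) {ta tb : α}
    (ha : ta ∈ G.vertexSet \ {s}) (hb : tb ∈ G.vertexSet \ {s}) (h₃ : t₃ ∈ G.vertexSet \ {s})
    (hsV : s ∈ G.vertexSet) (hA : s(c (.inr 0) 0, c (.inr 0) 1) = s(s₁, pos ta))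
    (hB0 : c (.inr 1) 0 = pos s) (hB1 : c (.inr 1) 1 = pos tb)
    (hC : ∃ γ, IsArc γ (pos s) s₁ ∧ γ '' Ioo 0 1 = c (.inr 2) '' Ioo 0 1)
    (hC' : s(c (.inr 2) 0, c (.inr 2) 1) = s(pos s, s₁))
    (hd0 : c (.inr 3) 0 = pos s) (hd1 : c (.inr 3) 1 = pos t₃) {v₁ v₂ : NewVertex}
    (h₁₂ : v₁ ≠ v₂) (h₁₃ : v₁ ≠ .s3) (h₂₃ : v₂ ≠ .s3) {q : Fin 7 → Fin 6}
    (hq : ∀ p, s(newLeft α (q p), newRight t₁ t₂ t₃ (q p)) =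
      ![s(.inr v₁, .inl ta), s(.inr v₂, .inl tb), s(.inr v₂, .inr v₁), s(.inr .s3, .inr v₁),
        s(.inr v₂, .inr .s3), s(.inr .s3, .inl t₃), s(.inr v₂, .inr v₁)] p)
    {F : Fin 7 → Set (β ⊕ NewEdge)} (hF : ∀ p, F p ⊆ newBunch (q p))
    (hcov : ∀ p, ∀ e ∈ newBunch p, e ∈ H.edgeSet → ∃ p', e ∈ F p') {w₀ w₁ w₂ k : ℕ}
    (hw : ∀ p, (F p ∩ H.edgeSet).ncard ≤ ![w₀, w₁, w₂, k, 1, 1, k] p) {m : ℕ}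
    (hm : cost (Sum.elim (fun _ => 1) ![w₀, w₁, w₂ + 2 * k, 1]) c < 2 * m) :
    H.crossingNumber < m := by
  classical
  have hne : ∀ {u}, u ∈ G.vertexSet → u ≠ s → pos u ≠ pos s := fun hu hus he => hus (hpos hu hsV he)
  have hmem : ∀ {u}, u ∈ G.vertexSet → pos u ∈ pos '' G.vertexSet := fun hu => mem_image_of_mem _ hu
  have hs₁s : s₁ ≠ pos s := fun he => hs₁ (he ▸ hmem hsV)
  obtain ⟨s₃, c', hs₃, h', hold, e0, e1, e2, a3, a4, a5, a6, hcost⟩ := h.exists_expansion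
    (s := pos s) (s₁ := s₁) (t := pos t₃) hC
    (by
      have := h.isArc (i := .inr 3) (by rw [hd0, hd1]; exact (hne h₃.1 h₃.2).symm)
      rwa [hd0, hd1] at this) (mem_insert _ _)
    (by
      rcases Sym2.eq_iff.1 hA with ⟨h0, h1⟩ | ⟨h0, h1⟩
      · rw [h0, h1]; exact ⟨hs₁s, hne ha.1 ha.2⟩
      · rw [h0, h1]; exact ⟨hne ha.1 ha.2, hs₁s⟩)
    (by rw [hB1]; exact hne hb.1 hb.2)
    (fun o => by
      rw [hx, hy]
      exact ⟨hne (hxy o).1.left_mem (hxy o).2.1, hne (hxy o).1.right_mem (hxy o).2.2⟩)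
  have hs₃₁ : s₃ ≠ s₁ := fun he => hs₃ (he ▸ mem_insert _ _)
  have hs₃V : ∀ {u}, u ∈ G.vertexSet → s₃ ≠ pos u := fun hu he =>
    hs₃ (he ▸ mem_insert_of_mem _ (hmem hu))
  have hcases := newVertex_cases h₁₂ h₁₃ h₂₃
  obtain ⟨z, z1, z2, z3⟩ : ∃ z : NewVertex → Plane, z v₁ = s₁ ∧ z v₂ = pos s ∧ z .s3 = s₃ :=
    ⟨fun v => if v = v₁ then s₁ else if v = v₂ then pos s else s₃, by simp, by simp [h₁₂.symm],
      by simp [h₁₃.symm, h₂₃.symm]⟩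
  have hz : Function.Injective z := by
    intro u v huv
    rcases hcases u with rfl | rfl | rfl <;> rcases hcases v with rfl | rfl | rfl
    · rfl
    · rw [z1, z2] at huv; exact absurd huv hs₁s
    · rw [z1, z3] at huv; exact absurd huv.symm hs₃₁
    · rw [z1, z2] at huv; exact absurd huv.symm hs₁s
    · rfl
    · rw [z2, z3] at huv; exact absurd huv.symm (hs₃V hsV)
    · rw [z1, z3] at huv; exact absurd huv hs₃₁
    · rw [z2, z3] at huv; exact absurd huv (hs₃V hsV)
    · rfl
  refine crossingNumber_lt_of_le_expansion hs hE hH hO hxy (pos := Sum.elim pos z)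
    (injOn_expansion hs hpos hz ?_) ?_ h' (fun o => by rw [hold, hx]; rfl)
    (fun o => by rw [hold, hy]; rfl) q ?_ hF hcov hw ((hcost w₀ w₁ w₂ k).trans_lt hm)
  · intro v u hu hus
    rcases hcases v with rfl | rfl | rfl
    · rw [z1]; exact fun he => hs₁ (he ▸ hmem hu)
    · rw [z2]; exact hne hu hus
    · rw [z3]; exact (hs₃V hu).symm
  · rintro _ ⟨u | v, hu, rfl⟩
    · rw [inl_mem_vertexSet_expansion] at hu
      exact mem_insert_of_mem _ (mem_insert_of_mem _ (hmem hu.1))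
    · change z v ∈ _
      rcases hcases v with rfl | rfl | rfl
      · rw [z1]; exact mem_insert_of_mem _ (mem_insert _ _)
      · rw [z2]; exact mem_insert_of_mem _ (mem_insert_of_mem _ (hmem hsV))
      · rw [z3]; exact mem_insert _ _
  · intro p
    have hmap := congrArg (Sym2.map (Sum.elim pos z)) (hq p)
    rw [Sym2.map_mk] at hmap
    rw [hmap]
    clear hmap
    fin_cases p
    · change s(c' (.inr 0) 0, c' (.inr 0) 1) = s(z v₁, pos ta)
      rw [e0, z1, hA]
    · change s(c' (.inr 1) 0, c' (.inr 1) 1) = s(z v₂, pos tb)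
      rw [e1, z2, hB0, hB1]
    · change s(c' (.inr 2) 0, c' (.inr 2) 1) = s(z v₂, z v₁)
      rw [e2, z1, z2, hC']
    · change s(c' (.inr 3) 0, c' (.inr 3) 1) = s(z .s3, z v₁)
      rw [z1, z3, a3.left, a3.right]
    · change s(c' (.inr 4) 0, c' (.inr 4) 1) = s(z v₂, z .s3)
      rw [z2, z3, a4.left, a4.right]
    · change s(c' (.inr 5) 0, c' (.inr 5) 1) = s(z .s3, pos t₃)
      rw [z3, a5.left, a5.right]
    · change s(c' (.inr 6) 0, c' (.inr 6) 1) = s(z v₂, z v₁)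
      rw [z1, z2, a6.left, a6.right]

end

end

/-! ### Deleting one edge of an expansion -/

section

open Graph

section
variable {α β : Type*} {G : Graph α β} {s t₁ t₂ t₃ : α} (hs : G.IsExpandable s t₁ t₂ t₃)

/-- Subgraphs of the expansion that lack an old edge or an edge of one of the two `4`-thick edges: a
drawing of `G` without an edge `f` is modified near `s`. -/
theorem crossingNumber_lt_of_near (hV : G.vertexSet.Finite) (hE : G.edgeSet.Finite) {m : ℕ}
    (hG : G.IsCrossingCritical m) {H : Graph (α ⊕ NewVertex) (β ⊕ NewEdge)}
    (hH : H ≤ G.expansion s t₁ t₂ t₃ hs) {F₁ F₂ F₃ : Set β} (h₁ : G.IsThickEdge 4 s t₁ F₁)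
    (h₂ : G.IsThickEdge 4 s t₂ F₂) (h₃ : G.IsThickEdge 1 s t₃ F₃) (d₁₂ : Disjoint F₁ F₂)
    (d₁₃ : Disjoint F₁ F₃) (d₂₃ : Disjoint F₂ F₃) (hinc : ∀ e, G.Inc e s ↔ e ∈ F₁ ∪ F₂ ∪ F₃) {f : β}
    (hf : f ∈ G.edgeSet) (hf₃ : f ∉ F₃) (hfH : .inl f ∉ H.edgeSet) {w₁ w₂ : ℕ} (hw₁0 : 0 < w₁)
    (hw₂0 : 0 < w₂) (hw₁ : w₁ ≤ (F₁ \ {f}).ncard) (hw₂ : w₂ ≤ (F₂ \ {f}).ncard)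
    (hH₁ : (newBunch 0 ∩ H.edgeSet).ncard ≤ w₁) (hH₂ : (newBunch 1 ∩ H.edgeSet).ncard ≤ w₂) :
    H.crossingNumber < m := by
  obtain ⟨O, hO⟩ : ∃ O : Set β, O = {e | (e ∈ G.edgeSet ∧ ¬ G.Inc e s) ∧ e ≠ f} := ⟨_, rfl⟩
  have := (hE.subset (show O ⊆ G.edgeSet by rw [hO]; exact fun e he => he.1.1)).fintype
  obtain ⟨x, y, hxy⟩ := exists_ends (G := G) (s := s) (O := O) fun e he => by
    rw [hO] at he; exact he.1
  have hcls : ∀ e, G.Inc e s ↔ e ∈ F₁ ∨ e ∈ F₂ ∨ e ∈ F₃ := fun e => by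
    rw [hinc]; simp [or_assoc]
  obtain ⟨pos, c, hpos, h, hx, hy, ha, hb, hcost⟩ := exists_pic_of_critical hV hE hG hf hO
    (fun o => (hxy o).1) (F := ![F₁ \ {f}, F₂ \ {f}, F₃]) (by
      intro e he hef
      rcases (hcls e).1 he with he | he | he
      exacts [⟨0, he, hef⟩, ⟨1, he, hef⟩, ⟨2, he⟩])
    (by
      intro p e he
      fin_cases p
      exacts [⟨(hcls e).2 (Or.inl he.1), he.2⟩, ⟨(hcls e).2 (Or.inr (Or.inl he.1)), he.2⟩,
        ⟨(hcls e).2 (Or.inr (Or.inr he)), fun hef => hf₃ (hef ▸ he)⟩])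
    (by
      have k₁₂ := d₁₂.mono (sdiff_subset (t := {f})) (sdiff_subset (t := {f}))
      have k₁₃ := d₁₃.mono_left (sdiff_subset (t := {f}))
      have k₂₃ := d₂₃.mono_left (sdiff_subset (t := {f}))
      intro p q hpq
      fin_cases p <;> fin_cases q
      exacts [absurd rfl hpq, k₁₂, k₁₃, k₁₂.symm, absurd rfl hpq, k₂₃, k₁₃.symm, k₂₃.symm,
        absurd rfl hpq])
    (a := fun _ => s) (b := ![t₁, t₂, t₃])
    (by
      intro p e he
      fin_cases p
      exacts [h₁.2.2 e he.1, h₂.2.2 e he.1, h₃.2.2 e he])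
    (w := ![w₁, w₂, 1])
    (by
      intro p
      fin_cases p
      exacts [hw₁, hw₂, (IsThickEdge.finite_and_ncard h₃).2.ge])
    (by
      intro p
      fin_cases p
      exacts [hw₁0, hw₂0, one_pos])
  have m₁ := h₁.right_mem (by norm_num)
  have m₂ := h₂.right_mem (by norm_num)
  have m₃ := h₃.right_mem (by norm_num)
  have hsV : s ∈ G.vertexSet := by
    obtain ⟨e, he⟩ : F₃.Nonempty := nonempty_of_ncard_ne_zero (by
      rw [(IsThickEdge.finite_and_ncard h₃).2]; exact one_ne_zero)
    exact (h₃.2.2 e he).left_mem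
  have b0 : c (.inr 0) 1 = pos t₁ := hb 0
  have b1 : c (.inr 1) 1 = pos t₂ := hb 1
  have b2 : c (.inr 2) 1 = pos t₃ := hb 2
  have hA : IsArc (c (.inr 0)) (pos s) (pos t₁) := by
    have := h.isArc (i := .inr 0) (by
      rw [ha, b0]
      exact fun he => m₁.2 (hpos hsV m₁.1 he).symm)
    rwa [ha, b0] at this
  obtain ⟨s₁, u, v, hs₁, hu, hv, h', -, hcost', -⟩ := h.exists_subdivision_first hA
  refine crossingNumber_lt_of_pic hs hE hH (O := O) ?_ hxy hpos hs₁ h' hx hy m₁ m₂ m₃ hsV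
    (congrArg₂ Sym2.mk hv.left hv.right) (ha 1) b1 ⟨u, hu, rfl⟩ (congrArg₂ Sym2.mk hu.left hu.right)
    (ha 2) b2 (v₁ := .s1) (v₂ := .s2) (by simp) (by simp) (by simp) (q := ![0, 1, 2, 3, 4, 5, 2]) ?_
    (F := ![newBunch 0, newBunch 1, newBunch 2, newBunch 3, newBunch 4, newBunch 5, ∅]) ?_ ?_
    (w₀ := w₁) (w₁ := w₂) (w₂ := 3) (k := 1) ?_ ((hcost' 5 w₁ w₂ 1).trans_lt hcost)
  · intro e he
    rw [hO]
    refine ⟨(inl_mem_edgeSet_expansion hs).1 (Graph.IsSubgraph.edgeSet_mono hH he), ?_⟩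
    rintro rfl
    exact hfH he
  · intro p
    fin_cases p <;> first | rfl | exact Sym2.eq_swap
  · intro p
    fin_cases p
    exacts [subset_rfl, subset_rfl, subset_rfl, subset_rfl, subset_rfl, subset_rfl, empty_subset _]
  · intro p e he _
    fin_cases p
    exacts [⟨0, he⟩, ⟨1, he⟩, ⟨2, he⟩, ⟨3, he⟩, ⟨4, he⟩, ⟨5, he⟩]
  · intro p
    fin_cases p
    exacts [hH₁, hH₂, ncard_newBunch_inter_le 2 _, ncard_newBunch_inter_le 3 _,
      ncard_newBunch_inter_le 4 _, ncard_newBunch_inter_le 5 _, by simp]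

/-- Subgraphs of the expansion that lack an edge of the triangle `s¹ s² s³`: in a drawing of `G`
without an edge `f` of the `4`-thick edge `s tₐ`, the vertex `s` is stretched along the remaining
three edges, so that the new vertex `v₁` lies near `tₐ`. The three edges become `m` edges `s¹s²`, and
if `k = 1` one edge on each side of them. -/
theorem crossingNumber_lt_of_far (hV : G.vertexSet.Finite) (hE : G.edgeSet.Finite) {n : ℕ}
    (hG : G.IsCrossingCritical n) {H : Graph (α ⊕ NewVertex) (β ⊕ NewEdge)}
    (hH : H ≤ G.expansion s t₁ t₂ t₃ hs) {ta tb : α} {Fa Fb F₃ : Set β}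
    (ha : G.IsThickEdge 4 s ta Fa) (hb : G.IsThickEdge 4 s tb Fb) (h₃ : G.IsThickEdge 1 s t₃ F₃)
    (dab : Disjoint Fa Fb) (da₃ : Disjoint Fa F₃) (db₃ : Disjoint Fb F₃)
    (hcls : ∀ e, G.Inc e s ↔ e ∈ Fa ∨ e ∈ Fb ∨ e ∈ F₃)
    {v₁ v₂ : NewVertex} (h₁₂ : v₁ ≠ v₂) (h₁₃ : v₁ ≠ .s3) (h₂₃ : v₂ ≠ .s3) {q : Fin 7 → Fin 6}
    (hq : ∀ p, s(newLeft α (q p), newRight t₁ t₂ t₃ (q p)) =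
      ![s(.inr v₁, .inl ta), s(.inr v₂, .inl tb), s(.inr v₂, .inr v₁), s(.inr .s3, .inr v₁),
        s(.inr v₂, .inr .s3), s(.inr .s3, .inl t₃), s(.inr v₂, .inr v₁)] p)
    {F : Fin 7 → Set (β ⊕ NewEdge)} (hF : ∀ p, F p ⊆ newBunch (q p))
    (hcov : ∀ p, ∀ e ∈ newBunch p, e ∈ H.edgeSet → ∃ p', e ∈ F p') {m k : ℕ} (hmk : m + 2 * k = 3)
    (hw : ∀ p, (F p ∩ H.edgeSet).ncard ≤ ![4, 4, m, k, 1, 1, k] p) :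
    H.crossingNumber < n := by
  obtain ⟨f, hfa⟩ : Fa.Nonempty := nonempty_of_ncard_ne_zero (by
    rw [(IsThickEdge.finite_and_ncard ha).2]; norm_num)
  have hf : f ∈ G.edgeSet := (ha.2.2 f hfa).edge_mem
  have hsV : s ∈ G.vertexSet := (ha.2.2 f hfa).left_mem
  obtain ⟨O, hO⟩ : ∃ O : Set β, O = {e | (e ∈ G.edgeSet ∧ ¬ G.Inc e s) ∧ e ≠ f} := ⟨_, rfl⟩
  have := (hE.subset (show O ⊆ G.edgeSet by rw [hO]; exact fun e he => he.1.1)).fintype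
  obtain ⟨x, y, hxy⟩ := exists_ends (G := G) (s := s) (O := O) fun e he => by
    rw [hO] at he; exact he.1
  obtain ⟨pos, c, hpos, h, hx, hy, hl, hr, hcost⟩ := exists_pic_of_critical hV hE hG hf hO
    (fun o => (hxy o).1) (F := ![Fa \ {f}, Fb, F₃]) (by
      intro e he hef
      rcases (hcls e).1 he with he | he | he
      exacts [⟨0, he, hef⟩, ⟨1, he⟩, ⟨2, he⟩])
    (by
      intro p e he
      fin_cases p
      exacts [⟨(hcls e).2 (Or.inl he.1), he.2⟩,
        ⟨(hcls e).2 (Or.inr (Or.inl he)), fun hef => disjoint_left.1 dab hfa (hef ▸ he)⟩,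
        ⟨(hcls e).2 (Or.inr (Or.inr he)), fun hef => disjoint_left.1 da₃ hfa (hef ▸ he)⟩])
    (by
      have k₁₂ := dab.mono_left (sdiff_subset (t := {f}))
      have k₁₃ := da₃.mono_left (sdiff_subset (t := {f}))
      intro p q hpq
      fin_cases p <;> fin_cases q
      exacts [absurd rfl hpq, k₁₂, k₁₃, k₁₂.symm, absurd rfl hpq, db₃, k₁₃.symm, db₃.symm,
        absurd rfl hpq])
    (a := ![ta, s, s]) (b := ![s, tb, t₃])
    (by
      intro p e he
      fin_cases p
      exacts [(ha.2.2 e he.1).symm, hb.2.2 e he, h₃.2.2 e he])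
    (w := ![3, 4, 1])
    (by
      intro p
      fin_cases p
      · change 3 ≤ (Fa \ {f}).ncard
        rw [ncard_sdiff_singleton_of_mem hfa, (IsThickEdge.finite_and_ncard ha).2]
      · exact (IsThickEdge.finite_and_ncard hb).2.ge
      · exact (IsThickEdge.finite_and_ncard h₃).2.ge)
    (by decide)
  have ma := ha.right_mem (by norm_num)
  have mb := hb.right_mem (by norm_num)
  have m₃ := h₃.right_mem (by norm_num)
  have l0 : c (.inr 0) 0 = pos ta := hl 0
  have r0 : c (.inr 0) 1 = pos s := hr 0
  have hA : IsArc (c (.inr 0)) (pos ta) (pos s) := by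
    have := h.isArc (i := .inr 0) (by
      rw [l0, r0]
      exact fun he => ma.2 (hpos ma.1 hsV he))
    rwa [l0, r0] at this
  obtain ⟨s₁, u, v, hs₁, hu, hv, -, h', -, hcost'⟩ := h.exists_subdivision_first hA
  have hcost'' : cost (Sum.elim (fun _ => 1) ![4, 4, m + 2 * k, 1])
      (Sum.elim (fun o => c (.inl o)) ![u, c (.inr 1), v, c (.inr 2)]) < 2 * n := by
    rw [hmk]
    exact (hcost' 4 3 4 1).trans_lt hcost
  refine crossingNumber_lt_of_pic hs hE hH (O := O) ?_ hxy hpos hs₁ h' hx hy ma mb m₃ hsV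
    ((congrArg₂ Sym2.mk hu.left hu.right).trans Sym2.eq_swap) (hl 1) (hr 1) hv.reverse
    ((congrArg₂ Sym2.mk hv.left hv.right).trans Sym2.eq_swap) (hl 2) (hr 2) h₁₂ h₁₃ h₂₃ hq hF hcov hw
    hcost''
  intro e he
  rw [hO]
  have he' := (inl_mem_edgeSet_expansion hs).1 (Graph.IsSubgraph.edgeSet_mono hH he)
  refine ⟨he', ?_⟩
  rintro rfl
  exact he'.2 ((hcls e).2 (Or.inl hfa))

/-- Subgraphs of the expansion that lack the edge `s³t₃`. -/
theorem crossingNumber_lt_of_s3t3 (hV : G.vertexSet.Finite) (hE : G.edgeSet.Finite) {m : ℕ}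
    (hG : G.IsCrossingCritical m) {H : Graph (α ⊕ NewVertex) (β ⊕ NewEdge)}
    (hH : H ≤ G.expansion s t₁ t₂ t₃ hs) {F₁ F₂ F₃ : Set β} (h₁ : G.IsThickEdge 4 s t₁ F₁)
    (h₂ : G.IsThickEdge 4 s t₂ F₂) (h₃ : G.IsThickEdge 1 s t₃ F₃) (d₁₂ : Disjoint F₁ F₂)
    (d₁₃ : Disjoint F₁ F₃) (d₂₃ : Disjoint F₂ F₃) (hinc : ∀ e, G.Inc e s ↔ e ∈ F₁ ∪ F₂ ∪ F₃)
    (hfH : .inr .s3t3 ∉ H.edgeSet) : H.crossingNumber < m := by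
  obtain ⟨f, hF₃⟩ : ∃ f, F₃ = {f} := ncard_eq_one.1 (IsThickEdge.finite_and_ncard h₃).2
  have hf₃ : f ∈ F₃ := hF₃ ▸ rfl
  have hf : f ∈ G.edgeSet := (h₃.2.2 f hf₃).edge_mem
  have hsV : s ∈ G.vertexSet := (h₃.2.2 f hf₃).left_mem
  obtain ⟨O, hO⟩ : ∃ O : Set β, O = {e | (e ∈ G.edgeSet ∧ ¬ G.Inc e s) ∧ e ≠ f} := ⟨_, rfl⟩
  have := (hE.subset (show O ⊆ G.edgeSet by rw [hO]; exact fun e he => he.1.1)).fintype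
  obtain ⟨x, y, hxy⟩ := exists_ends (G := G) (s := s) (O := O) fun e he => by
    rw [hO] at he; exact he.1
  have hcls : ∀ e, G.Inc e s ↔ e ∈ F₁ ∨ e ∈ F₂ ∨ e = f := fun e => by
    rw [hinc, hF₃, mem_union, mem_union, mem_singleton_iff, or_assoc]
  obtain ⟨pos, c, hpos, h, hx, hy, hl, hr, hcost⟩ := exists_pic_of_critical hV hE hG hf hO
    (fun o => (hxy o).1) (F := ![F₁, F₂]) (by
      intro e he hef
      rcases (hcls e).1 he with he | he | he
      exacts [⟨0, he⟩, ⟨1, he⟩, absurd he hef])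
    (by
      intro p e he
      fin_cases p
      exacts [⟨(hcls e).2 (Or.inl he), fun hef => disjoint_left.1 d₁₃ he (hef ▸ hf₃)⟩,
        ⟨(hcls e).2 (Or.inr (Or.inl he)), fun hef => disjoint_left.1 d₂₃ he (hef ▸ hf₃)⟩])
    (by
      intro p q hpq
      fin_cases p <;> fin_cases q
      exacts [absurd rfl hpq, d₁₂, d₁₂.symm, absurd rfl hpq])
    (a := fun _ => s) (b := ![t₁, t₂])
    (by
      intro p e he
      fin_cases p
      exacts [h₁.2.2 e he, h₂.2.2 e he])
    (w := ![4, 4])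
    (by
      intro p
      fin_cases p
      exacts [(IsThickEdge.finite_and_ncard h₁).2.ge, (IsThickEdge.finite_and_ncard h₂).2.ge])
    (by decide)
  have m₁ := h₁.right_mem (by norm_num)
  have m₂ := h₂.right_mem (by norm_num)
  have hmem : ∀ {u}, u ∈ G.vertexSet → pos u ∈ pos '' G.vertexSet := fun hu => mem_image_of_mem _ hu
  have r0 : c (.inr 0) 1 = pos t₁ := hr 0
  have r1 : c (.inr 1) 1 = pos t₂ := hr 1
  have hA : IsArc (c (.inr 0)) (pos s) (pos t₁) := by
    have := h.isArc (i := .inr 0) (by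
      rw [hl, r0]
      exact fun he => m₁.2 (hpos hsV m₁.1 he).symm)
    rwa [hl, r0] at this
  obtain ⟨s₁, s₃, c', hs₁, hs₃, h', hold, a0, e1, a2, a3, a4, hcost'⟩ := h.exists_expansion_two hA
  have hs₁V : ∀ {u}, u ∈ G.vertexSet → pos u ≠ s₁ := fun hu he => hs₁ (he ▸ hmem hu)
  have hs₃V : ∀ {u}, u ∈ G.vertexSet → pos u ≠ s₃ := fun hu he =>
    hs₃ (he ▸ mem_insert_of_mem _ (hmem hu))
  have hs₃₁ : s₃ ≠ s₁ := fun he => hs₃ (he ▸ mem_insert _ _)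
  obtain ⟨z, z1, z2, z3⟩ : ∃ z : NewVertex → Plane, z .s1 = s₁ ∧ z .s2 = pos s ∧ z .s3 = s₃ :=
    ⟨fun v => NewVertex.casesOn v s₁ (pos s) s₃, rfl, rfl, rfl⟩
  have hz : Function.Injective z := by
    have k₁ := hs₁V hsV
    have k₃ := hs₃V hsV
    rintro (_ | _ | _) (_ | _ | _) huv
    · rfl
    · rw [z1, z2] at huv; exact absurd huv.symm k₁
    · rw [z1, z3] at huv; exact absurd huv.symm hs₃₁
    · rw [z1, z2] at huv; exact absurd huv k₁
    · rfl
    · rw [z2, z3] at huv; exact absurd huv k₃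
    · rw [z1, z3] at huv; exact absurd huv hs₃₁
    · rw [z2, z3] at huv; exact absurd huv.symm k₃
    · rfl
  refine crossingNumber_lt_of_le_expansion hs hE hH (O := O) ?_ hxy (pos := Sum.elim pos z)
    (injOn_expansion hs hpos hz ?_) ?_ h' (fun o => by rw [hold, hx]; rfl)
    (fun o => by rw [hold, hy]; rfl) ![0, 1, 2, 3, 4] ?_ (F := ![newBunch 0, newBunch 1, newBunch 2,
      newBunch 3, newBunch 4]) ?_ ?_ (w := ![4, 4, 3, 1, 1]) ?_ ((hcost' 4 4 3 1 1).trans_lt hcost)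
  · intro e he
    rw [hO]
    have he' := (inl_mem_edgeSet_expansion hs).1 (Graph.IsSubgraph.edgeSet_mono hH he)
    refine ⟨he', ?_⟩
    rintro rfl
    exact he'.2 ((hcls e).2 (Or.inr (Or.inr rfl)))
  · rintro (_ | _ | _) u hu hus
    · rw [z1]; exact hs₁V hu
    · rw [z2]; exact fun he => hus (hpos hu hsV he)
    · rw [z3]; exact hs₃V hu
  · rintro _ ⟨u | v, hu, rfl⟩
    · rw [inl_mem_vertexSet_expansion] at hu
      exact mem_insert_of_mem _ (mem_insert_of_mem _ (hmem hu.1))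
    · change z v ∈ _
      rcases v with _ | _ | _
      · rw [z1]; exact mem_insert_of_mem _ (mem_insert _ _)
      · rw [z2]; exact mem_insert_of_mem _ (mem_insert_of_mem _ (hmem hsV))
      · rw [z3]; exact mem_insert _ _
  · intro p
    fin_cases p
    · change s(c' (.inr 0) 0, c' (.inr 0) 1) = s(z .s1, pos t₁)
      rw [z1, a0.left, a0.right]
    · change s(c' (.inr 1) 0, c' (.inr 1) 1) = s(z .s2, pos t₂)
      rw [e1, z2, hl, r1]
    · change s(c' (.inr 2) 0, c' (.inr 2) 1) = s(z .s1, z .s2)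
      rw [z1, z2, a2.left, a2.right, Sym2.eq_swap]
    · change s(c' (.inr 3) 0, c' (.inr 3) 1) = s(z .s3, z .s1)
      rw [z1, z3, a3.left, a3.right]
    · change s(c' (.inr 4) 0, c' (.inr 4) 1) = s(z .s3, z .s2)
      rw [z2, z3, a4.left, a4.right, Sym2.eq_swap]
  · intro p
    fin_cases p <;> exact subset_rfl
  · intro p e he heH
    fin_cases p
    · exact ⟨0, he⟩
    · exact ⟨1, he⟩
    · exact ⟨2, he⟩
    · exact ⟨3, he⟩
    · exact ⟨4, he⟩
    · obtain rfl := he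
      exact absurd heH hfH
  · intro p
    fin_cases p
    exacts [ncard_newBunch_inter_le 0 _, ncard_newBunch_inter_le 1 _, ncard_newBunch_inter_le 2 _,
      ncard_newBunch_inter_le 3 _, ncard_newBunch_inter_le 4 _]

end

end

/-! ### Criticality of an expansion -/

section

open Graph

section
variable {α β : Type*} {G : Graph α β} {s t₁ t₂ t₃ : α} (hs : G.IsExpandable s t₁ t₂ t₃)

theorem ncard_newBunch_inter_le_pred {p : Fin 6} {E : Set (β ⊕ NewEdge)} {e : β ⊕ NewEdge}
    (he : e ∈ newBunch p) (heE : e ∉ E) : (newBunch p ∩ E).ncard ≤ ![4, 4, 3, 1, 1, 1] p - 1 := by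
  rw [← ncard_newBunch, ← ncard_sdiff_singleton_of_mem he]
  refine ncard_le_ncard ?_ ((finite_newBunch p).subset sdiff_subset)
  rintro x ⟨hx, hxE⟩
  exact ⟨hx, fun hxe => heE (hxe ▸ hxE)⟩

/-- Deleting any edge of the expansion of a critical graph decreases the crossing number. -/
theorem crossingNumber_lt_of_notMem (hV : G.vertexSet.Finite) (hE : G.edgeSet.Finite) {m : ℕ}
    (hG : G.IsCrossingCritical m) {H : Graph (α ⊕ NewVertex) (β ⊕ NewEdge)}
    (hH : H ≤ G.expansion s t₁ t₂ t₃ hs) {e : β ⊕ NewEdge}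
    (he : e ∈ (G.expansion s t₁ t₂ t₃ hs).edgeSet) (heH : e ∉ H.edgeSet) :
    H.crossingNumber < m := by
  obtain ⟨F₁, F₂, F₃, h₁, h₂, h₃, d₁₂, d₁₃, d₂₃, hinc⟩ := id hs
  have hcls : ∀ e, G.Inc e s ↔ e ∈ F₁ ∨ e ∈ F₂ ∨ e ∈ F₃ := fun e => by
    rw [hinc, mem_union, mem_union, or_assoc]
  have hcls' : ∀ e, G.Inc e s ↔ e ∈ F₂ ∨ e ∈ F₁ ∨ e ∈ F₃ := fun e => by
    rw [hcls]; tauto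
  have n₁ := (IsThickEdge.finite_and_ncard h₁).2
  have n₂ := (IsThickEdge.finite_and_ncard h₂).2
  have hnot : ∀ {f}, G.Inc f s → .inl f ∉ H.edgeSet := fun hf hfH =>
    ((inl_mem_edgeSet_expansion hs).1 (Graph.IsSubgraph.edgeSet_mono hH hfH)).2 hf
  have hdel : ∀ {f : β} {F : Set β}, f ∉ F → (F \ {f}).ncard = F.ncard := fun hf => by
    rw [sdiff_singleton_eq_self hf]
  have hfar : ∀ p : Fin 7, s(newLeft α (![0, 1, 2, 3, 4, 5, 2] p),
      newRight t₁ t₂ t₃ (![0, 1, 2, 3, 4, 5, 2] p)) =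
      ![s(.inr .s1, .inl t₁), s(.inr .s2, .inl t₂), s(.inr .s2, .inr .s1), s(.inr .s3, .inr .s1),
        s(.inr .s2, .inr .s3), s(.inr .s3, .inl t₃), s(.inr .s2, .inr .s1)] p := by
    intro p
    fin_cases p <;> first | rfl | exact Sym2.eq_swap
  rcases e with f | n
  · obtain ⟨hf, hfs⟩ := (inl_mem_edgeSet_expansion hs).1 he
    have hfF : f ∉ F₁ ∧ f ∉ F₂ ∧ f ∉ F₃ := by
      rw [hcls] at hfs; tauto
    exact crossingNumber_lt_of_near hs hV hE hG hH h₁ h₂ h₃ d₁₂ d₁₃ d₂₃ hinc hf hfF.2.2 heH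
      (w₁ := 4) (w₂ := 4) (by norm_num) (by norm_num) (by rw [hdel hfF.1, n₁])
      (by rw [hdel hfF.2.1, n₂]) (ncard_newBunch_inter_le 0 _) (ncard_newBunch_inter_le 1 _)
  rcases n with i | i | i | _ | _ | _
  · obtain ⟨f, hf⟩ : F₁.Nonempty := nonempty_of_ncard_ne_zero (by rw [n₁]; norm_num)
    exact crossingNumber_lt_of_near hs hV hE hG hH h₁ h₂ h₃ d₁₂ d₁₃ d₂₃ hinc (h₁.2.2 f hf).edge_mem
      (disjoint_left.1 d₁₃ hf) (hnot ((hcls f).2 (Or.inl hf))) (w₁ := 3) (w₂ := 4) (by norm_num)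
      (by norm_num) (by rw [ncard_sdiff_singleton_of_mem hf, n₁])
      (by rw [hdel (disjoint_left.1 d₁₂ hf), n₂]) (ncard_newBunch_inter_le_pred ⟨i, rfl⟩ heH)
      (ncard_newBunch_inter_le 1 _)
  · obtain ⟨f, hf⟩ : F₂.Nonempty := nonempty_of_ncard_ne_zero (by rw [n₂]; norm_num)
    exact crossingNumber_lt_of_near hs hV hE hG hH h₁ h₂ h₃ d₁₂ d₁₃ d₂₃ hinc (h₂.2.2 f hf).edge_mem
      (disjoint_left.1 d₂₃ hf) (hnot ((hcls f).2 (Or.inr (Or.inl hf)))) (w₁ := 4) (w₂ := 3)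
      (by norm_num) (by norm_num) (by rw [hdel (disjoint_right.1 d₁₂ hf), n₁])
      (by rw [ncard_sdiff_singleton_of_mem hf, n₂]) (ncard_newBunch_inter_le 0 _)
      (ncard_newBunch_inter_le_pred ⟨i, rfl⟩ heH)
  · -- The three remaining copies of `s t₁` become the edge `s³s¹` and the two remaining edges `s¹s²`:
    -- one of these two is the middle copy, the other one lies on the side opposite to `s³s¹`.
    refine crossingNumber_lt_of_far hs hV hE hG hH h₁ h₂ h₃ d₁₂ d₁₃ d₂₃ hcls (v₁ := .s1) (v₂ := .s2)
      (by simp) (by simp) (by simp) hfar (F := ![newBunch 0, newBunch 1, {.inr (.s1s2 (i + 1))},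
        newBunch 3, newBunch 4, newBunch 5, {.inr (.s1s2 (i + 2))}]) ?_ ?_ (m := 1) (k := 1) rfl ?_
    · intro p
      fin_cases p
      exacts [subset_rfl, subset_rfl, singleton_subset_iff.2 ⟨_, rfl⟩, subset_rfl, subset_rfl,
        subset_rfl, singleton_subset_iff.2 ⟨_, rfl⟩]
    · intro p e he heH'
      fin_cases p
      · exact ⟨0, he⟩
      · exact ⟨1, he⟩
      · obtain ⟨j, rfl⟩ := he
        have hji : j ≠ i := by
          rintro rfl
          exact heH heH'
        have : j = i + 1 ∨ j = i + 2 := by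
          clear * - hji
          revert i j
          decide
        rcases this with rfl | rfl
        exacts [⟨2, rfl⟩, ⟨6, rfl⟩]
      · exact ⟨3, he⟩
      · exact ⟨4, he⟩
      · exact ⟨5, he⟩
    · have hone : ∀ x : β ⊕ NewEdge, ({x} ∩ H.edgeSet).ncard ≤ 1 := fun x =>
        (ncard_le_ncard inter_subset_left (finite_singleton _)).trans (ncard_singleton _).le
      intro p
      fin_cases p
      exacts [ncard_newBunch_inter_le 0 _, ncard_newBunch_inter_le 1 _, hone _,
        ncard_newBunch_inter_le 3 _, ncard_newBunch_inter_le 4 _, ncard_newBunch_inter_le 5 _, hone _]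
  · refine crossingNumber_lt_of_far hs hV hE hG hH h₁ h₂ h₃ d₁₂ d₁₃ d₂₃ hcls (v₁ := .s1) (v₂ := .s2)
      (by simp) (by simp) (by simp) hfar (F := ![newBunch 0, newBunch 1, newBunch 2,
        newBunch 3, newBunch 4, newBunch 5, ∅]) ?_ ?_ (m := 3) (k := 0) rfl ?_
    · intro p
      fin_cases p
      exacts [subset_rfl, subset_rfl, subset_rfl, subset_rfl, subset_rfl, subset_rfl, empty_subset _]
    · intro p e he _
      fin_cases p
      exacts [⟨0, he⟩, ⟨1, he⟩, ⟨2, he⟩, ⟨3, he⟩, ⟨4, he⟩, ⟨5, he⟩]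
    · intro p
      fin_cases p
      exacts [ncard_newBunch_inter_le 0 _, ncard_newBunch_inter_le 1 _, ncard_newBunch_inter_le 2 _,
        ncard_newBunch_inter_le_pred (p := 3) rfl heH, ncard_newBunch_inter_le 4 _,
        ncard_newBunch_inter_le 5 _, by simp]
  · refine crossingNumber_lt_of_far hs hV hE hG hH h₂ h₁ h₃ d₁₂.symm d₂₃ d₁₃ hcls' (v₁ := .s2)
      (v₂ := .s1) (by simp) (by simp) (by simp) (q := ![1, 0, 2, 4, 3, 5, 2]) ?_ (F := ![newBunch 1,
        newBunch 0, newBunch 2, newBunch 4, newBunch 3, newBunch 5, ∅]) ?_ ?_ (m := 3) (k := 0) rfl ?_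
    · intro p
      fin_cases p <;> first | rfl | exact Sym2.eq_swap
    · intro p
      fin_cases p
      exacts [subset_rfl, subset_rfl, subset_rfl, subset_rfl, subset_rfl, subset_rfl, empty_subset _]
    · intro p e he _
      fin_cases p
      exacts [⟨1, he⟩, ⟨0, he⟩, ⟨2, he⟩, ⟨4, he⟩, ⟨3, he⟩, ⟨5, he⟩]
    · intro p
      fin_cases p
      exacts [ncard_newBunch_inter_le 1 _, ncard_newBunch_inter_le 0 _, ncard_newBunch_inter_le 2 _,
        ncard_newBunch_inter_le_pred (p := 4) rfl heH, ncard_newBunch_inter_le 3 _,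
        ncard_newBunch_inter_le 5 _, by simp]
  · exact crossingNumber_lt_of_s3t3 hs hV hE hG hH h₁ h₂ h₃ d₁₂ d₁₃ d₂₃ hinc heH

/-- A critical graph has no isolated vertices, so a proper subgraph of its expansion lacks an edge. -/
theorem exists_edge_notMem (hV : G.vertexSet.Finite) (hE : G.edgeSet.Finite) {m : ℕ}
    (hG : G.IsCrossingCritical m) {H : Graph (α ⊕ NewVertex) (β ⊕ NewEdge)}
    (hH : H < G.expansion s t₁ t₂ t₃ hs) :
    ∃ e ∈ (G.expansion s t₁ t₂ t₃ hs).edgeSet, e ∉ H.edgeSet := by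
  by_contra! hall
  have hend : ∀ {e u v}, (G.expansion s t₁ t₂ t₃ hs).IsLink e u v → u ∈ H.vertexSet ∧ v ∈ H.vertexSet :=
    fun hl => by
      have := (Graph.IsSubgraph.isLink_iff hH.le (hall _ hl.edge_mem)).2 hl
      exact ⟨this.left_mem, this.right_mem⟩
  have hbunch : ∀ p, newLeft α p ∈ H.vertexSet ∧ newRight t₁ t₂ t₃ p ∈ H.vertexSet := fun p => by
    obtain ⟨e, he⟩ : (newBunch p : Set (β ⊕ NewEdge)).Nonempty := by
      refine nonempty_of_ncard_ne_zero ?_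
      rw [ncard_newBunch]
      revert p
      decide
    exact hend (isLink_newBunch hs p he)
  rcases Graph.vertexSet_ssubset_or_edgeSet_ssubset_of_lt hH with hlt | hlt
  · obtain ⟨v, hv, hvH⟩ := exists_of_ssubset hlt
    rcases v with v | v
    · rw [inl_mem_vertexSet_expansion] at hv
      obtain ⟨F₁, F₂, F₃, h₁, h₂, h₃, -, -, -, hinc⟩ := id hs
      have hiso : ∀ e, ¬ G.Inc e v := by
        rintro e ⟨w, hl⟩
        by_cases hes : G.Inc e s
        · have hvt : ∀ {t : α}, G.IsLink e s t → v = t := fun hst => by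
            rcases hl.left_eq_or_eq hst with h | h
            · exact absurd h hv.2
            · exact h
          rcases (hinc e).1 hes with (he | he) | he
          · exact hvH (hvt (h₁.2.2 e he) ▸ (hbunch 0).2)
          · exact hvH (hvt (h₂.2.2 e he) ▸ (hbunch 1).2)
          · exact hvH (hvt (h₃.2.2 e he) ▸ (hbunch 5).2)
        · refine hvH (hend (isLink_expansion_inl hs hl hv.2 ?_)).1
          rintro rfl
          exact hes hl.inc_right
      have hlt' : G.deleteVerts {v} < G := by
        refine lt_of_le_of_ne deleteVerts_le fun heq => ?_
        have : v ∈ (G.deleteVerts {v}).vertexSet := heq.symm ▸ hv.1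
        simp at this
      exact absurd (hG.1.trans (crossingNumber_le_deleteVerts hV hE hiso)) (not_le.2 (hG.2 _ hlt'))
    · rcases v with _ | _ | _
      exacts [hvH (hbunch 0).1, hvH (hbunch 1).1, hvH (hbunch 3).1]
  · obtain ⟨e, he, heH⟩ := exists_of_ssubset hlt
    exact heH (hall e he)

end

end

end PlaneDrawing

theorem mainTheorem5 {α : Type*} {β : Type*} (G : Graph α β)
    (hV : G.vertexSet.Finite) (hE : G.edgeSet.Finite)
    (hG : G.IsCrossingCritical 13)
    (s t₁ t₂ t₃ : α) (hs : G.IsExpandable s t₁ t₂ t₃) :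
    (G.expansion s t₁ t₂ t₃ hs).IsCrossingCritical 13 := by
  refine ⟨PlaneDrawing.thirteen_le_crossingNumber_expansion hV hE hG.1 hs, fun H hH => ?_⟩
  obtain ⟨e, he, heH⟩ := PlaneDrawing.exists_edge_notMem hs hV hE hG hH
  exact PlaneDrawing.crossingNumber_lt_of_notMem hs hV hE hG hH.le he heH
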